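/- **Model.** An asynchronous message-passing system consists of $n$ replicas and arbitrarily many clients. Clients invoke read and write operations of a register with initial value $v_0$, each client one operation at a time, and may crash permanently. Replicas may crash, losing their volatile state, and may restart, which makes them execute an *on restart* block; at a restart, a replica may also suffer a *rollback* failure, i.e. its non-volatile storage reverts to a content that it had earlier. Messages may be lost, delayed, reordered or duplicated, but are not forged. If two processes are permanently up from some time on, then every message sent from then on by one to the other is eventually delivered, and every process that is permanently up from some time on takes infinitely many steps. Processes have a primitive generating globally unique identifiers. A replica is *active* if it is up and is not executing its on restart block. A replica is *correct* if it is eventually permanently up and never rolls back, and *faulty* otherwise; a correct replica is *benign* if it crashes at least once. *The threshold $k$ holds from time $t$* if at most $k$ replicas are not eventually permanently up or roll back at time $t$ or later. An implementation is an *$\Diamond k$-tolerant atomic MWMR register* if it is linearizable in every execution in which the threshold $k$ holds from some (unknown) time on. It is *wait-free* in an execution if every operation invoked by a client that never crashes returns. **Algorithm $\mathcal D$.** It uses no non-volatile storage. A replica $i$ keeps a timestamp $ts$ (initially $(0,0)$; timestamps are ordered lexicographically), a value $val$ (initially $v_0$), two vectors $cv,pre\_cv\in\mathbb N^n$ (initially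 $0$) and a flag $stale$ (initially false). Requests carry fresh identifiers and are retransmitted until the respective call has enough answers. * read_quorum(req): send READ(req) to all replicas until $k+1$ of them have answered; return the answers. Only replicas with $stale=$ false answer, with $ts$, $(ts,val)$, $pre\_cv[j]$, $cv$ or the whole state, as requested; before answering a request State$(inc)$ of replica $j$, they set $cv[j]:=\max(cv[j],inc)$. * write_quorum(req): with a local vector $c=0$ and a set $Q=\emptyset$ of acknowledging replicas, repeat the following until $|Q|\ge n-k$. Send WRITE(req, $c[z]$) to each replica $z\notin Q$ until new acknowledgements from a set $M$ with $|Q\cup M|\ge n-k$ have been received; let $S$ be the set of crash vectors in the acknowledgements of $Q\cup M$ if req $=$ TSVal, and the answers of read_quorum(CV) if req is PreCV or CV; let $c$ be the entrywise maximum of $S$, and let $Q$ become the set of those $j\in Q\cup M$ whose acknowledged incarnation number is at least $c[j]$. * On WRITE(TSVal$(t,v)$, ·), a replica $i$ with $stale=$ false sets $(ts,val):=(t,v)$ if $t>ts$, and acknowledges with its incarnation number $cv[i]$ and with $cv$. On WRITE(PreCV$(j,m)$, $inc$) or WRITE(CV$(j,m)$, $inc$), a replica $i$, stale or not, sets $cv[i]:=\max(cv[i],inc)$,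 raises $pre\_cv[j]$, respectively $cv[j]$, to at least $m$, and acknowledges with $cv[i]$. * write($v$) by process $p$: obtain timestamps by read_quorum(TS), let $m$ be the largest counter among them, call write_quorum(TSVal$((m+1,p),v)$), return. read(): obtain pairs by read_quorum(TSVal), choose one with the largest timestamp, write it back by write_quorum(TSVal), return its value. * On restart, replica $i$ (with the initial state) sets $stale:=$ true; sets $m:=1+\max$ of the answers of read_quorum(PreCV$(i)$); calls write_quorum(PreCV$(i,m)$); sets $cv[i]:=m$; calls write_quorum(CV$(i,cv[i])$); obtains states by read_quorum(State$(cv[i])$); raises its $pre\_cv$, $cv$ entrywise, and $(ts,val)$, to the maxima received; sets $stale:=$ false. **Theorem.** Let $n,k,b$ be natural numbers with $n\ge 2k+b+1$. Then algorithm $\mathcal D$ with $n$ replicas and threshold $k$ is an $\Diamond k$-tolerant atomic MWMR register. It is wait-free in every execution in which (i) the threshold $k$ holds from the beginning and at most $b$ replicas are benign, or (ii) the threshold $k$ holds from some time on and at every time some $k+1$ eventually permanently up replicas are active. Its good-case latency is $4$ message delays, both for reads and for writes: in executions without replica crashes in which every message between processes that never crash takes at most one unit of time and local steps take none, every operation of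 a client that never crashes returns within $4$ units of time, and $4$ is the least bound with this property. -/

import Mathlib

/-! # Read/write registers over crash-restart-rollback prone replicas

The first part is the system model: processes, implementations (client and replica automata), runs,
failures, atomicity, wait freedom, good-case latency.  The second part is algorithm `D`. -/

namespace CRR

universe u

/-! ## Implementations -/

/-- The processes: `n` replicas, and clients (any number of which may be used in a run). -/
inductive Proc (n : ℕ) : Type
  | replica (i : Fin n)
  | client (c : ℕ)

/-- Operations of a read/write register. -/
inductive RegOp (V : Type u) : Type u
  | read
  | write (v : V)

/-- Responses of a read/write register: a value for a read, an acknowledgement for a write. -/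
inductive RegResp (V : Type u) : Type u
  | val (v : V)
  | ack

/-- Result of a local step of a client: new local state, messages sent (with their destinations),
and possibly the response to the pending operation. -/
structure ClientStep (n : ℕ) (V S M : Type u) : Type u where
  state : S
  sends : List (Proc n × M)
  resp : Option (RegResp V)

/-- Result of a local step of a replica: new volatile state, new content of the non-volatile
storage, messages sent. -/
structure ReplicaStep (n : ℕ) (S N M : Type u) : Type u where
  state : S
  stored : N
  sends : List (Proc n × M)

/-- An implementation of a register with value set `V` by `n` replicas: a client automaton and a
replica automaton.  Local steps are atomic.  They are triggered by the invocation of an operation,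
by the receipt of a message, by the process itself (a `tick`, used for retransmission), or by a
restart.  Every step has access to a globally unique identifier (the first `ℕ` argument after the
name of the process).  A restart only sees the non-volatile storage.  `inRestart s` says that the
`on restart` block has not been completed in the local state `s`. -/
structure Implementation (n : ℕ) (V : Type u) : Type (u + 1) where
  Msg : Type u
  ClientState : Type u
  ReplicaState : Type u
  Stored : Type u
  clientInit : ℕ → ClientState
  clientInvoke : ℕ → ℕ → RegOp V → ClientState → ClientStep n V ClientState Msg
  clientRecv : ℕ → ℕ → Proc n → Msg → ClientState → ClientStep n V ClientState Msg
  clientTick : ℕ → ℕ → ClientState → ClientStep n V ClientState Msg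
  replicaInit : Fin n → ReplicaState
  storedInit : Fin n → Stored
  replicaRecv : Fin n → ℕ → Proc n → Msg → ReplicaState → Stored →
    ReplicaStep n ReplicaState Stored Msg
  replicaTick : Fin n → ℕ → ReplicaState → Stored → ReplicaStep n ReplicaState Stored Msg
  replicaRestart : Fin n → ℕ → Stored → ReplicaStep n ReplicaState Stored Msg
  inRestart : ReplicaState → Prop

/-! ## Runs -/

section Runs

variable {n : ℕ} {V : Type u}

/-- A global configuration.  `pending c` says that client `c` has a pending operation. -/
structure Config (A : Implementation n V) : Type u where
  replica : Fin n → A.ReplicaState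
  stored : Fin n → A.Stored
  replicaUp : Fin n → Bool
  client : ℕ → A.ClientState
  clientUp : ℕ → Bool
  pending : ℕ → Bool

/-- Global actions.  `restart i rb d` restarts replica `i` with content `d` of its non-volatile
storage; `rb` tells whether this is a rollback failure.  `skip` changes nothing. -/
inductive Action (A : Implementation n V) : Type u
  | invoke (c : ℕ) (op : RegOp V)
  | deliver (src dst : Proc n) (m : A.Msg)
  | tick (p : Proc n)
  | crash (p : Proc n)
  | restart (i : Fin n) (rb : Bool) (d : A.Stored)
  | skip

/-- A message together with its sender and its destination. -/
structure Packet (A : Implementation n V) : Type u where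
  src : Proc n
  dst : Proc n
  msg : A.Msg

/-- The effect of an action: next configuration, packets sent, response given to a client. -/
structure Outcome (A : Implementation n V) : Type u where
  next : Config A
  sent : List (Packet A)
  resp : Option (ℕ × RegResp V)

variable {A : Implementation n V}

def Config.initial (A : Implementation n V) : Config A where
  replica := A.replicaInit
  stored := A.storedInit
  replicaUp := fun _ => true
  client := A.clientInit
  clientUp := fun _ => true
  pending := fun _ => false

/-- Process `p` is up in the configuration. -/
def Config.up (g : Config A) : Proc n → Prop
  | .replica i => g.replicaUp i = true
  | .client c => g.clientUp c = true

/-- The effect of a local step of client `c`; `busy` says whether `c` has a pending operation. -/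
def Config.clientOutcome (g : Config A) (c : ℕ) (busy : Bool)
    (r : ClientStep n V A.ClientState A.Msg) : Outcome A where
  next := { g with
    client := Function.update g.client c r.state
    pending := Function.update g.pending c (busy && r.resp.isNone) }
  sent := r.sends.map fun q => ⟨.client c, q.1, q.2⟩
  resp := r.resp.map fun x => (c, x)

/-- The effect of a local step of replica `i`. -/
def Config.replicaOutcome (g : Config A) (i : Fin n)
    (r : ReplicaStep n A.ReplicaState A.Stored A.Msg) : Outcome A where
  next := { g with
    replica := Function.update g.replica i r.state
    stored := Function.update g.stored i r.stored
    replicaUp := Function.update g.replicaUp i true }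
  sent := r.sends.map fun q => ⟨.replica i, q.1, q.2⟩
  resp := none

/-- The effect of an action in the configuration `g`, with unique identifier `x`. -/
def Config.perform (g : Config A) (x : ℕ) : Action A → Outcome A
  | .invoke c op => g.clientOutcome c true (A.clientInvoke c x op (g.client c))
  | .deliver src (.client c) m =>
      g.clientOutcome c (g.pending c) (A.clientRecv c x src m (g.client c))
  | .deliver src (.replica i) m =>
      g.replicaOutcome i (A.replicaRecv i x src m (g.replica i) (g.stored i))
  | .tick (.client c) => g.clientOutcome c (g.pending c) (A.clientTick c x (g.client c))
  | .tick (.replica i) => g.replicaOutcome i (A.replicaTick i x (g.replica i) (g.stored i))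
  | .crash (.client c) => ⟨{ g with clientUp := Function.update g.clientUp c false }, [], none⟩
  | .crash (.replica i) => ⟨{ g with replicaUp := Function.update g.replicaUp i false }, [], none⟩
  | .restart i _ d => g.replicaOutcome i (A.replicaRestart i x d)
  | .skip => ⟨g, [], none⟩

/-- Local enabledness: only processes that are up take steps or crash, only crashed replicas
restart, and a client invokes an operation only if its previous operation has returned. -/
def Config.Enabled (g : Config A) : Action A → Prop
  | .invoke c _ => g.up (.client c) ∧ g.pending c = false
  | .deliver _ dst _ => g.up dst
  | .tick p => g.up p
  | .crash p => g.up p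
  | .restart i _ _ => ¬ g.up (.replica i)
  | .skip => True

/-- A run: an infinite sequence of configurations and actions, one action per time step (a finite
execution is continued by `skip`).  Messages may be lost, delayed, reordered and duplicated, but a
delivered message has been sent before by its authenticated sender.  At a restart without rollback,
the non-volatile storage has the content it had when the replica crashed; at a restart with
rollback, it has a content that it had at some earlier time. -/
structure Run (A : Implementation n V) : Type u where
  cfg : ℕ → Config A
  act : ℕ → Action A
  uid : ℕ → ℕ
  uid_injective : Function.Injective uid
  cfg_zero : cfg 0 = Config.initial A
  cfg_succ : ∀ t, cfg (t + 1) = ((cfg t).perform (uid t) (act t)).next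
  enabled : ∀ t, (cfg t).Enabled (act t)
  deliver_sent : ∀ t src dst m, act t = .deliver src dst m →
    ∃ s < t, (⟨src, dst, m⟩ : Packet A) ∈ ((cfg s).perform (uid s) (act s)).sent
  restart_keep : ∀ t i d, act t = .restart i false d → d = (cfg t).stored i
  restart_rollback : ∀ t i d, act t = .restart i true d → ∃ s < t, d = (cfg s).stored i

namespace Run

variable (ρ : Run A)

/-- The packets sent at time `t`. -/
def sent (t : ℕ) : List (Packet A) := ((ρ.cfg t).perform (ρ.uid t) (ρ.act t)).sent

/-- The response given at time `t`, with the client that receives it. -/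
def resp (t : ℕ) : Option (ℕ × RegResp V) := ((ρ.cfg t).perform (ρ.uid t) (ρ.act t)).resp

def Up (p : Proc n) (t : ℕ) : Prop := (ρ.cfg t).up p

def NeverCrashes (p : Proc n) : Prop := ∀ t, ρ.act t ≠ .crash p

/-! ### Failures -/

def EventuallyUp (i : Fin n) : Prop := ∃ t, ∀ t' ≥ t, ρ.Up (.replica i) t'

/-- Replica `i` experiences a rollback failure at time `t` or later. -/
def RollsBackFrom (t : ℕ) (i : Fin n) : Prop := ∃ s ≥ t, ∃ d, ρ.act s = .restart i true d

/-- Replica `i` is faulty when failures before time `t` are disregarded. -/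
def FaultyFrom (t : ℕ) (i : Fin n) : Prop := ¬ ρ.EventuallyUp i ∨ ρ.RollsBackFrom t i

/-- A replica is correct if it is eventually up and never rolls back. -/
def Correct (i : Fin n) : Prop := ¬ ρ.FaultyFrom 0 i

/-- A replica is benign if it is correct and crashes at least once. -/
def Benign (i : Fin n) : Prop := ρ.Correct i ∧ ¬ ρ.NeverCrashes (.replica i)

/-- The failure threshold `k` holds from time `t` on. -/
def ThresholdFrom (k t : ℕ) : Prop := {i : Fin n | ρ.FaultyFrom t i}.ncard ≤ k

/-- At most `b` replicas are benign. -/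
def BenignBound (b : ℕ) : Prop := {i : Fin n | ρ.Benign i}.ncard ≤ b

/-- Replica `i` is up and not executing its `on restart` block. -/
def Active (i : Fin n) (t : ℕ) : Prop :=
  ρ.Up (.replica i) t ∧ ¬ A.inRestart ((ρ.cfg t).replica i)

/-- At every time, some `k + 1` replicas that are eventually up are active. -/
def AlwaysActive (k : ℕ) : Prop :=
  ∀ t, ∃ S : Finset (Fin n), S.card = k + 1 ∧ ∀ i ∈ S, ρ.EventuallyUp i ∧ ρ.Active i t

/-! ### Fairness and channels -/

/-- Every process that is permanently up from some time on takes infinitely many steps of its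
own. -/
def Fair : Prop :=
  ∀ p, (∃ t, ∀ t' ≥ t, ρ.Up p t') → ∀ t, ∃ t' ≥ t, ρ.act t' = .tick p

/-- If `p` and `q` are permanently up from time `t` on, then every message sent by `p` to `q` from
time `t` on is eventually delivered. -/
def ReliableChannels : Prop :=
  ∀ p q t, (∀ t' ≥ t, ρ.Up p t' ∧ ρ.Up q t') → ∀ s ≥ t, ∀ m,
    (⟨p, q, m⟩ : Packet A) ∈ ρ.sent s → ∃ r > s, ρ.act r = .deliver p q m

/-! ### Operations; an operation is named by the time of its invocation -/

/-- Operation `op` is invoked by client `c` at time `t`. -/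
def Invokes (t c : ℕ) (op : RegOp V) : Prop := ρ.act t = .invoke c op

/-- The operation invoked at time `t` returns `r` at time `s`. -/
def Returns (t s : ℕ) (r : RegResp V) : Prop :=
  ∃ c op, ρ.Invokes t c op ∧ t ≤ s ∧ ρ.resp s = some (c, r) ∧
    ∀ u, t ≤ u → u < s → ∀ r', ρ.resp u ≠ some (c, r')

/-- The operation invoked at time `t` is a write of `v`. -/
def IsWrite (t : ℕ) (v : V) : Prop := ∃ c, ρ.Invokes t c (.write v)

/-- The operation invoked at time `t` is a read. -/
def IsRead (t : ℕ) : Prop := ∃ c, ρ.Invokes t c .read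

/-- Linearizability with respect to a read/write register with initial value `v₀`: a set `L` of
operations that contains all complete ones is arranged in a sequence (`pos` gives the positions)
that respects the real-time order and in which every write returns an acknowledgement and every
read returns the value of the last preceding write, or `v₀` if there is none. -/
def Linearizable (v₀ : V) : Prop :=
  ∃ (L : Set ℕ) (pos : ℕ → ℕ),
    (∀ o ∈ L, ∃ c op, ρ.Invokes o c op) ∧
    (∀ o s r, ρ.Returns o s r → o ∈ L) ∧
    Set.InjOn pos L ∧
    (∀ o ∈ L, ∀ o' ∈ L, ∀ s r, ρ.Returns o s r → s < o' → pos o < pos o') ∧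
    (∀ o ∈ L, ∀ v s r, ρ.IsWrite o v → ρ.Returns o s r → r = .ack) ∧
    (∀ o ∈ L, ∀ s r, ρ.IsRead o → ρ.Returns o s r →
      (∃ w ∈ L, ∃ v, ρ.IsWrite w v ∧ r = .val v ∧ pos w < pos o ∧
        ∀ w' ∈ L, ∀ v', ρ.IsWrite w' v' → pos w' < pos o → pos w' ≤ pos w) ∨
      (r = .val v₀ ∧ ∀ w ∈ L, ∀ v, ρ.IsWrite w v → ¬ pos w < pos o))

/-- Every operation invoked by a client that never crashes returns. -/
def WaitFree : Prop :=
  ∀ t c op, ρ.Invokes t c op → ρ.NeverCrashes (.client c) → ∃ s r, ρ.Returns t s r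

/-- `τ` assigns real times to the steps of the run so that every message between processes that
never crash takes at most one unit of time; local steps take no time. -/
def UnitDelay (τ : ℕ → ℝ) : Prop :=
  Monotone τ ∧ ∀ p q, ρ.NeverCrashes p → ρ.NeverCrashes q → ∀ s m,
    (⟨p, q, m⟩ : Packet A) ∈ ρ.sent s → ∃ r > s, ρ.act r = .deliver p q m ∧ τ r ≤ τ s + 1

end Run

/-! ### Correctness of implementations -/

/-- `A` is an atomic `◇k`-tolerant register: it is linearizable in every run in which the failure
threshold `k` holds from some time on. -/
def Implementation.EventuallyTolerantAtomic (A : Implementation n V) (k : ℕ) (v₀ : V) : Prop :=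
  ∀ ρ : Run A, (∃ t, ρ.ThresholdFrom k t) → ρ.Linearizable v₀

/-- The good-case latency of the operations in `K` is `d` message delays: `d` is the least number
such that in every run without replica crashes in which messages take at most one unit of time,
every operation in `K` of a client that never crashes returns within `d` units of time. -/
def Implementation.GoodCaseLatency (A : Implementation n V) (K : Set (RegOp V)) (d : ℝ) : Prop :=
  IsLeast {x : ℝ | ∀ (ρ : Run A) (τ : ℕ → ℝ), (∀ i, ρ.NeverCrashes (.replica i)) →
    ρ.UnitDelay τ → ∀ t c, ∀ op ∈ K, ρ.Invokes t c op → ρ.NeverCrashes (.client c) →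
      ∃ s r, ρ.Returns t s r ∧ τ s ≤ τ t + x} d

end Runs

/-! ## Algorithm `D` -/

/-- Timestamps: a counter and the index of a client, ordered lexicographically. -/
abbrev TS : Type := ℕ ×ₗ ℕ

/-- Crash vectors. -/
abbrev CrashVec (n : ℕ) : Type := Fin n → ℕ

/-- The register copy and the crash vectors kept by a replica. -/
structure RegState (n : ℕ) (V : Type u) : Type u where
  ts : TS
  val : V
  cv : CrashVec n
  preCV : CrashVec n

inductive ReadReq (n : ℕ) : Type
  | ts
  | tsVal
  | preCV (j : Fin n)
  | cv
  | state (inc : ℕ)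

inductive ReadReply (n : ℕ) (V : Type u) : Type u
  | ts (t : TS)
  | tsVal (t : TS) (v : V)
  | preCV (m : ℕ)
  | cv (w : CrashVec n)
  | state (s : RegState n V)

inductive WriteReq (n : ℕ) (V : Type u) : Type u
  | tsVal (t : TS) (v : V)
  | preCV (j : Fin n) (m : ℕ)
  | cv (j : Fin n) (m : ℕ)

/-- Messages.  The sender of a message is known to its receiver and is not repeated in it.  In a
`writeAck`, `inc` is the incarnation number of the sender; a crash vector is only included in
acknowledgements of register writes. -/
inductive DMsg (n : ℕ) (V : Type u) : Type u
  | read (id : ℕ) (req : ReadReq n)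
  | readAck (id : ℕ) (x : ReadReply n V)
  | write (id : ℕ) (req : WriteReq n V) (inc : ℕ)
  | writeAck (id : ℕ) (inc : ℕ) (cv : Option (CrashVec n))

section AlgorithmD

variable {n : ℕ} {V : Type u}

def ReadReply.ts? : ReadReply n V → Option TS
  | .ts t => some t
  | _ => none

def ReadReply.tsVal? : ReadReply n V → Option (TS × V)
  | .tsVal t v => some (t, v)
  | _ => none

def ReadReply.preCV? : ReadReply n V → Option ℕ
  | .preCV m => some m
  | _ => none

def ReadReply.cv? : ReadReply n V → Option (CrashVec n)
  | .cv w => some w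
  | _ => none

def ReadReply.state? : ReadReply n V → Option (RegState n V)
  | .state s => some s
  | _ => none

/-- The number of replicas for which `f` has an entry. -/
def count {α : Type*} (f : Fin n → Option α) : ℕ :=
  (Finset.univ.filter fun j => (f j).isSome = true).card

/-- The list of the entries of `f`. -/
def entries {α : Type*} (f : Fin n → Option α) : List α := (List.finRange n).filterMap f

/-- The maximum of `g` over a list (`0` if the list is empty). -/
def maxOf {α : Type*} (g : α → ℕ) (l : List α) : ℕ := l.foldr (fun a m => max (g a) m) 0

/-! ### `read_quorum` -/

/-- A call of `read_quorum`: its identifier, its request, the replies received so far. -/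
structure ReadCall (n : ℕ) (V : Type u) : Type u where
  id : ℕ
  req : ReadReq n
  acks : Fin n → Option (ReadReply n V)

def ReadCall.start (id : ℕ) (req : ReadReq n) : ReadCall n V := ⟨id, req, fun _ => none⟩

/-- The messages broadcast (and rebroadcast) by a call of `read_quorum`. -/
def ReadCall.sends (q : ReadCall n V) : List (Proc n × DMsg n V) :=
  (List.finRange n).map fun z => (.replica z, .read q.id q.req)

def ReadCall.record (q : ReadCall n V) (j : Fin n) (x : ReadReply n V) : ReadCall n V :=
  { q with acks := Function.update q.acks j (some x) }

/-- A read quorum, of size `k + 1`, has replied. -/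
def ReadCall.complete (k : ℕ) (q : ReadCall n V) : Bool := decide (k + 1 ≤ count q.acks)

/-! ### `write_quorum` -/

/-- Content of an acknowledgement of a write: incarnation number and crash vector. -/
structure WAck (n : ℕ) : Type where
  inc : ℕ
  cv : Option (CrashVec n)

/-- A call of `write_quorum`: identifier, request, crash vector, the set `Q` (with the content of
the acknowledgements), the new acknowledgements `M`, and the inner call of `read_quorum` during the
validation of `Q` (`none` while the call waits for acknowledgements). -/
structure WriteCall (n : ℕ) (V : Type u) : Type u where
  id : ℕ
  req : WriteReq n V
  cv : CrashVec n
  Q : Fin n → Option (WAck n)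
  M : Fin n → Option (WAck n)
  inner : Option (ReadCall n V)

def WriteCall.start (id : ℕ) (req : WriteReq n V) : WriteCall n V :=
  ⟨id, req, fun _ => 0, fun _ => none, fun _ => none, none⟩

/-- The write messages, to all replicas outside `Q`. -/
def WriteCall.sends (w : WriteCall n V) : List (Proc n × DMsg n V) :=
  ((List.finRange n).filter fun z => (w.Q z).isNone).map fun z =>
    (.replica z, .write w.id w.req (w.cv z))

/-- The messages that are retransmitted in the current phase of the call. -/
def WriteCall.resend (w : WriteCall n V) : List (Proc n × DMsg n V) :=
  match w.inner with
  | none => w.sends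
  | some q => q.sends

/-- Of two acknowledgements of the same replica, keep one with the higher incarnation number. -/
def mergeAck (old new : Option (WAck n)) : Option (WAck n) :=
  match old, new with
  | none, y => y
  | some x, none => some x
  | some x, some y => if x.inc ≤ y.inc then some y else some x

/-- Result of a step of `write_quorum`. -/
structure WriteStep (n : ℕ) (V : Type u) : Type u where
  call : WriteCall n V
  sends : List (Proc n × DMsg n V)
  done : Bool

/-- End of an iteration of the loop, with crash vectors `S`: recompute `cv`, purge from `Q` the
replicas with an outdated incarnation number; return if `Q` still has `n - k` elements, otherwise
start the next iteration. -/
def WriteCall.validate (k : ℕ) (w : WriteCall n V) (S : List (CrashVec n)) : WriteStep n V :=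
  let cv : CrashVec n := fun z => maxOf (fun c => c z) S
  let w' : WriteCall n V := { w with
    cv := cv
    Q := fun j => (w.Q j).filter fun a => decide (cv j ≤ a.inc)
    inner := none }
  if n - k ≤ count w'.Q then ⟨w', [], true⟩ else ⟨w', w'.sends, false⟩

/-- Receipt of an acknowledgement `a` from replica `j`; `x` is a fresh identifier.  If the call is
waiting and a write quorum has been reached, `M` is merged into `Q` and validated, directly with the
crash vectors in the acknowledgements or, for requests of the recovery, with crash vectors obtained
by an inner `read_quorum`. -/
def WriteCall.onWriteAck (k x : ℕ) (w : WriteCall n V) (j : Fin n) (id : ℕ) (a : WAck n) :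
    WriteStep n V :=
  if id = w.id then
    let M : Fin n → Option (WAck n) := Function.update w.M j (mergeAck (w.M j) (some a))
    let Q : Fin n → Option (WAck n) := fun z => mergeAck (w.Q z) (M z)
    if w.inner.isNone ∧ n - k ≤ count Q then
      let w' : WriteCall n V := { w with Q := Q, M := fun _ => none }
      match w.req with
      | .tsVal _ _ => w'.validate k ((entries Q).filterMap WAck.cv)
      | _ =>
        let q : ReadCall n V := ReadCall.start x .cv
        ⟨{ w' with inner := some q }, q.sends, false⟩
    else ⟨{ w with M := M }, [], false⟩
  else ⟨w, [], false⟩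

/-- Receipt of a reply to the inner `read_quorum`. -/
def WriteCall.onReadAck (k : ℕ) (w : WriteCall n V) (j : Fin n) (id : ℕ) (y : ReadReply n V) :
    WriteStep n V :=
  match w.inner with
  | none => ⟨w, [], false⟩
  | some q =>
    if id = q.id then
      let q' := q.record j y
      if q'.complete k then w.validate k ((entries q'.acks).filterMap ReadReply.cv?)
      else ⟨{ w with inner := some q' }, [], false⟩
    else ⟨w, [], false⟩

/-! ### Clients -/

/-- Local state of a client: idle, executing the first phase of an operation, or executing the
second phase of an operation that is going to return `res`. -/
inductive DClient (n : ℕ) (V : Type u) : Type u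
  | idle
  | query (op : RegOp V) (q : ReadCall n V)
  | store (res : RegResp V) (w : WriteCall n V)

def dClientInvoke (_c x : ℕ) (op : RegOp V) (_s : DClient n V) :
    ClientStep n V (DClient n V) (DMsg n V) :=
  let q : ReadCall n V := ReadCall.start x
    (match op with
      | .read => .tsVal
      | .write _ => .ts)
  ⟨.query op q, q.sends, none⟩

/-- The second phase of an operation, started with the replies of a read quorum: a write of `v` by
client `c` (the process number `n + 1 + c`) stores `v` with a timestamp whose counter exceeds all
those received; a read stores a pair with the largest timestamp received and returns its value. -/
def dClientStore (v₀ : V) (c x : ℕ) (op : RegOp V) (acks : Fin n → Option (ReadReply n V)) :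
    ClientStep n V (DClient n V) (DMsg n V) :=
  match op with
  | .write v =>
    let cnt := maxOf (fun t : TS => (ofLex t).1) ((entries acks).filterMap ReadReply.ts?)
    let w : WriteCall n V := WriteCall.start x (.tsVal (toLex (cnt + 1, n + 1 + c)) v)
    ⟨.store .ack w, w.sends, none⟩
  | .read =>
    let p := (((entries acks).filterMap ReadReply.tsVal?).argmax Prod.fst).getD (toLex (0, 0), v₀)
    let w : WriteCall n V := WriteCall.start x (.tsVal p.1 p.2)
    ⟨.store (.val p.2) w, w.sends, none⟩

def dClientRecv (k : ℕ) (v₀ : V) (c x : ℕ) (src : Proc n) (m : DMsg n V) (s : DClient n V) :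
    ClientStep n V (DClient n V) (DMsg n V) :=
  match s, src, m with
  | .query op q, .replica j, .readAck id y =>
    if id = q.id then
      let q' := q.record j y
      if q'.complete k then dClientStore v₀ c x op q'.acks else ⟨.query op q', [], none⟩
    else ⟨s, [], none⟩
  | .store res w, .replica j, .writeAck id inc cv =>
    let r := w.onWriteAck k x j id ⟨inc, cv⟩
    if r.done then ⟨.idle, [], some res⟩ else ⟨.store res r.call, r.sends, none⟩
  | _, _, _ => ⟨s, [], none⟩

def dClientTick (_c _x : ℕ) (s : DClient n V) : ClientStep n V (DClient n V) (DMsg n V) :=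
  match s with
  | .idle => ⟨s, [], none⟩
  | .query _ q => ⟨s, q.sends, none⟩
  | .store _ w => ⟨s, w.resend, none⟩

/-! ### Replicas -/

/-- Control state of the `on restart` block: completed, or executing one of its four quorum
accesses. -/
inductive Recovery (n : ℕ) (V : Type u) : Type u
  | completed
  | readPre (q : ReadCall n V)
  | writePre (nextInc : ℕ) (w : WriteCall n V)
  | writeCV (w : WriteCall n V)
  | readState (q : ReadCall n V)

structure DReplica (n : ℕ) (V : Type u) : Type u where
  reg : RegState n V
  stale : Bool
  recovery : Recovery n V

def RegState.initial (v₀ : V) : RegState n V := ⟨toLex (0, 0), v₀, fun _ => 0, fun _ => 0⟩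

/-- `cv[j] := max (cv[j], m)` -/
def RegState.raiseCV (s : RegState n V) (j : Fin n) (m : ℕ) : RegState n V :=
  { s with cv := Function.update s.cv j (max (s.cv j) m) }

/-- `pre_cv[j] := max (pre_cv[j], m)` -/
def RegState.raisePreCV (s : RegState n V) (j : Fin n) (m : ℕ) : RegState n V :=
  { s with preCV := Function.update s.preCV j (max (s.preCV j) m) }

/-- Adopt a timestamp and value if the timestamp is larger than the current one. -/
def RegState.raiseTS (s : RegState n V) (t : TS) (v : V) : RegState n V :=
  if s.ts < t then { s with ts := t, val := v } else s

/-- The reply to a read request. -/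
def RegState.reply (s : RegState n V) : ReadReq n → ReadReply n V
  | .ts => .ts s.ts
  | .tsVal => .tsVal s.ts s.val
  | .preCV j => .preCV (s.preCV j)
  | .cv => .cv s.cv
  | .state _ => .state s

/-- Last step of the recovery: take the maximum with the states received from a read quorum. -/
def RegState.absorb (s : RegState n V) (S : List (RegState n V)) : RegState n V :=
  let s' : RegState n V := { s with
    preCV := fun z => max (s.preCV z) (maxOf (fun a => a.preCV z) S)
    cv := fun z => max (s.cv z) (maxOf (fun a => a.cv z) S) }
  match S.argmax RegState.ts with
  | none => s'
  | some a => s'.raiseTS a.ts a.val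

abbrev DStep (n : ℕ) (V : Type u) : Type u :=
  ReplicaStep n (DReplica n V) PUnit.{u + 1} (DMsg n V)

/-- Progress of `write_quorum(preCV(i, nextInc))` in the recovery of replica `i`. -/
def dAfterWritePre (i : Fin n) (x : ℕ) (s : DReplica n V) (nextInc : ℕ) (r : WriteStep n V) :
    DStep n V :=
  if r.done then
    let w : WriteCall n V := WriteCall.start x (.cv i nextInc)
    ⟨{ s with
        reg := { s.reg with cv := Function.update s.reg.cv i nextInc }
        recovery := .writeCV w }, ⟨⟩, w.sends⟩
  else ⟨{ s with recovery := .writePre nextInc r.call }, ⟨⟩, r.sends⟩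

/-- Progress of `write_quorum(CV(i, cv[i]))` in the recovery of replica `i`. -/
def dAfterWriteCV (i : Fin n) (x : ℕ) (s : DReplica n V) (r : WriteStep n V) : DStep n V :=
  if r.done then
    let q : ReadCall n V := ReadCall.start x (.state (s.reg.cv i))
    ⟨{ s with recovery := .readState q }, ⟨⟩, q.sends⟩
  else ⟨{ s with recovery := .writeCV r.call }, ⟨⟩, r.sends⟩

/-- Receipt of a read reply by a recovering replica. -/
def dOnReadAck (k : ℕ) (i : Fin n) (x : ℕ) (j : Fin n) (id : ℕ) (y : ReadReply n V)
    (s : DReplica n V) : DStep n V :=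
  match s.recovery with
  | .completed => ⟨s, ⟨⟩, []⟩
  | .readPre q =>
    if id = q.id then
      let q' := q.record j y
      if q'.complete k then
        let nextInc := maxOf (fun m => m) ((entries q'.acks).filterMap ReadReply.preCV?) + 1
        let w : WriteCall n V := WriteCall.start x (.preCV i nextInc)
        ⟨{ s with recovery := .writePre nextInc w }, ⟨⟩, w.sends⟩
      else ⟨{ s with recovery := .readPre q' }, ⟨⟩, []⟩
    else ⟨s, ⟨⟩, []⟩
  | .writePre nextInc w => dAfterWritePre i x s nextInc (w.onReadAck k j id y)
  | .writeCV w => dAfterWriteCV i x s (w.onReadAck k j id y)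
  | .readState q =>
    if id = q.id then
      let q' := q.record j y
      if q'.complete k then
        ⟨⟨s.reg.absorb ((entries q'.acks).filterMap ReadReply.state?), false, .completed⟩, ⟨⟩, []⟩
      else ⟨{ s with recovery := .readState q' }, ⟨⟩, []⟩
    else ⟨s, ⟨⟩, []⟩

/-- Receipt of a write acknowledgement by a recovering replica. -/
def dOnWriteAck (k : ℕ) (i : Fin n) (x : ℕ) (j : Fin n) (id : ℕ) (a : WAck n)
    (s : DReplica n V) : DStep n V :=
  match s.recovery with
  | .writePre nextInc w => dAfterWritePre i x s nextInc (w.onWriteAck k x j id a)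
  | .writeCV w => dAfterWriteCV i x s (w.onWriteAck k x j id a)
  | _ => ⟨s, ⟨⟩, []⟩

/-- Receipt of a message by replica `i`.  Read requests and register writes are ignored while the
replica is stale; requests of the recovery protocol are always served. -/
def dReplicaRecv (k : ℕ) (i : Fin n) (x : ℕ) (src : Proc n) (m : DMsg n V) (s : DReplica n V)
    (_d : PUnit.{u + 1}) : DStep n V :=
  match m with
  | .read id req =>
    if s.stale then ⟨s, ⟨⟩, []⟩
    else
      let reg' : RegState n V :=
        match req, src with
        | .state inc, .replica j => s.reg.raiseCV j inc
        | _, _ => s.reg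
      ⟨{ s with reg := reg' }, ⟨⟩, [(src, .readAck id (reg'.reply req))]⟩
  | .write id (.tsVal t v) _ =>
    if s.stale then ⟨s, ⟨⟩, []⟩
    else
      let reg' := s.reg.raiseTS t v
      ⟨{ s with reg := reg' }, ⟨⟩, [(src, .writeAck id (reg'.cv i) (some reg'.cv))]⟩
  | .write id (.preCV j m) inc =>
    let reg' := (s.reg.raiseCV i inc).raisePreCV j m
    ⟨{ s with reg := reg' }, ⟨⟩, [(src, .writeAck id (reg'.cv i) none)]⟩
  | .write id (.cv j m) inc =>
    let reg' := (s.reg.raiseCV i inc).raiseCV j m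
    ⟨{ s with reg := reg' }, ⟨⟩, [(src, .writeAck id (reg'.cv i) none)]⟩
  | .readAck id y =>
    match src with
    | .replica j => dOnReadAck k i x j id y s
    | .client _ => ⟨s, ⟨⟩, []⟩
  | .writeAck id inc cv =>
    match src with
    | .replica j => dOnWriteAck k i x j id ⟨inc, cv⟩ s
    | .client _ => ⟨s, ⟨⟩, []⟩

def dReplicaTick (_i : Fin n) (_x : ℕ) (s : DReplica n V) (_d : PUnit.{u + 1}) : DStep n V :=
  match s.recovery with
  | .completed => ⟨s, ⟨⟩, []⟩
  | .readPre q => ⟨s, ⟨⟩, q.sends⟩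
  | .writePre _ w => ⟨s, ⟨⟩, w.resend⟩
  | .writeCV w => ⟨s, ⟨⟩, w.resend⟩
  | .readState q => ⟨s, ⟨⟩, q.sends⟩

/-- Restart of replica `i`: the state is lost, the replica becomes stale and starts to recover. -/
def dReplicaRestart (v₀ : V) (i : Fin n) (x : ℕ) (_d : PUnit.{u + 1}) : DStep n V :=
  let q : ReadCall n V := ReadCall.start x (.preCV i)
  ⟨⟨RegState.initial v₀, true, .readPre q⟩, ⟨⟩, q.sends⟩

/-- Algorithm `D` for `n` replicas, failure threshold `k` and initial value `v₀`.  It does not use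
non-volatile storage. -/
def algorithmD (n k : ℕ) {V : Type u} (v₀ : V) : Implementation n V where
  Msg := DMsg n V
  ClientState := DClient n V
  ReplicaState := DReplica n V
  Stored := PUnit.{u + 1}
  clientInit := fun _ => .idle
  clientInvoke := dClientInvoke
  clientRecv := dClientRecv k v₀
  clientTick := dClientTick
  replicaInit := fun _ => ⟨RegState.initial v₀, false, .completed⟩
  storedInit := fun _ => ⟨⟩
  replicaRecv := dReplicaRecv k
  replicaTick := dReplicaTick
  replicaRestart := dReplicaRestart v₀
  inRestart := fun s => s.recovery ≠ .completed

end AlgorithmD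

end CRR

/-! Safety rests on one fact: a write quorum (`n - k` replicas) and a read quorum (`k + 1` replicas)
intersect. If replicas never lost their state, this would give the usual two-phase register with
timestamps. The difficulty is that a replica may acknowledge a write, forget it, and answer again
later.

The central result is `persist`: once a call of `write_quorum` has completed, every replica of the
validated quorum `Q` knows what was written, from its acknowledgement on, whenever it is not stale.
Suppose that `j` in `Q` restarted after its acknowledgement. To be no longer stale, it has adopted a
new incarnation number `m`, written CV(j, m) to a write quorum, and only then collected states from
a read quorum `R`. Let `l` be in `Q` and `R`. If `l` acknowledged before it answered `j`, it handed
the information to `j`, by induction. Otherwise `l` had learnt `m` before it acknowledged, since a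
State request raises its entry for `j`. Then some crash vector used to validate `Q` has an entry for
`j` of at least `m`: the one acknowledged by `l` (which recovers `m` from the quorum of CV(j, m) if
`l` restarted meanwhile), or that of a reader of CV which meets this quorum. But `j` acknowledged
with a number less than `m`, so the validation would have removed `j` from `Q`. That `m` exceeds the
numbers of all former incarnations is what `pre_cv` is for: each adopted number was first written
there to a write quorum, and a later incarnation reads it. This is again persistence, at earlier
times, so that everything is proved in one induction on time. A further ingredient is
`assigns_of_cv`: positive entries of crash vectors are always numbers that were really adopted.

Linearizability then follows as usual. Operations are ordered by the timestamp they store, a write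
before the reads of its value, reads by invocation time. By `persist`, an operation invoked after
the return of another one stores a timestamp that is at least as large, and larger if it is a write.

For termination, a replica that is eventually up adopts only finitely many incarnation numbers, so
its entry in the vector of an endless `write_quorum` reaches a maximum. Acknowledgements of requests
sent with this maximum carry at least this number: recovery requests raise it at the receiver, and
for register writes a recovered replica knows its own number (`assigns_le_cv`). As there are at
least `n - k` such replicas, a validation started late enough removes none of them and completes the
call (`Writing.absurd`). If `k + 1` active replicas stay up, the recoveries therefore end, then the
operations of clients. In case (i), at least `n - k - b ≥ k + 1` replicas never crash and are always
active.

For the latency, without crashes all crash vectors are zero, nothing is ever purged, and an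
operation takes two round trips. Conversely, in a run where every message takes exactly one unit of
time, a response ends a causal chain of four messages. -/

namespace CRR

universe u

variable {n k : ℕ} {V : Type u} {v₀ : V}

/-! ## Phases: the quorum access that a process is executing -/

/-- The quorum access that a client or a recovering replica is executing. -/
inductive Phase (n : ℕ) (V : Type u) : Type u
  | idle
  | rd (q : ReadCall n V)
  | wr (w : WriteCall n V)

namespace Phase

/-- The current call of `read_quorum`, possibly inside a call of `write_quorum`. -/
def read : Phase n V → Option (ReadCall n V)
  | idle => none
  | rd q => some q
  | wr w => w.inner

/-- The current call of `write_quorum`. -/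
def write : Phase n V → Option (WriteCall n V)
  | wr w => some w
  | _ => none

/-- The messages that are retransmitted in this phase. -/
def sends : Phase n V → List (Proc n × DMsg n V)
  | idle => []
  | rd q => q.sends
  | wr w => w.resend

/-- Either no quorum access, or one that has just been started with identifier `x`. -/
def Fresh (x : ℕ) (f : Phase n V) : Prop :=
  f = idle ∨ (∃ req, f = rd (ReadCall.start x req)) ∨ ∃ req, f = wr (WriteCall.start x req)

end Phase

def DClient.phase : DClient n V → Phase n V
  | .idle => .idle
  | .query _ q => .rd q
  | .store _ w => .wr w

def Recovery.phase : Recovery n V → Phase n V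
  | .completed => .idle
  | .readPre q => .rd q
  | .writePre _ w => .wr w
  | .writeCV w => .wr w
  | .readState q => .rd q

namespace Run

variable (ρ : Run (algorithmD n k v₀))

/-- The state of replica `l` at time `t`. -/
def rep (l : Fin n) (t : ℕ) : DReplica n V := (ρ.cfg t).replica l

/-- The register state of replica `l` at time `t`. -/
def reg (l : Fin n) (t : ℕ) : RegState n V := (ρ.rep l t).reg

def stale (l : Fin n) (t : ℕ) : Bool := (ρ.rep l t).stale

def recov (l : Fin n) (t : ℕ) : Recovery n V := (ρ.rep l t).recovery

/-- The state of client `c` at time `t`. -/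
def cl (c : ℕ) (t : ℕ) : DClient n V := (ρ.cfg t).client c

/-- The quorum access that process `p` is executing at time `t`. -/
def ph : Proc n → ℕ → Phase n V
  | .replica l, t => (ρ.recov l t).phase
  | .client c, t => (ρ.cl c t).phase

def Delivers (t : ℕ) (src dst : Proc n) (m : DMsg n V) : Prop := ρ.act t = .deliver src dst m

def Sends (t : ℕ) (src dst : Proc n) (m : DMsg n V) : Prop :=
  (⟨src, dst, m⟩ : Packet (algorithmD n k v₀)) ∈ ρ.sent t

def Restarts (t : ℕ) (i : Fin n) : Prop := ∃ rb d, ρ.act t = .restart i rb d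

/-! ### Single steps -/

lemma rep_zero (l : Fin n) : ρ.rep l 0 = ⟨RegState.initial v₀, false, .completed⟩ := by
  simp only [rep, ρ.cfg_zero]; rfl

lemma cl_zero (c : ℕ) : ρ.cl c 0 = .idle := by
  simp only [cl, ρ.cfg_zero]; rfl

lemma pending_zero (c : ℕ) : (ρ.cfg 0).pending c = false := by
  rw [ρ.cfg_zero]; rfl

lemma exists_sends_of_delivers {t : ℕ} {src dst : Proc n} {m : DMsg n V}
    (h : ρ.Delivers t src dst m) : ∃ s < t, ρ.Sends s src dst m :=
  ρ.deliver_sent t src dst m h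

lemma rep_deliver {t : ℕ} {src : Proc n} {l : Fin n} {m : DMsg n V}
    (h : ρ.Delivers t src (.replica l) m) :
    ρ.rep l (t + 1) = (dReplicaRecv k l (ρ.uid t) src m (ρ.rep l t) ⟨⟩).state := by
  simp only [rep, ρ.cfg_succ]
  rw [show ρ.act t = _ from h]
  simp only [Config.perform, Config.replicaOutcome, Function.update_self]
  rfl

lemma rep_restart {t : ℕ} {l : Fin n} (h : ρ.Restarts t l) :
    ρ.rep l (t + 1) =
      ⟨RegState.initial v₀, true, .readPre (ReadCall.start (ρ.uid t) (.preCV l))⟩ := by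
  obtain ⟨rb, d, h⟩ := h
  simp only [rep, ρ.cfg_succ, h]
  simp only [Config.perform, Config.replicaOutcome, Function.update_self]
  rfl

lemma dReplicaTick_state (i : Fin n) (x : ℕ) (s : DReplica n V) (d : PUnit.{u + 1}) :
    (dReplicaTick i x s d).state = s := by
  unfold dReplicaTick; split <;> rfl

lemma dReplicaTick_sends (i : Fin n) (x : ℕ) (s : DReplica n V) (d : PUnit.{u + 1}) :
    (dReplicaTick i x s d).sends = s.recovery.phase.sends := by
  unfold dReplicaTick; split <;> simp_all [Recovery.phase, Phase.sends]

lemma dClientTick_state (i : ℕ) (x : ℕ) (s : DClient n V) :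
    (dClientTick i x s).state = s := by
  unfold dClientTick; split <;> rfl

lemma dClientTick_resp (i : ℕ) (x : ℕ) (s : DClient n V) :
    (dClientTick i x s).resp = none := by
  unfold dClientTick; split <;> rfl

lemma dClientTick_sends (i : ℕ) (x : ℕ) (s : DClient n V) :
    (dClientTick i x s).sends = s.phase.sends := by
  unfold dClientTick; split <;> rfl

lemma rep_other {t : ℕ} {l : Fin n} (h : ∀ src m, ¬ ρ.Delivers t src (.replica l) m)
    (h' : ¬ ρ.Restarts t l) : ρ.rep l (t + 1) = ρ.rep l t := by
  simp only [rep, ρ.cfg_succ]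
  rcases ha : ρ.act t with ⟨c, op⟩ | ⟨src, ⟨j⟩ | ⟨c⟩, m⟩ | ⟨⟨j⟩ | ⟨c⟩⟩ | ⟨⟨j⟩ | ⟨c⟩⟩ | ⟨j, rb, d⟩ | _
  · rfl
  · have : l ≠ j := by rintro rfl; exact h _ _ ha
    simp [Config.perform, Config.replicaOutcome, Function.update_of_ne this]; rfl
  · rfl
  · by_cases hj : l = j
    · subst hj
      simp only [Config.perform, Config.replicaOutcome, Function.update_self]
      exact dReplicaTick_state l (ρ.uid t) (ρ.rep l t) ⟨⟩
    · simp [Config.perform, Config.replicaOutcome, Function.update_of_ne hj]; rfl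
  · rfl
  · rfl
  · rfl
  · have : l ≠ j := by rintro rfl; exact h' ⟨_, _, ha⟩
    simp [Config.perform, Config.replicaOutcome, Function.update_of_ne this]; rfl
  · rfl

lemma cl_deliver {t : ℕ} {src : Proc n} {c : ℕ} {m : DMsg n V}
    (h : ρ.Delivers t src (.client c) m) :
    ρ.cl c (t + 1) = (dClientRecv k v₀ c (ρ.uid t) src m (ρ.cl c t)).state := by
  simp only [cl, ρ.cfg_succ]
  rw [show ρ.act t = _ from h]
  simp only [Config.perform, Config.clientOutcome, Function.update_self]
  rfl

lemma cl_invoke {t : ℕ} {c : ℕ} {op : RegOp V} (h : ρ.Invokes t c op) :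
    ρ.cl c (t + 1) = (dClientInvoke c (ρ.uid t) op (ρ.cl c t)).state := by
  simp only [cl, ρ.cfg_succ]
  rw [show ρ.act t = _ from h]
  simp only [Config.perform, Config.clientOutcome, Function.update_self]
  rfl

lemma cl_other {t : ℕ} {c : ℕ} (h : ∀ src m, ¬ ρ.Delivers t src (.client c) m)
    (h' : ∀ op, ¬ ρ.Invokes t c op) : ρ.cl c (t + 1) = ρ.cl c t := by
  simp only [cl, ρ.cfg_succ]
  rcases ha : ρ.act t with ⟨d, op⟩ | ⟨src, ⟨j⟩ | ⟨d⟩, m⟩ | ⟨⟨j⟩ | ⟨d⟩⟩ | ⟨⟨j⟩ | ⟨d⟩⟩ | ⟨j, rb, d⟩ | _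
  · have : c ≠ d := by rintro rfl; exact h' _ ha
    simp [Config.perform, Config.clientOutcome, Function.update_of_ne this]; rfl
  · rfl
  · have : c ≠ d := by rintro rfl; exact h _ _ ha
    simp [Config.perform, Config.clientOutcome, Function.update_of_ne this]; rfl
  · rfl
  · by_cases hj : c = d
    · subst hj
      simp only [Config.perform, Config.clientOutcome, Function.update_self]
      exact dClientTick_state c (ρ.uid t) (ρ.cl c t)
    · simp [Config.perform, Config.clientOutcome, Function.update_of_ne hj]; rfl
  · rfl
  · rfl
  · rfl
  · rfl

/-- What the sender of a packet does in the step in which it sends the packet. -/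
lemma sends_cases {t : ℕ} {p d : Proc n} {m : DMsg n V} (h : ρ.Sends t p d m) :
    (∃ c op, p = .client c ∧ ρ.Invokes t c op ∧
      (d, m) ∈ (dClientInvoke c (ρ.uid t) op (ρ.cl c t)).sends) ∨
    (∃ c src m', p = .client c ∧ ρ.Delivers t src p m' ∧
      (d, m) ∈ (dClientRecv k v₀ c (ρ.uid t) src m' (ρ.cl c t)).sends) ∨
    (∃ l src m', p = .replica l ∧ ρ.Delivers t src p m' ∧
      (d, m) ∈ (dReplicaRecv k l (ρ.uid t) src m' (ρ.rep l t) ⟨⟩).sends) ∨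
    (∃ l, p = .replica l ∧ ρ.Restarts t l ∧
      (d, m) ∈ (ReadCall.start (V := V) (ρ.uid t) (.preCV l)).sends) ∨
    (ρ.act t = .tick p ∧ (d, m) ∈ (ρ.ph p t).sends) := by
  unfold Sends sent at h
  rcases ha : ρ.act t with ⟨c, op⟩ | ⟨src, ⟨j⟩ | ⟨c⟩, m'⟩ | ⟨⟨j⟩ | ⟨c⟩⟩ | ⟨⟨j⟩ | ⟨c⟩⟩ | ⟨j, rb, e⟩ | _ <;>
    rw [ha] at h <;>
    simp only [Config.perform, Config.clientOutcome, Config.replicaOutcome, List.mem_map,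
      List.not_mem_nil] at h
  · obtain ⟨⟨d', m''⟩, hq, rfl, rfl, rfl⟩ := h
    exact .inl ⟨c, op, rfl, ha, hq⟩
  · obtain ⟨⟨d', m''⟩, hq, rfl, rfl, rfl⟩ := h
    exact .inr (.inr (.inl ⟨j, src, m', rfl, ha, hq⟩))
  · obtain ⟨⟨d', m''⟩, hq, rfl, rfl, rfl⟩ := h
    exact .inr (.inl ⟨c, src, m', rfl, ha, hq⟩)
  · obtain ⟨⟨d', m''⟩, hq, rfl, rfl, rfl⟩ := h
    refine .inr (.inr (.inr (.inr ⟨rfl, ?_⟩)))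
    have := dReplicaTick_sends j (ρ.uid t) (ρ.rep j t) ⟨⟩
    simp only [ph, recov]
    rw [← this]; exact hq
  · obtain ⟨⟨d', m''⟩, hq, rfl, rfl, rfl⟩ := h
    refine .inr (.inr (.inr (.inr ⟨rfl, ?_⟩)))
    have := dClientTick_sends c (ρ.uid t) (ρ.cl c t)
    simp only [ph]
    rw [← this]; exact hq
  · obtain ⟨⟨d', m''⟩, hq, rfl, rfl, rfl⟩ := h
    exact .inr (.inr (.inr (.inl ⟨j, rfl, ⟨_, _, ha⟩, hq⟩)))

lemma sends_of_tick {t : ℕ} {p d : Proc n} {m : DMsg n V} (h : ρ.act t = .tick p)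
    (hm : (d, m) ∈ (ρ.ph p t).sends) : ρ.Sends t p d m := by
  unfold Sends sent
  rw [h]
  rcases p with ⟨l⟩ | ⟨c⟩ <;>
    simp only [Config.perform, Config.clientOutcome, Config.replicaOutcome, List.mem_map]
  · refine ⟨(d, m), ?_, rfl⟩
    have := dReplicaTick_sends l (ρ.uid t) (ρ.rep l t) ⟨⟩
    simp only [ph, recov] at hm
    rw [← this] at hm; exact hm
  · refine ⟨(d, m), ?_, rfl⟩
    have := dClientTick_sends c (ρ.uid t) (ρ.cl c t)
    simp only [ph] at hm
    rw [← this] at hm; exact hm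

lemma sends_of_invoke {t c : ℕ} {op : RegOp V} {d : Proc n} {m : DMsg n V} (h : ρ.Invokes t c op)
    (hm : (d, m) ∈ (dClientInvoke c (ρ.uid t) op (ρ.cl c t)).sends) :
    ρ.Sends t (.client c) d m := by
  unfold Sends sent
  rw [show ρ.act t = _ from h]
  exact List.mem_map.2 ⟨(d, m), hm, rfl⟩

lemma sends_of_cl_deliver {t c : ℕ} {src d : Proc n} {m m' : DMsg n V}
    (h : ρ.Delivers t src (.client c) m')
    (hm : (d, m) ∈ (dClientRecv k v₀ c (ρ.uid t) src m' (ρ.cl c t)).sends) :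
    ρ.Sends t (.client c) d m := by
  unfold Sends sent
  rw [show ρ.act t = _ from h]
  exact List.mem_map.2 ⟨(d, m), hm, rfl⟩

lemma sends_of_rep_deliver {t : ℕ} {l : Fin n} {src d : Proc n} {m m' : DMsg n V}
    (h : ρ.Delivers t src (.replica l) m')
    (hm : (d, m) ∈ (dReplicaRecv k l (ρ.uid t) src m' (ρ.rep l t) ⟨⟩).sends) :
    ρ.Sends t (.replica l) d m := by
  unfold Sends sent
  rw [show ρ.act t = _ from h]
  exact List.mem_map.2 ⟨(d, m), hm, rfl⟩

/-! ### Responses and pending operations -/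

lemma resp_eq_some {t c : ℕ} {r : RegResp V} :
    ρ.resp t = some (c, r) ↔ ∃ src m, ρ.Delivers t src (.client c) m ∧
      (dClientRecv k v₀ c (ρ.uid t) src m (ρ.cl c t)).resp = some r := by
  constructor
  · unfold resp Delivers
    intro h
    rcases ha : ρ.act t with ⟨d, op⟩ | ⟨src, ⟨j⟩ | ⟨d⟩, m'⟩ | ⟨⟨j⟩ | ⟨d⟩⟩ | ⟨⟨j⟩ | ⟨d⟩⟩ |
      ⟨j, rb, e⟩ | _ <;> rw [ha] at h <;>
      simp only [Config.perform, Config.clientOutcome, Config.replicaOutcome, reduceCtorEq,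
        Option.map_eq_some_iff, Prod.mk.injEq] at h
    · obtain ⟨a, h, -⟩ := h
      cases (show (none : Option (RegResp V)) = some a from h)
    · obtain ⟨a, h, rfl, rfl⟩ := h
      exact ⟨_, _, rfl, h⟩
    · obtain ⟨a, h, -⟩ := h
      have h : (dClientTick d (ρ.uid t) (ρ.cl d t)).resp = some a := h
      rw [dClientTick_resp] at h
      cases h
  · rintro ⟨src, m, h, hr⟩
    unfold resp
    rw [show ρ.act t = _ from h]
    simp only [Config.perform, Config.clientOutcome, Option.map_eq_some_iff]
    exact ⟨r, hr, rfl⟩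

lemma pending_invoke {t c : ℕ} {op : RegOp V} (h : ρ.Invokes t c op) :
    (ρ.cfg (t + 1)).pending c = true := by
  rw [ρ.cfg_succ, show ρ.act t = _ from h]
  simp only [Config.perform, Config.clientOutcome, Function.update_self]
  rfl

lemma pending_eq_false_of_invoke {t c : ℕ} {op : RegOp V} (h : ρ.Invokes t c op) :
    (ρ.cfg t).pending c = false := by
  have := ρ.enabled t
  rw [show ρ.act t = _ from h] at this
  exact this.2

lemma pending_resp {t c : ℕ} {r : RegResp V} (h : ρ.resp t = some (c, r)) :
    (ρ.cfg (t + 1)).pending c = false := by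
  obtain ⟨src, m, hd, hr⟩ := ρ.resp_eq_some.1 h
  rw [ρ.cfg_succ, show ρ.act t = _ from hd]
  simp only [Config.perform, Config.clientOutcome, Function.update_self]
  change (_ && Option.isNone (dClientRecv k v₀ c (ρ.uid t) src m (ρ.cl c t)).resp) = false
  rw [hr]; simp

lemma pending_other {t c : ℕ} (h : ∀ op, ¬ ρ.Invokes t c op) (h' : ∀ r, ρ.resp t ≠ some (c, r)) :
    (ρ.cfg (t + 1)).pending c = (ρ.cfg t).pending c := by
  rw [ρ.cfg_succ]
  rcases ha : ρ.act t with ⟨d, op⟩ | ⟨src, ⟨j⟩ | ⟨d⟩, m⟩ | ⟨⟨j⟩ | ⟨d⟩⟩ | ⟨⟨j⟩ | ⟨d⟩⟩ | ⟨j, rb, d⟩ | _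
  · have : c ≠ d := by rintro rfl; exact h _ ha
    simp [Config.perform, Config.clientOutcome, Function.update_of_ne this]
  · rfl
  · by_cases hj : c = d
    · subst hj
      simp only [Config.perform, Config.clientOutcome, Function.update_self]
      change (_ && Option.isNone (dClientRecv k v₀ c (ρ.uid t) src m (ρ.cl c t)).resp) = _
      rcases hr : (dClientRecv k v₀ c (ρ.uid t) src m (ρ.cl c t)).resp with _ | r
      · simp
      · exact absurd (ρ.resp_eq_some.2 ⟨src, m, ha, hr⟩) (h' r)
    · simp [Config.perform, Config.clientOutcome, Function.update_of_ne hj]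
  · rfl
  · by_cases hj : c = d
    · subst hj
      simp only [Config.perform, Config.clientOutcome, Function.update_self]
      change (_ && Option.isNone (dClientTick c (ρ.uid t) (ρ.cl c t)).resp) = _
      rw [dClientTick_resp]; simp
    · simp [Config.perform, Config.clientOutcome, Function.update_of_ne hj]
  · rfl
  · rfl
  · rfl
  · rfl

lemma not_up_of_restarts {t : ℕ} {i : Fin n} (h : ρ.Restarts t i) : ¬ ρ.Up (.replica i) t := by
  obtain ⟨rb, d, h⟩ := h
  have := ρ.enabled t
  rw [h] at this
  exact this

end Run

end CRR


namespace CRR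

universe u

variable {n k : ℕ} {V : Type u} {v₀ : V}

/-! ## Lists and counting -/

lemma le_maxOf {α : Type*} {g : α → ℕ} {l : List α} {a : α} (h : a ∈ l) : g a ≤ maxOf g l := by
  induction l with
  | nil => cases h
  | cons b l ih =>
    rcases List.mem_cons.1 h with rfl | h
    · exact le_max_left _ _
    · exact (ih h).trans (le_max_right _ _)

lemma maxOf_eq_zero_or_mem {α : Type*} (g : α → ℕ) (l : List α) :
    maxOf g l = 0 ∨ ∃ a ∈ l, maxOf g l = g a := by
  induction l with
  | nil => exact .inl rfl
  | cons b l ih =>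
    change max (g b) (maxOf g l) = 0 ∨ ∃ a ∈ b :: l, max (g b) (maxOf g l) = g a
    rcases le_total (maxOf g l) (g b) with h | h
    · exact .inr ⟨b, by simp, max_eq_left h⟩
    · rw [max_eq_right h]
      rcases ih with ih | ⟨a, ha, e⟩
      · exact .inl ih
      · exact .inr ⟨a, by simp [ha], e⟩

lemma mem_entries {α : Type*} {f : Fin n → Option α} {a : α} :
    a ∈ entries f ↔ ∃ j, f j = some a := by
  simp [entries]

lemma mergeAck_eq_some {x y : Option (WAck n)} {a : WAck n} (h : mergeAck x y = some a) :
    x = some a ∨ y = some a := by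
  unfold mergeAck at h
  split at h
  · exact .inr h
  · exact .inl h
  · split at h
    · exact .inr h
    · exact .inl h

/-- A merge keeps the higher incarnation number, so an acknowledgement good enough for a validation
is never replaced by a worse one. Termination depends on this. -/
lemma mergeAck_good {x y : Option (WAck n)} {a : WAck n} (h : x = some a ∨ y = some a) :
    ∃ a', mergeAck x y = some a' ∧ a.inc ≤ a'.inc := by
  rcases h with rfl | rfl
  · rcases y with _ | b
    · exact ⟨a, rfl, le_rfl⟩
    · by_cases hab : a.inc ≤ b.inc
      · exact ⟨b, by simp [mergeAck, hab], hab⟩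
      · exact ⟨a, by simp [mergeAck, hab], le_rfl⟩
  · rcases x with _ | b
    · exact ⟨a, rfl, le_rfl⟩
    · by_cases hab : b.inc ≤ a.inc
      · exact ⟨a, by simp [mergeAck, hab], le_rfl⟩
      · exact ⟨b, by simp [mergeAck, hab], by omega⟩

lemma mem_readCall_sends {q : ReadCall n V} {d : Proc n} {m : DMsg n V} :
    (d, m) ∈ q.sends ↔ ∃ z, d = .replica z ∧ m = .read q.id q.req := by
  simp only [ReadCall.sends, List.mem_map, List.mem_finRange, true_and, Prod.mk.injEq]
  exact ⟨fun ⟨z, h, h'⟩ => ⟨z, h.symm, h'.symm⟩, fun ⟨z, h, h'⟩ => ⟨z, h.symm, h'.symm⟩⟩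

lemma mem_writeCall_sends {w : WriteCall n V} {d : Proc n} {m : DMsg n V} :
    (d, m) ∈ w.sends ↔ ∃ z, w.Q z = none ∧ d = .replica z ∧ m = .write w.id w.req (w.cv z) := by
  simp only [WriteCall.sends, List.mem_map, List.mem_filter, List.mem_finRange, true_and,
    Prod.mk.injEq, Option.isNone_iff_eq_none]
  exact ⟨fun ⟨z, h₀, h, h'⟩ => ⟨z, h₀, h.symm, h'.symm⟩, fun ⟨z, h₀, h, h'⟩ => ⟨z, h₀, h.symm, h'.symm⟩⟩

/-- A message of a caller of a quorum access (a request, not an acknowledgement). -/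
def DMsg.IsRequest : DMsg n V → Prop
  | .read _ _ => True
  | .write _ _ _ => True
  | _ => False

/-! ### The transitions of a call of `write_quorum` -/

namespace WriteCall

lemma validate_done {w : WriteCall n V} {S : List (CrashVec n)} (h : (w.validate k S).done = false) :
    (w.validate k S).sends = (w.validate k S).call.sends := by
  unfold validate at h ⊢
  dsimp only at h ⊢
  split_ifs at h ⊢
  rfl

lemma validate_call (w : WriteCall n V) (S : List (CrashVec n)) :
    (w.validate k S).call = { w with
      cv := fun z => maxOf (fun c => c z) S
      Q := fun j => (w.Q j).filter fun a => decide (maxOf (fun c => c j) S ≤ a.inc)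
      inner := none } := by
  unfold validate
  dsimp only
  split <;> rfl

lemma validate_done_iff {w : WriteCall n V} {S : List (CrashVec n)} :
    (w.validate k S).done = true ↔ n - k ≤ count (w.validate k S).call.Q := by
  rw [validate_call]
  unfold validate
  dsimp only
  split <;> simp_all

/-- The call when the acknowledgements `M`, together with a new one, have been merged into `Q`. -/
def merged (w : WriteCall n V) (j : Fin n) (a : WAck n) : WriteCall n V :=
  { w with
    Q := fun z => mergeAck (w.Q z) (Function.update w.M j (mergeAck (w.M j) (some a)) z)
    M := fun _ => none }

/-- The call when a new acknowledgement has been added to `M`. -/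
def collect (w : WriteCall n V) (j : Fin n) (a : WAck n) : WriteCall n V :=
  { w with M := Function.update w.M j (mergeAck (w.M j) (some a)) }

/-- On a message `m` from replica `j`, the call `w` validates its set `Q` (as recorded in `w'`) with
the crash vectors `S`. -/
inductive Validates (k : ℕ) (j : Fin n) :
    DMsg n V → WriteCall n V → WriteCall n V → List (CrashVec n) → Prop
  | direct (w : WriteCall n V) (a : WAck n) (h : w.inner = none)
      (hc : n - k ≤ count (w.merged j a).Q) (hreq : ∃ T v, w.req = .tsVal T v) :
      Validates k j (.writeAck w.id a.inc a.cv) w (w.merged j a)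
        ((entries (w.merged j a).Q).filterMap WAck.cv)
  | inner (w : WriteCall n V) (q : ReadCall n V) (y : ReadReply n V) (h : w.inner = some q)
      (hc : (q.record j y).complete k) :
      Validates k j (.readAck q.id y) w w ((entries (q.record j y).acks).filterMap ReadReply.cv?)

/-- The steps of a call of `write_quorum` that do not complete it. -/
inductive Step (k x : ℕ) (j : Fin n) : DMsg n V → WriteCall n V → WriteCall n V → Prop
  | same (m w) (h : ∀ a cv, m ≠ .writeAck w.id a cv)
      (h' : ∀ q y, w.inner = some q → m ≠ .readAck q.id y) : Step k x j m w w
  | collect (w : WriteCall n V) (a : WAck n)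
      (h : w.inner = none → count (w.merged j a).Q < n - k) :
      Step k x j (.writeAck w.id a.inc a.cv) w (w.collect j a)
  | openRead (w : WriteCall n V) (a : WAck n) (h : w.inner = none)
      (hc : n - k ≤ count (w.merged j a).Q) (hreq : ∀ T v, w.req ≠ .tsVal T v) :
      Step k x j (.writeAck w.id a.inc a.cv) w
        { w.merged j a with inner := some (ReadCall.start x .cv) }
  | record (w : WriteCall n V) (q : ReadCall n V) (y : ReadReply n V) (h : w.inner = some q)
      (hc : ¬ (q.record j y).complete k) :
      Step k x j (.readAck q.id y) w { w with inner := some (q.record j y) }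
  | validate (m w w' S) (h : Validates k j m w w' S) (hd : (w'.validate k S).done = false) :
      Step k x j m w (w'.validate k S).call

/-- The steps that complete a call of `write_quorum`. -/
def Finish (k : ℕ) (j : Fin n) (m : DMsg n V) (w : WriteCall n V) : Prop :=
  ∃ w' S, Validates k j m w w' S ∧ (w'.validate k S).done = true

/-- The steps of a call, together with the messages sent. -/
def Move (k x : ℕ) (j : Fin n) (m : DMsg n V) (w : WriteCall n V) (r : WriteStep n V) : Prop :=
  (r.done = false ∧ Step k x j m w r.call ∧ (∀ e ∈ r.sends, e ∈ r.call.resend) ∧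
    ∀ w' S, Validates k j m w w' S → ∀ e ∈ r.call.resend, e ∈ r.sends) ∨
  (r.done = true ∧ Finish k j m w)

lemma not_validates {j : Fin n} {w w' : WriteCall n V} {m : DMsg n V} {S : List (CrashVec n)}
    (h : ∀ a cv, m ≠ .writeAck w.id a cv) (h' : ∀ q y, w.inner = some q → m ≠ .readAck q.id y) :
    ¬ Validates k j m w w' S := by
  rintro (⟨_, a, _, _, _⟩ | ⟨_, q, y, hq, _⟩)
  · exact h _ _ rfl
  · exact h' _ _ hq rfl

lemma move_same {j : Fin n} {w : WriteCall n V} {m : DMsg n V} (x : ℕ)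
    (h : ∀ a cv, m ≠ .writeAck w.id a cv) (h' : ∀ q y, w.inner = some q → m ≠ .readAck q.id y) :
    Move k x j m w ⟨w, [], false⟩ :=
  .inl ⟨rfl, .same _ _ h h', by simp, fun _ _ hv => absurd hv (not_validates h h')⟩

lemma move_validate {j : Fin n} {m : DMsg n V} {w w' : WriteCall n V} {S : List (CrashVec n)}
    (x : ℕ) (h : Validates k j m w w' S) : Move k x j m w (w'.validate k S) := by
  rcases hd : (w'.validate k S).done
  · have h' : (w'.validate k S).call.inner = none := by rw [validate_call]
    refine .inl ⟨hd, .validate _ _ _ _ h hd, ?_⟩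
    rw [resend, h', validate_done hd]
    simp
  · exact .inr ⟨hd, _, _, h, hd⟩

lemma onReadAck_move (w : WriteCall n V) (x : ℕ) (j : Fin n) (id : ℕ) (y : ReadReply n V) :
    Move k x j (.readAck id y) w (w.onReadAck k j id y) := by
  unfold onReadAck
  rcases h : w.inner with _ | q
  · exact move_same x (by simp) (by simp [h])
  · dsimp only
    by_cases hid : id = q.id
    · subst hid
      rw [if_pos rfl]
      by_cases hc : (q.record j y).complete k = true
      · rw [if_pos hc]
        exact move_validate x (.inner w q y h hc)
      · rw [if_neg hc]
        refine .inl ⟨rfl, .record w q y h hc, by simp, ?_⟩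
        intro w' S hv
        generalize hm : (DMsg.readAck q.id y : DMsg n V) = m at hv
        rcases hv with ⟨_, a, _, _, _⟩ | ⟨_, q', y', hq, hc'⟩
        · cases hm
        · rw [h] at hq; cases hq; cases hm; exact absurd hc' hc
    · rw [if_neg hid]
      exact move_same x (by simp) (by simp [h, hid])

lemma onWriteAck_move (w : WriteCall n V) (x : ℕ) (j : Fin n) (id : ℕ) (a : WAck n) :
    Move k x j (.writeAck id a.inc a.cv) w (w.onWriteAck k x j id a) := by
  unfold onWriteAck
  by_cases hid : id = w.id
  · subst hid
    rw [if_pos rfl]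
    dsimp only
    split_ifs with hc
    · have hin : w.inner = none := by simpa using hc.1
      split
      · rename_i T v hreq
        exact move_validate x (.direct w a hin hc.2 ⟨T, v, hreq⟩)
      · rename_i hreq
        exact .inl ⟨rfl, .openRead w a hin hc.2 hreq, fun m hm => hm, fun _ _ _ m hm => hm⟩
    · have hc' : w.inner = none → count (w.merged j a).Q < n - k := by
        intro hin
        by_contra hlt
        exact hc ⟨by simp [hin], not_lt.1 hlt⟩
      refine .inl ⟨rfl, .collect w a hc', by simp, ?_⟩
      intro w' S hv
      generalize hm : (DMsg.writeAck w.id a.inc a.cv : DMsg n V) = m at hv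
      rcases hv with ⟨_, a', h, hc'', _⟩ | ⟨_, q', y', hq, _⟩
      · obtain ⟨i, c⟩ := a
        obtain ⟨i', c'⟩ := a'
        cases hm
        exact absurd (hc' h) (not_lt.2 hc'')
      · cases hm
  · rw [if_neg hid]
    exact move_same x (by simp [hid]) (by simp)

end WriteCall

/-! ### The transitions of a quorum access -/

namespace Phase

/-- The steps of a quorum access, caused by a message `m` from replica `j`, that do not complete
it. -/
inductive Step (k x : ℕ) (j : Fin n) (m : DMsg n V) : Phase n V → Phase n V → Prop
  | idle : Step k x j m idle idle
  | same (q : ReadCall n V) (h : ∀ y, m ≠ .readAck q.id y) : Step k x j m (rd q) (rd q)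
  | record (q : ReadCall n V) (y : ReadReply n V) (hm : m = .readAck q.id y)
      (hc : ¬ (q.record j y).complete k) : Step k x j m (rd q) (rd (q.record j y))
  | wr (w w' : WriteCall n V) (h : WriteCall.Step k x j m w w') : Step k x j m (wr w) (wr w')

/-- The steps that complete a quorum access. -/
inductive Finish (k : ℕ) (j : Fin n) (m : DMsg n V) : Phase n V → Prop
  | rd (q : ReadCall n V) (y : ReadReply n V) (hm : m = .readAck q.id y)
      (hc : (q.record j y).complete k) : Finish k j m (rd q)
  | wr (w : WriteCall n V) (h : WriteCall.Finish k j m w) : Finish k j m (wr w)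

/-- The steps of a quorum access, together with the list of messages sent. -/
def Move (k x : ℕ) (j : Fin n) (m : DMsg n V) (f f' : Phase n V) (l : List (Proc n × DMsg n V)) :
    Prop :=
  (∀ e ∈ l, e.2.IsRequest → e ∈ f'.sends) ∧
  ((Step k x j m f f' ∧ ∀ w w' S, f = wr w → WriteCall.Validates k j m w w' S →
      ∀ e ∈ f'.sends, e ∈ l) ∨
    (Finish k j m f ∧ Fresh x f' ∧ ∀ e ∈ f'.sends, e ∈ l))

lemma move_same {j : Fin n} {m : DMsg n V} (x : ℕ) (f : Phase n V)
    {l : List (Proc n × DMsg n V)} (hl : ∀ e ∈ l, ¬ e.2.IsRequest)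
    (h : ∀ q, f.read = some q → ∀ y, m ≠ .readAck q.id y)
    (h' : ∀ w, f.write = some w → ∀ a cv, m ≠ .writeAck w.id a cv) : Move k x j m f f l := by
  refine ⟨fun e he hr => absurd hr (hl e he), .inl ⟨?_, ?_⟩⟩
  · rcases f with _ | q | w
    · exact .idle
    · exact .same q (h q rfl)
    · exact .wr w w (.same _ _ (h' w rfl) fun q y hq => h q hq y)
  · rintro w w' S rfl hv
    exact absurd hv (WriteCall.not_validates (h' w rfl) fun q y hq => h q hq y)

lemma move_finish {x : ℕ} {j : Fin n} {m : DMsg n V} {f f' : Phase n V}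
    {l : List (Proc n × DMsg n V)} (h : Finish k j m f) (h' : Fresh x f')
    (hl : ∀ e, e ∈ l ↔ e ∈ f'.sends) : Move k x j m f f' l :=
  ⟨fun e he _ => (hl e).1 he, .inr ⟨h, h', fun e he => (hl e).2 he⟩⟩

lemma move_of_step {x : ℕ} {j : Fin n} {m : DMsg n V} {w : WriteCall n V} {r : WriteStep n V}
    (h : WriteCall.Move k x j m w r) (hd : ¬ r.done = true) :
    Move k x j m (wr w) (wr r.call) r.sends := by
  rcases h with ⟨-, hs, h1, h2⟩ | ⟨h, -⟩
  · exact ⟨fun e he _ => h1 e he, .inl ⟨.wr _ _ hs, fun w₁ w' S e hv => by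
      cases e; exact h2 w' S hv⟩⟩
  · exact absurd h hd

lemma finish_of_done {x : ℕ} {j : Fin n} {m : DMsg n V} {w : WriteCall n V} {r : WriteStep n V}
    (h : WriteCall.Move k x j m w r) (hd : r.done = true) : Finish k j m (wr w) := by
  rcases h with ⟨h, -⟩ | ⟨-, h⟩
  · rw [h] at hd; cases hd
  · exact .wr _ h

end Phase

/-! ## Moves of clients and replicas -/

lemma dAfterWritePre_move {i : Fin n} {x : ℕ} {s : DReplica n V} {m : ℕ} {w : WriteCall n V}
    {r : WriteStep n V} {j : Fin n} {msg : DMsg n V}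
    (h : WriteCall.Move k x j msg w r) :
    Phase.Move k x j msg (.wr w) (dAfterWritePre i x s m r).state.recovery.phase
      (dAfterWritePre i x s m r).sends := by
  unfold dAfterWritePre
  split_ifs with hd
  · exact Phase.move_finish (Phase.finish_of_done h hd) (.inr (.inr ⟨_, rfl⟩)) fun e => Iff.rfl
  · exact Phase.move_of_step h hd

lemma dAfterWriteCV_move {i : Fin n} {x : ℕ} {s : DReplica n V} {w : WriteCall n V}
    {r : WriteStep n V} {j : Fin n} {msg : DMsg n V}
    (h : WriteCall.Move k x j msg w r) :
    Phase.Move k x j msg (.wr w) (dAfterWriteCV i x s r).state.recovery.phase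
      (dAfterWriteCV i x s r).sends := by
  unfold dAfterWriteCV
  split_ifs with hd
  · exact Phase.move_finish (Phase.finish_of_done h hd) (.inr (.inl ⟨_, rfl⟩)) fun e => Iff.rfl
  · exact Phase.move_of_step h hd

lemma Phase.move_record {x : ℕ} {j : Fin n} {q : ReadCall n V} {y : ReadReply n V}
    (hc : ¬ (q.record j y).complete k = true) :
    Phase.Move k x j (.readAck q.id y) (.rd q) (.rd (q.record j y)) [] :=
  ⟨by simp, .inl ⟨.record q y rfl hc, by simp⟩⟩

lemma dOnReadAck_move (i : Fin n) (x : ℕ) (j : Fin n) (id : ℕ) (y : ReadReply n V)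
    (s : DReplica n V) :
    Phase.Move k x j (.readAck id y) s.recovery.phase
      (dOnReadAck k i x j id y s).state.recovery.phase (dOnReadAck k i x j id y s).sends := by
  unfold dOnReadAck
  split <;> rename_i hs
  · exact Phase.move_same x _ (by simp) (by simp [hs, Recovery.phase, Phase.read])
      (by simp)
  · rename_i q
    simp only [hs]
    by_cases hid : id = q.id
    · subst hid
      rw [if_pos rfl]
      split_ifs with hc
      · exact Phase.move_finish (.rd _ y rfl hc) (.inr (.inr ⟨_, rfl⟩)) fun e => Iff.rfl
      · exact Phase.move_record hc
    · rw [if_neg hid]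
      simp only [hs]
      exact Phase.move_same x _ (by simp) (by simp [Recovery.phase, Phase.read, hid]) (by simp)
  · rw [hs]
    exact dAfterWritePre_move (WriteCall.onReadAck_move _ _ _ _ _)
  · rw [hs]
    exact dAfterWriteCV_move (WriteCall.onReadAck_move _ _ _ _ _)
  · rename_i q
    simp only [hs]
    by_cases hid : id = q.id
    · subst hid
      rw [if_pos rfl]
      split_ifs with hc
      · exact Phase.move_finish (.rd _ y rfl hc) (.inl rfl) fun e => Iff.rfl
      · exact Phase.move_record hc
    · rw [if_neg hid]
      simp only [hs]
      exact Phase.move_same x _ (by simp) (by simp [Recovery.phase, Phase.read, hid]) (by simp)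

lemma dOnWriteAck_move (i : Fin n) (x : ℕ) (j : Fin n) (id : ℕ) (a : WAck n)
    (s : DReplica n V) :
    Phase.Move k x j (.writeAck id a.inc a.cv) s.recovery.phase
      (dOnWriteAck k i x j id a s).state.recovery.phase (dOnWriteAck k i x j id a s).sends := by
  unfold dOnWriteAck
  split <;> rename_i hs
  · rw [hs]
    exact dAfterWritePre_move (WriteCall.onWriteAck_move _ _ _ _ _)
  · rw [hs]
    exact dAfterWriteCV_move (WriteCall.onWriteAck_move _ _ _ _ _)
  · rename_i h2
    refine Phase.move_same x _ (by simp) (by simp) ?_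
    rcases h : s.recovery with _ | q | ⟨m, w⟩ | w | q
    · simp [Recovery.phase, Phase.write]
    · simp [Recovery.phase, Phase.write]
    · exact absurd h (h2 _ _)
    · exact absurd h (hs _)
    · simp [Recovery.phase, Phase.write]

lemma dReplicaRecv_move (i : Fin n) (x : ℕ) (j : Fin n) (m : DMsg n V) (s : DReplica n V)
    (d : PUnit.{u + 1}) :
    Phase.Move k x j m s.recovery.phase
      (dReplicaRecv k i x (.replica j) m s d).state.recovery.phase
      (dReplicaRecv k i x (.replica j) m s d).sends := by
  unfold dReplicaRecv
  split
  · split_ifs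
    · exact Phase.move_same x _ (by simp) (by simp) (by simp)
    · exact Phase.move_same x _ (by simp [DMsg.IsRequest]) (by simp) (by simp)
  · split_ifs
    · exact Phase.move_same x _ (by simp) (by simp) (by simp)
    · exact Phase.move_same x _ (by simp [DMsg.IsRequest]) (by simp) (by simp)
  · exact Phase.move_same x _ (by simp [DMsg.IsRequest]) (by simp) (by simp)
  · exact Phase.move_same x _ (by simp [DMsg.IsRequest]) (by simp) (by simp)
  · exact dOnReadAck_move _ _ _ _ _ _
  · exact dOnWriteAck_move (a := ⟨_, _⟩) _ _ _ _ _

/-- Messages from clients do not affect the recovery of a replica. -/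
lemma dReplicaRecv_client (i : Fin n) (x : ℕ) (c : ℕ) (m : DMsg n V) (s : DReplica n V)
    (d : PUnit.{u + 1}) :
    (dReplicaRecv k i x (.client c) m s d).state.recovery = s.recovery ∧
      ∀ e ∈ (dReplicaRecv k i x (.client c) m s d).sends, ¬ e.2.IsRequest := by
  unfold dReplicaRecv
  split
  · split_ifs <;> simp [DMsg.IsRequest]
  · split_ifs <;> simp [DMsg.IsRequest]
  · simp [DMsg.IsRequest]
  · simp [DMsg.IsRequest]
  · simp
  · simp

lemma dClientStore_fresh (c x : ℕ) (op : RegOp V) (acks : Fin n → Option (ReadReply n V)) :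
    Phase.Fresh x (dClientStore v₀ c x op acks).state.phase ∧
      (dClientStore v₀ c x op acks).sends = (dClientStore v₀ c x op acks).state.phase.sends := by
  unfold dClientStore
  split
  · exact ⟨.inr (.inr ⟨_, rfl⟩), rfl⟩
  · exact ⟨.inr (.inr ⟨_, rfl⟩), rfl⟩

/-- In its second phase a client ignores read replies. This agrees with the transitions of
`write_quorum` only because a register write has no inner read, which is the hypothesis `hs`;
`cl_storeOK` provides it in runs. -/
lemma dClientRecv_move (c x : ℕ) (j : Fin n) (m : DMsg n V) (s : DClient n V)
    (hs : ∀ res w, s = .store res w → w.inner = none) :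
    Phase.Move k x j m s.phase
      (dClientRecv k v₀ c x (.replica j) m s).state.phase
      (dClientRecv k v₀ c x (.replica j) m s).sends := by
  unfold dClientRecv
  split
  · rename_i op q j' id y hj
    cases hj
    by_cases hid : id = q.id
    · subst hid
      rw [if_pos rfl]
      dsimp only
      split_ifs with hc
      · have := dClientStore_fresh (v₀ := v₀) c x op (q.record j y).acks
        exact Phase.move_finish (.rd _ y rfl hc) this.1 fun e => by rw [this.2]
      · exact Phase.move_record hc
    · rw [if_neg hid]
      exact Phase.move_same x _ (by simp) (by simp [DClient.phase, Phase.read, hid]) (by simp)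
  · rename_i res w j' id inc cv hj
    cases hj
    have := WriteCall.onWriteAck_move (k := k) w x j id ⟨inc, cv⟩
    dsimp only
    split_ifs with hd
    · exact Phase.move_finish (Phase.finish_of_done (x := x) this hd) (.inl rfl) fun e => Iff.rfl
    · exact Phase.move_of_step this hd
  · rename_i s m _ _ _ h1 h2
    refine Phase.move_same x _ (by simp) ?_ ?_
    · rcases s with _ | ⟨op, q⟩ | ⟨res, w⟩
      · simp [DClient.phase, Phase.read]
      · rintro q' hq y rfl
        exact h1 _ _ _ _ _ rfl rfl rfl
      · simp [DClient.phase, Phase.read, hs res w rfl]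
    · rcases s with _ | ⟨op, q⟩ | ⟨res, w⟩
      · simp [DClient.phase, Phase.write]
      · simp [DClient.phase, Phase.write]
      · rintro w' hw a cv rfl
        exact h2 _ _ _ _ _ _ rfl rfl rfl

lemma dClientRecv_client (c x : ℕ) (c' : ℕ) (m : DMsg n V) (s : DClient n V) :
    dClientRecv k v₀ c x (.client c') m s = ⟨s, [], none⟩ := by
  unfold dClientRecv
  split
  · rename_i h; cases h
  · rename_i h; cases h
  · rfl

lemma WriteCall.Step.req {x : ℕ} {j : Fin n} {m : DMsg n V} {w w' : WriteCall n V}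
    (h : WriteCall.Step k x j m w w') : w'.req = w.req ∧ w'.id = w.id := by
  rcases h with _ | _ | _ | _ | ⟨_, _, w'', S, hv, _⟩
  · exact ⟨rfl, rfl⟩
  · exact ⟨rfl, rfl⟩
  · exact ⟨rfl, rfl⟩
  · exact ⟨rfl, rfl⟩
  · rw [WriteCall.validate_call]
    rcases hv with _ | _ <;> exact ⟨rfl, rfl⟩

/-- Register writes are validated with the crash vectors carried by the acknowledgements, so the
transition that opens an inner read is not available to them. -/
lemma WriteCall.Step.inner_of_tsVal {x : ℕ} {j : Fin n} {m : DMsg n V} {w w' : WriteCall n V}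
    (h : WriteCall.Step k x j m w w') (hw : (∃ T v, w.req = .tsVal T v) ∧ w.inner = none) :
    (∃ T v, w'.req = .tsVal T v) ∧ w'.inner = none := by
  refine ⟨by rw [h.req.1]; exact hw.1, ?_⟩
  rcases h with _ | _ | ⟨_, a, _, _, hn⟩ | ⟨_, q, y, hq, _⟩ | ⟨_, _, w'', S, hv, _⟩
  · exact hw.2
  · exact hw.2
  · obtain ⟨T, v, hreq⟩ := hw.1
    exact absurd hreq (hn T v)
  · rw [hw.2] at hq; cases hq
  · rw [WriteCall.validate_call]

/-- The second phase of an operation never validates by a read. -/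
def DClient.StoreOK (s : DClient n V) : Prop :=
  ∀ res w, s = .store res w → (∃ T v, w.req = .tsVal T v) ∧ w.inner = none

lemma dClientRecv_storeOK {c x : ℕ} {src : Proc n} {m : DMsg n V} {s : DClient n V}
    (hs : s.StoreOK) : (dClientRecv k v₀ c x src m s).state.StoreOK := by
  intro res w h
  unfold dClientRecv at h
  split at h
  · dsimp only at h
    split_ifs at h
    unfold dClientStore at h
    split at h <;> cases h <;> exact ⟨⟨_, _, rfl⟩, rfl⟩
  · rename_i res' w' j id inc cv
    dsimp only at h
    split_ifs at h with hd
    cases h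
    rcases WriteCall.onWriteAck_move (k := k) w' x j id ⟨inc, cv⟩ with ⟨-, h', -⟩ | ⟨h', -⟩
    · exact h'.inner_of_tsVal (hs _ _ rfl)
    · exact absurd h' hd
  · exact hs _ _ h

/-! ### The quorum access of a process along a run -/

namespace Run

variable (ρ : Run (algorithmD n k v₀))

lemma cl_storeOK (c t : ℕ) : (ρ.cl c t).StoreOK := by
  induction t with
  | zero => rintro _ _ h; rw [cl_zero] at h; cases h
  | succ t ih =>
    by_cases hi : ∃ op, ρ.Invokes t c op
    · obtain ⟨op, hi⟩ := hi
      rw [ρ.cl_invoke hi]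
      rintro _ _ h
      cases h
    · by_cases hd : ∃ src m, ρ.Delivers t src (.client c) m
      · obtain ⟨src, m, hd⟩ := hd
        rw [ρ.cl_deliver hd]
        exact dClientRecv_storeOK ih
      · rw [ρ.cl_other (by simpa using hd) (by simpa using hi)]
        exact ih

/-- Process `p` starts anew in step `t`: a client invokes an operation or a replica restarts. -/
def Begins (t : ℕ) (p : Proc n) : Prop :=
  (∃ c op, p = .client c ∧ ρ.Invokes t c op) ∨ ∃ l, p = .replica l ∧ ρ.Restarts t l

lemma ph_begins {t : ℕ} {p : Proc n} (h : ρ.Begins t p) :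
    ∃ req, ρ.ph p (t + 1) = .rd (ReadCall.start (ρ.uid t) req) := by
  rcases h with ⟨c, op, rfl, h⟩ | ⟨l, rfl, h⟩
  · exact ⟨_, by simp only [ph, ρ.cl_invoke h]; rfl⟩
  · exact ⟨_, by simp only [ph, recov, ρ.rep_restart h]; rfl⟩

/-- The messages sent by the caller of a quorum access, on receipt of a message. -/
lemma ph_delivers {t : ℕ} {p : Proc n} {j : Fin n} {m : DMsg n V}
    (h : ρ.Delivers t (.replica j) p m) : ∃ l : List (Proc n × DMsg n V),
      Phase.Move k (ρ.uid t) j m (ρ.ph p t) (ρ.ph p (t + 1)) l ∧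
      ∀ d m', ρ.Sends t p d m' ↔ (d, m') ∈ l := by
  rcases p with ⟨l⟩ | ⟨c⟩
  · refine ⟨(dReplicaRecv k l (ρ.uid t) (.replica j) m (ρ.rep l t) ⟨⟩).sends, ?_,
      fun d m' => ⟨fun hs => ?_, fun hs => ρ.sends_of_rep_deliver h hs⟩⟩
    · simp only [ph, recov, ρ.rep_deliver h]
      exact dReplicaRecv_move _ _ _ _ _ _
    · unfold Sends sent at hs
      rw [show ρ.act t = _ from h] at hs
      obtain ⟨⟨d', m''⟩, hq, hh⟩ := List.mem_map.1 hs
      cases hh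
      exact hq
  · refine ⟨(dClientRecv k v₀ c (ρ.uid t) (.replica j) m (ρ.cl c t)).sends, ?_,
      fun d m' => ⟨fun hs => ?_, fun hs => ρ.sends_of_cl_deliver h hs⟩⟩
    · simp only [ph, ρ.cl_deliver h]
      exact dClientRecv_move _ _ _ _ _ fun res w h => (ρ.cl_storeOK c t res w h).2
    · unfold Sends sent at hs
      rw [show ρ.act t = _ from h] at hs
      obtain ⟨⟨d', m''⟩, hq, hh⟩ := List.mem_map.1 hs
      cases hh
      exact hq

lemma ph_other {t : ℕ} {p : Proc n} (h : ∀ j m, ¬ ρ.Delivers t (.replica j) p m)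
    (h' : ¬ ρ.Begins t p) : ρ.ph p (t + 1) = ρ.ph p t := by
  rcases p with ⟨l⟩ | ⟨c⟩
  · have hr : ¬ ρ.Restarts t l := fun hr => h' (.inr ⟨l, rfl, hr⟩)
    by_cases hd : ∃ src m, ρ.Delivers t src (.replica l) m
    · obtain ⟨⟨j⟩ | ⟨c⟩, m, hd⟩ := hd
      · exact absurd hd (h j m)
      · simp only [ph, recov, ρ.rep_deliver hd]
        rw [(dReplicaRecv_client _ _ _ _ _ _).1]
    · simp only [ph, recov, ρ.rep_other (by simpa using hd) hr]
  · have hi : ∀ op, ¬ ρ.Invokes t c op := fun op hi => h' (.inl ⟨c, op, rfl, hi⟩)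
    by_cases hd : ∃ src m, ρ.Delivers t src (.client c) m
    · obtain ⟨⟨j⟩ | ⟨c'⟩, m, hd⟩ := hd
      · exact absurd hd (h j m)
      · simp only [ph, ρ.cl_deliver hd, dClientRecv_client]
    · simp only [ph, ρ.cl_other (by simpa using hd) hi]

/-- How the phase of a process changes in a step. -/
lemma ph_cases (t : ℕ) (p : Proc n) :
    ρ.ph p (t + 1) = ρ.ph p t ∨ ρ.Begins t p ∨
    ∃ j m, ρ.Delivers t (.replica j) p m ∧
      (Phase.Step k (ρ.uid t) j m (ρ.ph p t) (ρ.ph p (t + 1)) ∨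
        Phase.Finish k j m (ρ.ph p t) ∧ Phase.Fresh (ρ.uid t) (ρ.ph p (t + 1))) := by
  by_cases h' : ρ.Begins t p
  · exact .inr (.inl h')
  · by_cases h : ∀ j m, ¬ ρ.Delivers t (.replica j) p m
    · exact .inl (ρ.ph_other h h')
    · push Not at h
      obtain ⟨j, m, h⟩ := h
      obtain ⟨l, ⟨-, hm⟩, -⟩ := ρ.ph_delivers h
      refine .inr (.inr ⟨j, m, h, ?_⟩)
      rcases hm with hm | hm
      · exact .inl hm.1
      · exact .inr ⟨hm.1, hm.2.1⟩

/-- Requests are only sent on behalf of the current quorum access. -/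
lemma mem_sends_of_sends {t : ℕ} {p d : Proc n} {m : DMsg n V} (h : ρ.Sends t p d m)
    (hm : m.IsRequest) : (d, m) ∈ (ρ.ph p (t + 1)).sends := by
  rcases ρ.sends_cases h with ⟨c, op, rfl, hi, hs⟩ | ⟨c, src, m', rfl, hd, hs⟩ |
    ⟨l, src, m', rfl, hd, hs⟩ | ⟨l, rfl, hr, hs⟩ | ⟨ha, hs⟩
  · simp only [ph, ρ.cl_invoke hi]
    exact hs
  · rcases src with ⟨j⟩ | ⟨c'⟩
    · obtain ⟨l, ⟨hl, -⟩, hs'⟩ := ρ.ph_delivers hd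
      exact hl _ ((hs' _ _).1 h) hm
    · rw [dClientRecv_client] at hs
      simp at hs
  · rcases src with ⟨j⟩ | ⟨c'⟩
    · obtain ⟨l, ⟨hl, -⟩, hs'⟩ := ρ.ph_delivers hd
      exact hl _ ((hs' _ _).1 h) hm
    · exact absurd hm ((dReplicaRecv_client _ _ _ _ _ _).2 _ hs)
  · simp only [ph, recov, ρ.rep_restart hr]
    exact hs
  · have : ρ.ph p (t + 1) = ρ.ph p t := by
      apply ρ.ph_other
      · intro j m h
        unfold Delivers at h
        rw [ha] at h; cases h
      · rintro (⟨c, op, rfl, hi⟩ | ⟨l, rfl, ⟨rb, d, hr⟩⟩)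
        · unfold Invokes at hi
          rw [ha] at hi; cases hi
        · rw [ha] at hr; cases hr
    rw [this]
    exact hs

/-- A request `read id req` has been sent by the current read call. -/
lemma read_of_sends {t : ℕ} {p d : Proc n} {id : ℕ} {req : ReadReq n}
    (h : ρ.Sends t p d (.read id req)) :
    ∃ q, (ρ.ph p (t + 1)).read = some q ∧ q.id = id ∧ q.req = req := by
  have := ρ.mem_sends_of_sends h trivial
  rcases hf : ρ.ph p (t + 1) with _ | q | w <;> rw [hf] at this
  · simp [Phase.sends] at this
  · obtain ⟨z, -, hz⟩ := mem_readCall_sends.1 this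
    cases hz
    exact ⟨q, rfl, rfl, rfl⟩
  · simp only [Phase.sends, WriteCall.resend] at this
    rcases hi : w.inner with _ | q <;> rw [hi] at this
    · obtain ⟨z, -, -, hz⟩ := mem_writeCall_sends.1 this
      cases hz
    · obtain ⟨z, -, hz⟩ := mem_readCall_sends.1 this
      cases hz
      exact ⟨q, hi, rfl, rfl⟩

/-- A request `write id req inc` has been sent by the current write call. -/
lemma write_of_sends {t : ℕ} {p d : Proc n} {id inc : ℕ} {req : WriteReq n V}
    (h : ρ.Sends t p d (.write id req inc)) :
    ∃ w z, (ρ.ph p (t + 1)).write = some w ∧ w.id = id ∧ w.req = req ∧ w.inner = none ∧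
      d = .replica z ∧ inc = w.cv z := by
  have := ρ.mem_sends_of_sends h trivial
  rcases hf : ρ.ph p (t + 1) with _ | q | w <;> rw [hf] at this
  · simp [Phase.sends] at this
  · obtain ⟨z, -, hz⟩ := mem_readCall_sends.1 this
    cases hz
  · simp only [Phase.sends, WriteCall.resend] at this
    rcases hi : w.inner with _ | q <;> rw [hi] at this
    · obtain ⟨z, -, hz', hz⟩ := mem_writeCall_sends.1 this
      cases hz
      exact ⟨w, z, rfl, rfl, rfl, hi, hz', rfl⟩
    · obtain ⟨z, -, hz⟩ := mem_readCall_sends.1 this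
      cases hz

end Run

end CRR


namespace CRR

universe u

variable {n k : ℕ} {V : Type u} {v₀ : V}

/-! ## Acknowledgements -/

/-- The information stored by a write request is present in a register state. -/
def WriteReq.Holds : WriteReq n V → RegState n V → Prop
  | .tsVal t _, s => t ≤ s.ts
  | .preCV j m, s => m ≤ s.preCV j
  | .cv j m, s => m ≤ s.cv j

lemma ReadCall.isRequest_of_mem_sends {q : ReadCall n V} {e : Proc n × DMsg n V}
    (h : e ∈ q.sends) : e.2.IsRequest := by
  obtain ⟨d, m⟩ := e
  obtain ⟨z, -, rfl⟩ := mem_readCall_sends.1 h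
  trivial

lemma WriteCall.isRequest_of_mem_sends {w : WriteCall n V} {e : Proc n × DMsg n V}
    (h : e ∈ w.sends) : e.2.IsRequest := by
  obtain ⟨d, m⟩ := e
  obtain ⟨z, -, -, rfl⟩ := mem_writeCall_sends.1 h
  trivial

lemma WriteCall.isRequest_of_mem_resend {w : WriteCall n V} {e : Proc n × DMsg n V}
    (h : e ∈ w.resend) : e.2.IsRequest := by
  unfold WriteCall.resend at h
  split at h
  · exact WriteCall.isRequest_of_mem_sends h
  · exact ReadCall.isRequest_of_mem_sends h

lemma Phase.isRequest_of_mem_sends {f : Phase n V} {e : Proc n × DMsg n V}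
    (h : e ∈ f.sends) : e.2.IsRequest := by
  rcases f with _ | q | w
  · cases h
  · exact ReadCall.isRequest_of_mem_sends h
  · exact WriteCall.isRequest_of_mem_resend h

lemma WriteCall.Move.isRequest {x : ℕ} {j : Fin n} {m : DMsg n V} {w : WriteCall n V}
    {r : WriteStep n V} (h : WriteCall.Move k x j m w r) (hd : ¬ r.done = true)
    {e : Proc n × DMsg n V} (he : e ∈ r.sends) : e.2.IsRequest := by
  rcases h with ⟨-, -, h, -⟩ | ⟨h, -⟩
  · exact WriteCall.isRequest_of_mem_resend (h e he)
  · exact absurd h hd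

lemma dAfterWritePre_isRequest {i : Fin n} {x : ℕ} {s : DReplica n V} {m : ℕ} {w : WriteCall n V}
    {r : WriteStep n V} {j : Fin n} {msg : DMsg n V} (h : WriteCall.Move k x j msg w r)
    {e : Proc n × DMsg n V} (he : e ∈ (dAfterWritePre i x s m r).sends) : e.2.IsRequest := by
  unfold dAfterWritePre at he
  split_ifs at he with hd
  · exact WriteCall.isRequest_of_mem_sends he
  · exact h.isRequest hd he

lemma dAfterWriteCV_isRequest {i : Fin n} {x : ℕ} {s : DReplica n V} {w : WriteCall n V}
    {r : WriteStep n V} {j : Fin n} {msg : DMsg n V} (h : WriteCall.Move k x j msg w r)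
    {e : Proc n × DMsg n V} (he : e ∈ (dAfterWriteCV i x s r).sends) : e.2.IsRequest := by
  unfold dAfterWriteCV at he
  split_ifs at he with hd
  · exact ReadCall.isRequest_of_mem_sends he
  · exact h.isRequest hd he

lemma dOnReadAck_isRequest {i : Fin n} {x : ℕ} {j : Fin n} {id : ℕ} {y : ReadReply n V}
    {s : DReplica n V} {e : Proc n × DMsg n V} (he : e ∈ (dOnReadAck k i x j id y s).sends) :
    e.2.IsRequest := by
  unfold dOnReadAck at he
  split at he
  · simp at he
  · dsimp only at he
    split_ifs at he
    · exact WriteCall.isRequest_of_mem_sends he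
    · simp at he
    · simp at he
  · exact dAfterWritePre_isRequest (WriteCall.onReadAck_move _ x _ _ _) he
  · exact dAfterWriteCV_isRequest (WriteCall.onReadAck_move _ x _ _ _) he
  · dsimp only at he
    split_ifs at he <;> simp at he

lemma dOnWriteAck_isRequest {i : Fin n} {x : ℕ} {j : Fin n} {id : ℕ} {a : WAck n}
    {s : DReplica n V} {e : Proc n × DMsg n V} (he : e ∈ (dOnWriteAck k i x j id a s).sends) :
    e.2.IsRequest := by
  unfold dOnWriteAck at he
  split at he
  · exact dAfterWritePre_isRequest (WriteCall.onWriteAck_move _ x _ _ _) he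
  · exact dAfterWriteCV_isRequest (WriteCall.onWriteAck_move _ x _ _ _) he
  · simp at he

lemma dClientRecv_isRequest {c x : ℕ} {src : Proc n} {m : DMsg n V} {s : DClient n V}
    {e : Proc n × DMsg n V} (he : e ∈ (dClientRecv k v₀ c x src m s).sends) :
    e.2.IsRequest := by
  unfold dClientRecv at he
  split at he
  · dsimp only at he
    split_ifs at he
    · rw [(dClientStore_fresh _ _ _ _).2] at he
      exact Phase.isRequest_of_mem_sends he
    · simp at he
    · simp at he
  · dsimp only at he
    split_ifs at he with hd
    · simp at he
    · exact (WriteCall.onWriteAck_move _ x _ _ _).isRequest hd he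
  · simp at he

/-! ### The information order on register states -/

namespace RegState

lemma raiseCV_cv_self (s : RegState n V) (j : Fin n) (m : ℕ) : m ≤ (s.raiseCV j m).cv j := by
  simp [raiseCV]

/-- `s'` contains all the information of `s`. -/
structure Le (s s' : RegState n V) : Prop where
  ts : s.ts ≤ s'.ts
  cv : ∀ i, s.cv i ≤ s'.cv i
  preCV : ∀ i, s.preCV i ≤ s'.preCV i

lemma Le.refl (s : RegState n V) : s.Le s := ⟨le_rfl, fun _ => le_rfl, fun _ => le_rfl⟩

lemma Le.trans {s s' s'' : RegState n V} (h : s.Le s') (h' : s'.Le s'') : s.Le s'' :=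
  ⟨h.ts.trans h'.ts, fun i => (h.cv i).trans (h'.cv i), fun i => (h.preCV i).trans (h'.preCV i)⟩

lemma Le.holds {s s' : RegState n V} (h : s.Le s') {req : WriteReq n V} (hr : req.Holds s) :
    req.Holds s' := by
  rcases req with ⟨t, v⟩ | ⟨j, m⟩ | ⟨j, m⟩
  · exact le_trans (α := TS) hr h.ts
  · exact le_trans (α := ℕ) hr (h.preCV j)
  · exact le_trans (α := ℕ) hr (h.cv j)

lemma le_raiseCV (s : RegState n V) (j : Fin n) (m : ℕ) : s.Le (s.raiseCV j m) := by
  refine ⟨le_rfl, fun i => ?_, fun _ => le_rfl⟩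
  by_cases h : i = j
  · subst h; simp [raiseCV]
  · simp [raiseCV, Function.update_of_ne h]

lemma le_raisePreCV (s : RegState n V) (j : Fin n) (m : ℕ) : s.Le (s.raisePreCV j m) := by
  refine ⟨le_rfl, fun _ => le_rfl, fun i => ?_⟩
  by_cases h : i = j
  · subst h; simp [raisePreCV]
  · simp [raisePreCV, Function.update_of_ne h]

lemma le_raiseTS (s : RegState n V) (t : TS) (v : V) : s.Le (s.raiseTS t v) := by
  unfold raiseTS
  split_ifs with h
  · exact ⟨h.le, fun _ => le_rfl, fun _ => le_rfl⟩
  · exact Le.refl s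

lemma raiseTS_ts (s : RegState n V) (t : TS) (v : V) : t ≤ (s.raiseTS t v).ts := by
  unfold raiseTS
  split_ifs with h
  · exact le_rfl
  · exact not_lt.1 h

lemma raiseTS_cv (s : RegState n V) (t : TS) (v : V) : (s.raiseTS t v).cv = s.cv := by
  unfold raiseTS
  split_ifs <;> rfl

lemma raiseTS_preCV (s : RegState n V) (t : TS) (v : V) : (s.raiseTS t v).preCV = s.preCV := by
  unfold raiseTS
  split_ifs <;> rfl

lemma raiseTS_tsVal (s : RegState n V) (t : TS) (v : V) :
    ((s.raiseTS t v).ts = s.ts ∧ (s.raiseTS t v).val = s.val) ∨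
      ((s.raiseTS t v).ts = t ∧ (s.raiseTS t v).val = v) := by
  unfold raiseTS
  split_ifs
  · exact .inr ⟨rfl, rfl⟩
  · exact .inl ⟨rfl, rfl⟩

lemma absorb_cv (s : RegState n V) (S : List (RegState n V)) (z : Fin n) :
    (s.absorb S).cv z = max (s.cv z) (maxOf (fun a => a.cv z) S) := by
  unfold absorb
  dsimp only
  split
  · rfl
  · rw [raiseTS_cv]

lemma absorb_preCV (s : RegState n V) (S : List (RegState n V)) (z : Fin n) :
    (s.absorb S).preCV z = max (s.preCV z) (maxOf (fun a => a.preCV z) S) := by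
  unfold absorb
  dsimp only
  split
  · rfl
  · rw [raiseTS_preCV]

lemma absorb_tsVal (s : RegState n V) (S : List (RegState n V)) :
    ((s.absorb S).ts = s.ts ∧ (s.absorb S).val = s.val) ∨
      ∃ a ∈ S, (s.absorb S).ts = a.ts ∧ (s.absorb S).val = a.val := by
  unfold absorb
  dsimp only
  split
  · exact .inl ⟨rfl, rfl⟩
  · rename_i a ha
    rcases raiseTS_tsVal { s with
      preCV := fun z => max (s.preCV z) (maxOf (fun a => a.preCV z) S)
      cv := fun z => max (s.cv z) (maxOf (fun a => a.cv z) S) } a.ts a.val with h | h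
    · exact .inl h
    · exact .inr ⟨a, List.argmax_mem ha, h⟩

lemma le_absorb_self (s : RegState n V) (S : List (RegState n V)) : s.Le (s.absorb S) := by
  refine ⟨?_, fun z => ?_, fun z => ?_⟩
  · unfold absorb
    dsimp only
    split
    · exact le_rfl
    · exact (le_raiseTS { s with
        preCV := fun z => max (s.preCV z) (maxOf (fun a => a.preCV z) S)
        cv := fun z => max (s.cv z) (maxOf (fun a => a.cv z) S) } _ _).ts
  · rw [absorb_cv]; exact le_max_left _ _
  · rw [absorb_preCV]; exact le_max_left _ _

lemma le_absorb (s : RegState n V) {S : List (RegState n V)} {a : RegState n V} (ha : a ∈ S) :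
    a.Le (s.absorb S) := by
  refine ⟨?_, fun z => ?_, fun z => ?_⟩
  · unfold absorb
    dsimp only
    split
    · rename_i h
      rw [List.argmax_eq_none] at h
      subst h; cases ha
    · rename_i b hb
      exact (List.le_of_mem_argmax ha hb).trans (raiseTS_ts _ _ _)
  · rw [absorb_cv]; exact (le_maxOf (g := fun a : RegState n V => a.cv z) ha).trans (le_max_right _ _)
  · rw [absorb_preCV]
    exact (le_maxOf (g := fun a : RegState n V => a.preCV z) ha).trans (le_max_right _ _)

end RegState

/-- Requests that a stale replica does not answer. -/
def WriteReq.IsTSVal : WriteReq n V → Prop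
  | .tsVal _ _ => True
  | _ => False

/-! ### Requests served by replicas -/

namespace Run

variable (ρ : Run (algorithmD n k v₀))

/-- In step `r`, replica `l` answers `y` to the request `req` with identifier `id` of `p`. -/
structure ReadServed (p : Proc n) (id : ℕ) (req : ReadReq n) (l : Fin n) (r : ℕ)
    (y : ReadReply n V) : Prop where
  delivers : ρ.Delivers r p (.replica l) (.read id req)
  stale' : ρ.stale l (r + 1) = false
  reply : y = (ρ.reg l (r + 1)).reply req
  state : ∀ i inc, p = .replica i → req = .state inc → inc ≤ (ρ.reg l (r + 1)).cv i

/-- In step `r`, replica `l` acknowledges by `a` the request `req` with identifier `id` of `p`. -/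
structure WriteServed (p : Proc n) (id : ℕ) (req : WriteReq n V) (l : Fin n) (r : ℕ)
    (a : WAck n) : Prop where
  delivers : ∃ inc, ρ.Delivers r p (.replica l) (.write id req inc)
  inc : a.inc = (ρ.reg l (r + 1)).cv l
  holds : req.Holds (ρ.reg l (r + 1))
  tsVal : req.IsTSVal → ρ.stale l r = false ∧ ρ.stale l (r + 1) = false ∧
    a.cv = some (ρ.reg l (r + 1)).cv

/-- The answer is described by the register after the step, because a State request first raises the
entry of the requester. This side effect later exposes acknowledgements given by former incarnations
of the requester. -/
lemma read_served {p : Proc n} {id : ℕ} {req : ReadReq n} {l : Fin n} {r : ℕ}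
    (h : ρ.Delivers r p (.replica l) (.read id req)) (hs : ρ.stale l r = false) :
    ∃ y, ρ.ReadServed p id req l r y ∧ ρ.Sends r (.replica l) p (.readAck id y) := by
  refine ⟨(ρ.reg l (r + 1)).reply req, ⟨h, ?_, rfl, ?_⟩, ρ.sends_of_rep_deliver h ?_⟩
  · simp only [stale, ρ.rep_deliver h]
    simp only [stale] at hs
    simp [dReplicaRecv, hs]
  · rintro i inc rfl rfl
    simp only [stale] at hs
    simp only [reg, ρ.rep_deliver h, dReplicaRecv, hs, Bool.false_eq_true, if_false]
    exact RegState.raiseCV_cv_self _ _ _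
  · simp only [stale] at hs
    simp [reg, ρ.rep_deliver h, dReplicaRecv, hs]

/-- A recovery request carries the number that the caller demands from the receiver, who raises its
own entry accordingly; hence the last clause, by which a purged replica gets accepted on the next
attempt. Register writes do not have this effect. -/
lemma write_served {p : Proc n} {id inc : ℕ} {req : WriteReq n V} {l : Fin n} {r : ℕ}
    (h : ρ.Delivers r p (.replica l) (.write id req inc))
    (hs : req.IsTSVal → ρ.stale l r = false) :
    ∃ a, ρ.WriteServed p id req l r a ∧ ρ.Sends r (.replica l) p (.writeAck id a.inc a.cv) ∧
      (¬ req.IsTSVal → inc ≤ a.inc) := by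
  rcases req with ⟨t, v⟩ | ⟨j, m⟩ | ⟨j, m⟩
  · have hs' := hs trivial
    simp only [stale] at hs'
    refine ⟨⟨(ρ.reg l (r + 1)).cv l, some (ρ.reg l (r + 1)).cv⟩, ⟨⟨inc, h⟩, rfl, ?_, ?_⟩,
      ρ.sends_of_rep_deliver h ?_, fun h => absurd trivial h⟩
    · simp only [reg, ρ.rep_deliver h, dReplicaRecv, hs', Bool.false_eq_true, if_false]
      exact RegState.raiseTS_ts _ _ _
    · refine fun _ => ⟨hs trivial, ?_, rfl⟩
      simp only [stale, ρ.rep_deliver h]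
      simp [dReplicaRecv, hs']
    · simp [reg, ρ.rep_deliver h, dReplicaRecv, hs']
  · refine ⟨⟨(ρ.reg l (r + 1)).cv l, none⟩, ⟨⟨inc, h⟩, rfl, ?_, fun h => absurd h fun h => h⟩,
      ρ.sends_of_rep_deliver h ?_, fun _ => ?_⟩
    · simp only [reg, ρ.rep_deliver h, dReplicaRecv]
      simp [WriteReq.Holds, RegState.raisePreCV]
    · simp [reg, ρ.rep_deliver h, dReplicaRecv]
    · simp only [reg, ρ.rep_deliver h, dReplicaRecv]
      exact RegState.raiseCV_cv_self _ _ _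
  · refine ⟨⟨(ρ.reg l (r + 1)).cv l, none⟩, ⟨⟨inc, h⟩, rfl, ?_, fun h => absurd h fun h => h⟩,
      ρ.sends_of_rep_deliver h ?_, fun _ => ?_⟩
    · simp only [reg, ρ.rep_deliver h, dReplicaRecv]
      exact RegState.raiseCV_cv_self _ _ _
    · simp [reg, ρ.rep_deliver h, dReplicaRecv]
    · simp only [reg, ρ.rep_deliver h, dReplicaRecv]
      exact (RegState.raiseCV_cv_self _ _ _).trans ((RegState.le_raiseCV _ _ _).cv l)

/-- Acknowledgements are sent by replicas in answer to requests. -/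
lemma served_of_sends {r : ℕ} {p d : Proc n} {m : DMsg n V} (h : ρ.Sends r p d m)
    (hm : ¬ m.IsRequest) : ∃ l, p = .replica l ∧
      ((∃ id req y, m = .readAck id y ∧ ρ.ReadServed d id req l r y) ∨
        ∃ id req a, m = .writeAck id a.inc a.cv ∧ ρ.WriteServed d id req l r a) := by
  rcases ρ.sends_cases h with ⟨c, op, rfl, hi, hs⟩ | ⟨c, src, m', rfl, hd, hs⟩ |
    ⟨l, src, m', rfl, hd, hs⟩ | ⟨l, rfl, hr, hs⟩ | ⟨ha, hs⟩
  · exact absurd (ReadCall.isRequest_of_mem_sends hs) hm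
  · exact absurd (dClientRecv_isRequest hs) hm
  · refine ⟨l, rfl, ?_⟩
    rcases m' with ⟨id, req⟩ | ⟨id, y⟩ | ⟨id, req, inc⟩ | ⟨id, inc, cv⟩
    · rcases hst : ρ.stale l r with _ | _
      · obtain ⟨y, hy, -⟩ := ρ.read_served hd hst
        have hst' := hst
        simp only [stale] at hst
        have hy' := hy.reply
        simp only [reg, ρ.rep_deliver hd] at hy'
        simp only [dReplicaRecv, hst, Bool.false_eq_true, if_false, List.mem_singleton,
          Prod.mk.injEq] at hs hy'
        obtain ⟨rfl, rfl⟩ := hs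
        rw [← hy']
        exact .inl ⟨id, req, _, rfl, hy⟩
      · simp only [stale] at hst
        simp [dReplicaRecv, hst] at hs
    · rcases src with ⟨j⟩ | ⟨c⟩
      · exact absurd (dOnReadAck_isRequest hs) hm
      · simp [dReplicaRecv] at hs
    · have key : (req.IsTSVal → ρ.stale l r = false) → d = src ∧ ∃ a, m = .writeAck id a.inc a.cv ∧
          ρ.WriteServed src id req l r a := by
        intro hst
        obtain ⟨a, ha, -, -⟩ := ρ.write_served hd hst
        rcases req with ⟨t, v⟩ | ⟨j, m⟩ | ⟨j, m⟩
        · have hst := hst trivial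
          simp only [stale] at hst
          have h1 := ha.inc
          have h2 := (ha.tsVal trivial).2.2
          simp only [reg, ρ.rep_deliver hd] at h1 h2
          simp only [dReplicaRecv, hst, Bool.false_eq_true, if_false, List.mem_singleton,
            Prod.mk.injEq] at hs h1 h2
          obtain ⟨rfl, rfl⟩ := hs
          exact ⟨rfl, a, by rw [h1, h2], ha⟩
        · have h1 := ha.inc
          simp only [reg, ρ.rep_deliver hd] at h1
          simp only [dReplicaRecv, List.mem_singleton, Prod.mk.injEq] at hs h1
          obtain ⟨rfl, rfl⟩ := hs
          exact ⟨rfl, ⟨a.inc, none⟩, by rw [h1], ⟨ha.delivers, ha.inc, ha.holds, fun h => absurd h (fun h => h)⟩⟩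
        · have h1 := ha.inc
          simp only [reg, ρ.rep_deliver hd] at h1
          simp only [dReplicaRecv, List.mem_singleton, Prod.mk.injEq] at hs h1
          obtain ⟨rfl, rfl⟩ := hs
          exact ⟨rfl, ⟨a.inc, none⟩, by rw [h1], ⟨ha.delivers, ha.inc, ha.holds, fun h => absurd h (fun h => h)⟩⟩
      by_cases hst : req.IsTSVal → ρ.stale l r = false
      · obtain ⟨rfl, a, hm, ha⟩ := key hst
        exact .inr ⟨id, req, a, hm, ha⟩
      · push Not at hst
        rcases req with ⟨t, v⟩ | ⟨j, m⟩ | ⟨j, m⟩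
        · have hst := hst.2
          simp only [stale, ne_eq, Bool.not_eq_false] at hst
          simp [dReplicaRecv, hst] at hs
        · exact absurd hst.1 fun h => h
        · exact absurd hst.1 fun h => h
    · rcases src with ⟨j⟩ | ⟨c⟩
      · exact absurd (dOnWriteAck_isRequest (a := ⟨_, _⟩) hs) hm
      · simp [dReplicaRecv] at hs
  · exact absurd (ReadCall.isRequest_of_mem_sends hs) hm
  · exact absurd (Phase.isRequest_of_mem_sends hs) hm

lemma readServed_of_delivers {t : ℕ} {p : Proc n} {j : Fin n} {id : ℕ} {y : ReadReply n V}
    (h : ρ.Delivers t (.replica j) p (.readAck id y)) :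
    ∃ r < t, ∃ req, ρ.ReadServed p id req j r y := by
  obtain ⟨r, hr, hs⟩ := ρ.exists_sends_of_delivers h
  obtain ⟨l, hl, ⟨id', req, y', hm, hy⟩ | ⟨id', req, a, hm, ha⟩⟩ := ρ.served_of_sends hs (fun h => h)
  · cases hl; cases hm
    exact ⟨r, hr, req, hy⟩
  · cases hm

lemma writeServed_of_delivers {t : ℕ} {p : Proc n} {j : Fin n} {id : ℕ} {a : WAck n}
    (h : ρ.Delivers t (.replica j) p (.writeAck id a.inc a.cv)) :
    ∃ r < t, ∃ req, ρ.WriteServed p id req j r a := by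
  obtain ⟨r, hr, hs⟩ := ρ.exists_sends_of_delivers h
  obtain ⟨l, hl, ⟨id', req, y', hm, hy⟩ | ⟨id', req, a', hm, ha⟩⟩ := ρ.served_of_sends hs (fun h => h)
  · cases hm
  · obtain ⟨i, c⟩ := a
    obtain ⟨i', c'⟩ := a'
    cases hl; cases hm
    exact ⟨r, hr, req, ha⟩

end Run

end CRR


namespace CRR

universe u

variable {n k : ℕ} {V : Type u} {v₀ : V}

/-! ## Invariants of quorum accesses -/

lemma Phase.Step.read {x : ℕ} {j : Fin n} {m : DMsg n V} {f f' : Phase n V} {q' : ReadCall n V}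
    (h : Phase.Step k x j m f f') (hq : f'.read = some q') :
    f.read = some q' ∨
    (∃ q y, f.read = some q ∧ m = .readAck q.id y ∧ q' = q.record j y ∧
      ¬ (q.record j y).complete k = true) ∨
    q' = ReadCall.start x .cv := by
  rcases h with _ | ⟨q, h⟩ | ⟨q, y, hm, hc⟩ | ⟨w, w', h⟩
  · exact .inl hq
  · exact .inl hq
  · cases hq
    exact .inr (.inl ⟨q, y, rfl, hm, rfl, hc⟩)
  · rcases h with _ | ⟨_, a, h⟩ | ⟨_, a, h, _, _⟩ | ⟨_, q, y, h, hc⟩ | ⟨_, _, w'', S, hv, hd⟩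
    · exact .inl hq
    · exact .inl hq
    · cases hq
      exact .inr (.inr rfl)
    · cases hq
      exact .inr (.inl ⟨q, y, h, rfl, rfl, hc⟩)
    · rw [WriteCall.validate_call] at hq
      cases hq

lemma Phase.Step.write {x : ℕ} {j : Fin n} {m : DMsg n V} {f f' : Phase n V} {w' : WriteCall n V}
    (h : Phase.Step k x j m f f') (hw : f'.write = some w') :
    ∃ w, f = .wr w ∧ f' = .wr w' ∧ WriteCall.Step k x j m w w' := by
  rcases h with _ | ⟨q, h⟩ | ⟨q, y, hm, hc⟩ | ⟨w, w'', h⟩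
  · cases hw
  · cases hw
  · cases hw
  · cases hw
    exact ⟨w, rfl, rfl, h⟩

lemma Phase.Fresh.read {x : ℕ} {f : Phase n V} {q : ReadCall n V} (h : Phase.Fresh x f)
    (hq : f.read = some q) : ∃ req, q = ReadCall.start x req := by
  rcases h with rfl | ⟨req, rfl⟩ | ⟨req, rfl⟩
  · cases hq
  · cases hq; exact ⟨req, rfl⟩
  · cases hq

lemma Phase.Fresh.write {x : ℕ} {f : Phase n V} {w : WriteCall n V} (h : Phase.Fresh x f)
    (hw : f.write = some w) : ∃ req, w = WriteCall.start x req := by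
  rcases h with rfl | ⟨req, rfl⟩ | ⟨req, rfl⟩
  · cases hw
  · cases hw
  · cases hw; exact ⟨req, rfl⟩

/-! ### Provenance of replies and acknowledgements -/

namespace Run

variable (ρ : Run (algorithmD n k v₀))

lemma ph_zero (p : Proc n) : ρ.ph p 0 = .idle := by
  rcases p with l | c
  · simp only [ph, recov, rep_zero]; rfl
  · simp only [ph, cl_zero]; rfl

/-- The read call `q` of process `p` at time `t` has been started in step `s`, and its replies have
been given in between. -/
structure ReadOK (p : Proc n) (t : ℕ) (q : ReadCall n V) (s : ℕ) : Prop where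
  lt : s < t
  id : q.id = ρ.uid s
  start : ∃ q₀, (ρ.ph p (s + 1)).read = some q₀ ∧ q₀.id = q.id ∧ q₀.req = q.req
  served : ∀ j y, q.acks j = some y → ∃ r, s < r ∧ r < t ∧ ρ.ReadServed p q.id q.req j r y

variable {ρ}

lemma ReadOK.mono {p : Proc n} {t t' : ℕ} {q : ReadCall n V} {s : ℕ} (h : ρ.ReadOK p t q s)
    (ht : t ≤ t') : ρ.ReadOK p t' q s :=
  ⟨h.lt.trans_le ht, h.id, h.start, fun j y hy =>
    let ⟨r, h1, h2, h3⟩ := h.served j y hy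
    ⟨r, h1, h2.trans_le ht, h3⟩⟩

lemma readOK_start {p : Proc n} {t : ℕ} {req : ReadReq n}
    (h : (ρ.ph p (t + 1)).read = some (ReadCall.start (ρ.uid t) req)) :
    ρ.ReadOK p (t + 1) (ReadCall.start (ρ.uid t) req) t :=
  ⟨t.lt_succ_self, rfl, ⟨_, h, rfl, rfl⟩, by simp [ReadCall.start]⟩

/-- The reply leads back to a request with the same identifier, sent on behalf of some call of `p`.
Identifiers are unique, so that call was started in the same step `s` and made the same request;
hence the reply was given after `s`. The invariant at earlier times is a hypothesis, so that this
can be used inside the induction that proves it. -/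
lemma served_of_readOK {p : Proc n} {t s : ℕ} {q : ReadCall n V}
    (ih : ∀ t' ≤ t, ∀ q, (ρ.ph p t').read = some q → ∃ s, ρ.ReadOK p t' q s)
    (h : ρ.ReadOK p t q s) {j : Fin n} {y : ReadReply n V}
    (hd : ρ.Delivers t (.replica j) p (.readAck q.id y)) :
    ∃ r, s < r ∧ r < t ∧ ρ.ReadServed p q.id q.req j r y := by
  obtain ⟨r, hr, req, hs⟩ := ρ.readServed_of_delivers hd
  obtain ⟨r', hr', hs'⟩ := ρ.exists_sends_of_delivers hs.delivers
  obtain ⟨q', hq', hid, hreq⟩ := ρ.read_of_sends hs'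
  obtain ⟨s', h'⟩ := ih (r' + 1) (by omega) q' hq'
  have hss : s' = s := ρ.uid_injective (by rw [← h'.id, hid, h.id])
  subst hss
  obtain ⟨q₀, h1, -, h2⟩ := h'.start
  obtain ⟨q₁, h3, -, h4⟩ := h.start
  rw [h1] at h3; cases h3
  have : req = q.req := by rw [← hreq, ← h2, h4]
  subst this
  exact ⟨r, by have := h'.lt; omega, hr, hs⟩

lemma ReadOK.record {p : Proc n} {t s : ℕ} {q : ReadCall n V} (h : ρ.ReadOK p t q s) {j : Fin n}
    {y : ReadReply n V} (hy : ∃ r, s < r ∧ r < t ∧ ρ.ReadServed p q.id q.req j r y) :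
    ρ.ReadOK p t (q.record j y) s := by
  refine ⟨h.lt, h.id, h.start, fun i z hz => ?_⟩
  simp only [ReadCall.record] at hz ⊢
  by_cases hij : i = j
  · subst hij
    rw [Function.update_self] at hz
    cases hz
    exact hy
  · rw [Function.update_of_ne hij] at hz
    exact h.served i z hz

lemma exists_readOK (p : Proc n) (t : ℕ) (q : ReadCall n V) (hq : (ρ.ph p t).read = some q) :
    ∃ s, ρ.ReadOK p t q s := by
  -- Strong induction, because a reply delivered now leads back to the step in which the request was
  -- sent, and the invariant is needed there.
  induction t using Nat.strong_induction_on generalizing q with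
  | _ t ih =>
  rcases t with _ | t
  · rw [ρ.ph_zero] at hq; cases hq
  rcases ρ.ph_cases t p with h | h | ⟨j, m, hd, h | ⟨-, h⟩⟩
  · rw [h] at hq
    obtain ⟨s, hs⟩ := ih t t.lt_succ_self q hq
    exact ⟨s, hs.mono t.le_succ⟩
  · obtain ⟨req, h⟩ := ρ.ph_begins h
    have hq' := hq
    rw [h] at hq; cases hq
    exact ⟨t, readOK_start hq'⟩
  · rcases h.read hq with h | ⟨q', y, hq', rfl, rfl, -⟩ | rfl
    · obtain ⟨s, hs⟩ := ih t t.lt_succ_self q h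
      exact ⟨s, hs.mono t.le_succ⟩
    · obtain ⟨s, hs⟩ := ih t t.lt_succ_self q' hq'
      refine ⟨s, (hs.record ?_).mono t.le_succ⟩
      exact served_of_readOK (fun t' ht' => ih t' (Nat.lt_succ_of_le ht')) hs hd
    · exact ⟨t, readOK_start hq⟩
  · obtain ⟨req, rfl⟩ := h.read hq
    exact ⟨t, readOK_start hq⟩

/-- The replies of a completed read call. -/
structure ReadQuorum (ρ : Run (algorithmD n k v₀)) (p : Proc n) (q : ReadCall n V) (s t : ℕ)
    (R : Finset (Fin n)) (r : Fin n → ℕ) (y : Fin n → ReadReply n V) : Prop where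
  card : k + 1 ≤ R.card
  lt : ∀ l ∈ R, s < r l
  lt' : ∀ l ∈ R, r l < t
  served : ∀ l ∈ R, ρ.ReadServed p q.id q.req l (r l) (y l)
  entries : ∀ z, z ∈ entries q.acks ↔ ∃ l ∈ R, z = y l

lemma ReadOK.quorum {p : Proc n} {t s : ℕ} {q : ReadCall n V} (h : ρ.ReadOK p t q s)
    (hc : q.complete k = true) : ∃ R r y, ρ.ReadQuorum p q s t R r y := by
  have : ∀ l, ∃ (r : ℕ) (y : ReadReply n V), (q.acks l).isSome = true → q.acks l = some y ∧
      s < r ∧ r < t ∧ ρ.ReadServed p q.id q.req l r y := by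
    intro l
    rcases hl : q.acks l with _ | z
    -- Irrelevant values for replicas that have not replied.
    · exact ⟨0, .preCV 0, by simp⟩
    · obtain ⟨r, h⟩ := h.served l z hl
      exact ⟨r, z, fun _ => ⟨rfl, h⟩⟩
  choose r y hry using this
  refine ⟨Finset.univ.filter fun j => (q.acks j).isSome = true, r, y, of_decide_eq_true hc, ?_, ?_,
    ?_, ?_⟩
  · intro l hl
    exact (hry l (Finset.mem_filter.1 hl).2).2.1
  · intro l hl
    exact (hry l (Finset.mem_filter.1 hl).2).2.2.1
  · intro l hl
    exact (hry l (Finset.mem_filter.1 hl).2).2.2.2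
  · intro z
    rw [mem_entries]
    constructor
    · rintro ⟨j, hj⟩
      have hs : (q.acks j).isSome = true := by rw [hj]; rfl
      refine ⟨j, Finset.mem_filter.2 ⟨Finset.mem_univ _, hs⟩, ?_⟩
      have := (hry j hs).1
      rw [hj] at this
      exact Option.some.inj this
    · rintro ⟨l, hl, rfl⟩
      exact ⟨l, (hry l (Finset.mem_filter.1 hl).2).1⟩

/-- A read call of `p` completed in step `t`. -/
lemma exists_readQuorum {p : Proc n} {t : ℕ} {q : ReadCall n V} {s : ℕ}
    (hs : ρ.ReadOK p t q s) {j : Fin n} {y : ReadReply n V}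
    (hd : ρ.Delivers t (.replica j) p (.readAck q.id y))
    (hc : (q.record j y).complete k = true) :
    ∃ R r z, ρ.ReadQuorum p (q.record j y) s t R r z :=
  (hs.record (served_of_readOK (fun t' _ => exists_readOK p t') hs hd)).quorum hc

variable (ρ) in
/-- The write call `w` of process `p` at time `t` has been started in step `s`, its
acknowledgements have been given in between, those in `Q` before the start of the inner read
call. -/
structure WriteOK (p : Proc n) (t : ℕ) (w : WriteCall n V) (s : ℕ) : Prop where
  lt : s < t
  id : w.id = ρ.uid s
  start : ∃ w₀, (ρ.ph p (s + 1)).write = some w₀ ∧ w₀.id = w.id ∧ w₀.req = w.req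
  served : ∀ j a, w.Q j = some a ∨ w.M j = some a →
    ∃ r, s < r ∧ r < t ∧ ρ.WriteServed p w.id w.req j r a
  inner : ∀ q, w.inner = some q → ¬ w.req.IsTSVal ∧ ∃ s', q.id = ρ.uid s' ∧ q.req = .cv ∧
    ∀ j a, w.Q j = some a → ∃ r, s < r ∧ r < s' ∧ ρ.WriteServed p w.id w.req j r a
  cv : ∀ z, w.cv z = 0 ∨ ∃ l r, r < t ∧ w.cv z = (ρ.reg l (r + 1)).cv z
  le_inc : w.inner = none → ∀ j a, w.Q j = some a → w.cv j ≤ a.inc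

lemma WriteOK.mono {p : Proc n} {t t' : ℕ} {w : WriteCall n V} {s : ℕ} (h : ρ.WriteOK p t w s)
    (ht : t ≤ t') : ρ.WriteOK p t' w s :=
  ⟨h.lt.trans_le ht, h.id, h.start, fun j y hy =>
    let ⟨r, h1, h2, h3⟩ := h.served j y hy
    ⟨r, h1, h2.trans_le ht, h3⟩, h.inner, fun z => (h.cv z).imp_right
      fun ⟨l, r, h, h'⟩ => ⟨l, r, h.trans_le ht, h'⟩, h.le_inc⟩

lemma writeOK_start {p : Proc n} {t : ℕ} {req : WriteReq n V}
    (h : (ρ.ph p (t + 1)).write = some (WriteCall.start (ρ.uid t) req)) :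
    ρ.WriteOK p (t + 1) (WriteCall.start (ρ.uid t) req) t :=
  ⟨t.lt_succ_self, rfl, ⟨_, h, rfl, rfl⟩, by simp [WriteCall.start], by simp [WriteCall.start],
    by simp [WriteCall.start], by simp [WriteCall.start]⟩

lemma served_of_writeOK {p : Proc n} {t s : ℕ} {w : WriteCall n V}
    (ih : ∀ t' ≤ t, ∀ w, (ρ.ph p t').write = some w → ∃ s, ρ.WriteOK p t' w s)
    (h : ρ.WriteOK p t w s) {j : Fin n} {a : WAck n}
    (hd : ρ.Delivers t (.replica j) p (.writeAck w.id a.inc a.cv)) :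
    ∃ r, s < r ∧ r < t ∧ ρ.WriteServed p w.id w.req j r a := by
  obtain ⟨r, hr, req, hs⟩ := ρ.writeServed_of_delivers hd
  obtain ⟨inc, hdel⟩ := hs.delivers
  obtain ⟨r', hr', hs'⟩ := ρ.exists_sends_of_delivers hdel
  obtain ⟨w', -, hw', hid, hreq, -⟩ := ρ.write_of_sends hs'
  obtain ⟨s', h'⟩ := ih (r' + 1) (by omega) w' hw'
  have hss : s' = s := ρ.uid_injective (by rw [← h'.id, hid, h.id])
  subst hss
  obtain ⟨q₀, h1, -, h2⟩ := h'.start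
  obtain ⟨q₁, h3, -, h4⟩ := h.start
  rw [h1] at h3; cases h3
  have : req = w.req := by rw [← hreq, ← h2, h4]
  subst this
  exact ⟨r, by have := h'.lt; omega, hr, hs⟩

lemma WriteOK.merged {p : Proc n} {t s : ℕ} {w : WriteCall n V} (h : ρ.WriteOK p t w s) {j : Fin n}
    {a : WAck n} (ha : ∃ r, s < r ∧ r < t ∧ ρ.WriteServed p w.id w.req j r a) (i : Fin n)
    (b : WAck n) (hb : (w.merged j a).Q i = some b) :
    ∃ r, s < r ∧ r < t ∧ ρ.WriteServed p w.id w.req i r b := by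
  rcases mergeAck_eq_some hb with hb | hb
  · exact h.served i b (.inl hb)
  · by_cases hij : i = j
    · subst hij
      rw [Function.update_self] at hb
      rcases mergeAck_eq_some hb with hb | hb
      · exact h.served i b (.inr hb)
      · cases hb
        exact ha
    · rw [Function.update_of_ne hij] at hb
      exact h.served i b (.inr hb)

/-- The acknowledgements and crash vectors used in a validation. -/
structure ValidateOK (ρ : Run (algorithmD n k v₀)) (p : Proc n) (t : ℕ) (w w' : WriteCall n V)
    (S : List (CrashVec n)) (s : ℕ) : Prop where
  id : w'.id = w.id
  req : w'.req = w.req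
  served : ∀ j a, w'.Q j = some a ∨ w'.M j = some a →
    ∃ r, s < r ∧ r < t ∧ ρ.WriteServed p w.id w.req j r a
  cv : ∀ c ∈ S, ∃ l r, r < t ∧ c = (ρ.reg l (r + 1)).cv
  quorum : (w.req.IsTSVal ∧ ∀ c, c ∈ S ↔ ∃ j a, w'.Q j = some a ∧ a.cv = some c) ∨
    ∃ (R : Finset (Fin n)) (r : Fin n → ℕ), k + 1 ≤ R.card ∧ ∀ l ∈ R, r l < t ∧
      ρ.stale l (r l + 1) = false ∧ (ρ.reg l (r l + 1)).cv ∈ S ∧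
      ∀ j a, w'.Q j = some a → ∃ r', s < r' ∧ r' < r l ∧ ρ.WriteServed p w.id w.req j r' a

/-- In a direct validation the crash vectors are those in the acknowledgements of the merged set
itself. With an inner read, they come from `k + 1` replicas that answered after the inner call was
opened, hence after every acknowledgement in `Q`. This order of events is essential in `persist`. -/
lemma validateOK {p : Proc n} {t s : ℕ} {w w' : WriteCall n V} {j : Fin n} {m : DMsg n V}
    {S : List (CrashVec n)}
    (ih : ∀ t' ≤ t, ∀ w, (ρ.ph p t').write = some w → ∃ s, ρ.WriteOK p t' w s)
    (hw : (ρ.ph p t).write = some w) (h : ρ.WriteOK p t w s)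
    (hd : ρ.Delivers t (.replica j) p m) (hv : WriteCall.Validates k j m w w' S) :
    ρ.ValidateOK p t w w' S s := by
  rcases hv with ⟨_, a, hin, hc, hreq⟩ | ⟨_, q, y, hin, hc⟩
  · have hts : w.req.IsTSVal := by obtain ⟨T, v, hreq⟩ := hreq; rw [hreq]; trivial
    have ha := served_of_writeOK ih h hd
    refine ⟨rfl, rfl, ?_, ?_, .inl ⟨hts, ?_⟩⟩
    · rintro i b (hb | hb)
      · exact h.merged ha i b hb
      · cases hb
    · intro c hc
      obtain ⟨b, hb, hbc⟩ := List.mem_filterMap.1 hc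
      obtain ⟨i, hb⟩ := mem_entries.1 hb
      obtain ⟨r, -, hr, hs⟩ := h.merged ha i b hb
      have := (hs.tsVal hts).2.2
      rw [hbc] at this
      exact ⟨i, r, hr, Option.some.inj this⟩
    · intro c
      rw [List.mem_filterMap]
      constructor
      · rintro ⟨b, hb, hbc⟩
        obtain ⟨i, hb⟩ := mem_entries.1 hb
        exact ⟨i, b, hb, hbc⟩
      · rintro ⟨i, b, hb, hbc⟩
        exact ⟨b, mem_entries.2 ⟨i, hb⟩, hbc⟩
  · have hq : (ρ.ph p t).read = some q := by
      rcases hf : ρ.ph p t with _ | q' | w' <;> rw [hf] at hw <;> cases hw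
      exact hin
    obtain ⟨-, s', hid, hreq, hQ⟩ := h.inner q hin
    obtain ⟨s'', hs'⟩ := exists_readOK p t q hq
    have : s'' = s' := ρ.uid_injective (by rw [← hs'.id, hid])
    subst this
    obtain ⟨R, r, z, hR⟩ := exists_readQuorum hs' hd hc
    have hz : ∀ l ∈ R, z l = .cv (ρ.reg l (r l + 1)).cv := by
      intro l hl
      have := (hR.served l hl).reply
      rw [show (q.record j y).req = .cv from hreq] at this
      exact this
    refine ⟨rfl, rfl, h.served, ?_, .inr ⟨R, r, hR.card, fun l hl => ⟨hR.lt' l hl,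
      (hR.served l hl).stale', ?_, ?_⟩⟩⟩
    · intro c hc
      obtain ⟨b, hb, hbc⟩ := List.mem_filterMap.1 hc
      obtain ⟨l, hl, rfl⟩ := (hR.entries b).1 hb
      rw [hz l hl] at hbc
      cases hbc
      exact ⟨l, r l, hR.lt' l hl, rfl⟩
    · exact List.mem_filterMap.2 ⟨z l, (hR.entries _).2 ⟨l, hl, rfl⟩, by rw [hz l hl]; rfl⟩
    · intro i a ha
      obtain ⟨r', h1, h2, h3⟩ := hQ i a ha
      exact ⟨r', h1, h2.trans (hR.lt l hl), h3⟩

lemma exists_writeOK (p : Proc n) (t : ℕ) (w : WriteCall n V) (hw : (ρ.ph p t).write = some w) :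
    ∃ s, ρ.WriteOK p t w s := by
  induction t using Nat.strong_induction_on generalizing w with
  | _ t ih =>
  rcases t with _ | t
  · rw [ρ.ph_zero] at hw; cases hw
  rcases ρ.ph_cases t p with h | h | ⟨j, m, hd, h | ⟨-, h⟩⟩
  · rw [h] at hw
    obtain ⟨s, hs⟩ := ih t t.lt_succ_self w hw
    exact ⟨s, hs.mono t.le_succ⟩
  · obtain ⟨req, h⟩ := ρ.ph_begins h
    rw [h] at hw; cases hw
  · obtain ⟨w', hw', -, h⟩ := h.write hw
    have hw'' : (ρ.ph p t).write = some w' := by rw [hw']; rfl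
    obtain ⟨s, hs⟩ := ih t t.lt_succ_self w' hw''
    have ih' := fun t' (ht' : t' ≤ t) => ih t' (Nat.lt_succ_of_le ht')
    have hms := hs.mono t.le_succ
    refine ⟨s, ?_⟩
    rcases h with _ | ⟨_, a, h⟩ | ⟨_, a, h, hcard, hreq⟩ | ⟨_, q, y, h, hc⟩ |
      ⟨_, _, w'', S, hv, hdone⟩
    · exact hms
    · refine ⟨hms.lt, hms.id, hms.start, ?_, hms.inner, hms.cv, hms.le_inc⟩
      intro i b hb
      have : ∃ r, s < r ∧ r < t ∧ ρ.WriteServed p w'.id w'.req i r b := by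
        rcases hb with hb | hb
        · exact hs.served i b (.inl hb)
        · simp only [WriteCall.collect] at hb
          by_cases hij : i = j
          · subst hij
            rw [Function.update_self] at hb
            rcases mergeAck_eq_some hb with hb | hb
            · exact hs.served i b (.inr hb)
            · cases hb
              exact served_of_writeOK ih' hs hd
          · rw [Function.update_of_ne hij] at hb
            exact hs.served i b (.inr hb)
      obtain ⟨r, h1, h2, h3⟩ := this
      exact ⟨r, h1, h2.trans t.lt_succ_self, h3⟩
    · have ha := served_of_writeOK ih' hs hd
      refine ⟨hms.lt, hms.id, hms.start, ?_, ?_, hms.cv, by simp⟩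
      · rintro i b (hb | hb)
        · obtain ⟨r, h1, h2, h3⟩ := hs.merged ha i b hb
          exact ⟨r, h1, h2.trans t.lt_succ_self, h3⟩
        · cases hb
      · rintro q hq
        cases hq
        -- The inner read takes its identifier in this very step, so that it starts at `t`, after
        -- all acknowledgements merged into `Q`.
        refine ⟨?_, t, rfl, rfl, fun i b hb => hs.merged ha i b hb⟩
        intro hts
        change w'.req.IsTSVal at hts
        rcases hr : w'.req with ⟨T, v⟩ | _ | _
        · exact hreq T v hr
        · rw [hr] at hts; exact hts
        · rw [hr] at hts; exact hts
    · refine ⟨hms.lt, hms.id, hms.start, hms.served, ?_, hms.cv, by simp⟩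
      rintro q' hq'
      cases hq'
      exact hms.inner q h
    · have hV := validateOK ih' hw'' hs hd hv
      rw [WriteCall.validate_call]
      refine ⟨hms.lt, hV.id.trans hms.id, ?_, ?_, by simp, ?_, ?_⟩
      · obtain ⟨w₀, h1, h2, h3⟩ := hms.start
        exact ⟨w₀, h1, h2.trans hV.id.symm, h3.trans hV.req.symm⟩
      · intro i a ha
        have : w''.Q i = some a ∨ w''.M i = some a := by
          rcases ha with ha | ha
          · exact .inl (Option.filter_eq_some_iff.1 ha).1
          · exact .inr ha
        obtain ⟨r, h1, h2, h3⟩ := hV.served i a this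
        refine ⟨r, h1, h2.trans t.lt_succ_self, ?_⟩
        change ρ.WriteServed p w''.id w''.req i r a
        rw [hV.id, hV.req]
        exact h3
      · intro z
        rcases maxOf_eq_zero_or_mem (fun c : CrashVec n => c z) S with h0 | ⟨c, hc, h0⟩
        · exact .inl h0
        · obtain ⟨l, r, hr, rfl⟩ := hV.cv c hc
          exact .inr ⟨l, r, hr.trans t.lt_succ_self, h0⟩
      · intro _ i a ha
        exact of_decide_eq_true (Option.filter_eq_some_iff.1 ha).2
  · obtain ⟨req, rfl⟩ := h.write hw
    exact ⟨t, writeOK_start hw⟩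

/-- The request `req` has been acknowledged by the write quorum `Q`, in the steps `σ`, and the
incarnation numbers in the acknowledgements have been validated, all before step `s`. -/
structure QuorumWrite (ρ : Run (algorithmD n k v₀)) (req : WriteReq n V) (s : ℕ)
    (Q : Finset (Fin n)) (σ : Fin n → ℕ) : Prop where
  card : n - k ≤ Q.card
  lt : ∀ j ∈ Q, σ j < s
  holds : ∀ j ∈ Q, req.Holds (ρ.reg j (σ j + 1))
  valid : (∀ j ∈ Q, ρ.stale j (σ j + 1) = false ∧
      ∀ l ∈ Q, (ρ.reg l (σ l + 1)).cv j ≤ (ρ.reg j (σ j + 1)).cv j) ∨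
    ∃ (R : Finset (Fin n)) (r : Fin n → ℕ), k + 1 ≤ R.card ∧ ∀ l ∈ R, r l < s ∧
      ρ.stale l (r l + 1) = false ∧
      ∀ j ∈ Q, σ j < r l ∧ (ρ.reg l (r l + 1)).cv j ≤ (ρ.reg j (σ j + 1)).cv j

/-- A replica survives the validation only if its number is at least the entrywise maximum of `S`,
hence at least the corresponding entry of each single crash vector used. -/
lemma exists_quorumWrite {p : Proc n} {t : ℕ} {w : WriteCall n V}
    (hw : (ρ.ph p t).write = some w) {j : Fin n} {m : DMsg n V}
    (hd : ρ.Delivers t (.replica j) p m) (hf : WriteCall.Finish k j m w) :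
    ∃ Q σ, ρ.QuorumWrite w.req t Q σ := by
  obtain ⟨w', S, hv, hdone⟩ := hf
  obtain ⟨s, hs⟩ := exists_writeOK p t w hw
  have hV := validateOK (fun t' _ => exists_writeOK p t') hw hs hd hv
  rw [WriteCall.validate_done_iff, WriteCall.validate_call] at hdone
  simp only [count] at hdone
  set Q := Finset.univ.filter fun i =>
    ((w'.Q i).filter fun a => decide (maxOf (fun c => c i) S ≤ a.inc)).isSome = true with hQ
  have hmem : ∀ i ∈ Q, ∃ a, w'.Q i = some a ∧ maxOf (fun c => c i) S ≤ a.inc := by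
    intro i hi
    obtain ⟨a, ha⟩ := Option.isSome_iff_exists.1 (Finset.mem_filter.1 hi).2
    exact ⟨a, (Option.filter_eq_some_iff.1 ha).1, of_decide_eq_true (Option.filter_eq_some_iff.1 ha).2⟩
  rcases hV.quorum with ⟨hts, hS⟩ | ⟨R, r, hR, hr⟩
  · have : ∀ i, ∃ σ, i ∈ Q → ∃ a, w'.Q i = some a ∧ maxOf (fun c => c i) S ≤ a.inc ∧
        σ < t ∧ ρ.WriteServed p w.id w.req i σ a := by
      intro i
      by_cases hi : i ∈ Q
      · obtain ⟨a, ha, hle⟩ := hmem i hi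
        obtain ⟨σ, -, h1, h2⟩ := hV.served i a (.inl ha)
        exact ⟨σ, fun _ => ⟨a, ha, hle, h1, h2⟩⟩
      · exact ⟨0, fun h => absurd h hi⟩
    choose σ hσ using this
    refine ⟨Q, σ, hdone, ?_, ?_, .inl ?_⟩
    · intro i hi
      obtain ⟨a, -, -, h, -⟩ := hσ i hi
      exact h
    · intro i hi
      obtain ⟨a, -, -, -, h⟩ := hσ i hi
      exact h.holds
    · intro i hi
      obtain ⟨a, -, hle, -, h⟩ := hσ i hi
      refine ⟨(h.tsVal hts).2.1, fun l hl => ?_⟩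
      obtain ⟨b, hb, -, -, h'⟩ := hσ l hl
      rw [← h.inc]
      exact (le_maxOf (g := fun c : CrashVec n => c i) ((hS _).2 ⟨l, b, hb, (h'.tsVal hts).2.2⟩)).trans hle
  · have hne : R.Nonempty := Finset.card_pos.1 (by omega)
    -- The acknowledgement steps must precede the answers of all readers at once; they are chosen
    -- relative to the reader that answered first.
    obtain ⟨l₀, hl₀, hmin⟩ := Finset.exists_min_image R r hne
    have : ∀ i, ∃ σ, i ∈ Q → ∃ a, w'.Q i = some a ∧ maxOf (fun c => c i) S ≤ a.inc ∧
        σ < r l₀ ∧ ρ.WriteServed p w.id w.req i σ a := by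
      intro i
      by_cases hi : i ∈ Q
      · obtain ⟨a, ha, hle⟩ := hmem i hi
        obtain ⟨σ, -, h1, h2⟩ := (hr l₀ hl₀).2.2.2 i a ha
        exact ⟨σ, fun _ => ⟨a, ha, hle, h1, h2⟩⟩
      · exact ⟨0, fun h => absurd h hi⟩
    choose σ hσ using this
    refine ⟨Q, σ, hdone, ?_, ?_, .inr ⟨R, r, hR, fun l hl => ⟨(hr l hl).1, (hr l hl).2.1, ?_⟩⟩⟩
    · intro i hi
      obtain ⟨a, -, -, h, -⟩ := hσ i hi
      exact h.trans (hr l₀ hl₀).1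
    · intro i hi
      obtain ⟨a, -, -, -, h⟩ := hσ i hi
      exact h.holds
    · intro i hi
      obtain ⟨a, -, hle, h1, h⟩ := hσ i hi
      refine ⟨h1.trans_le (hmin l hl), ?_⟩
      rw [← h.inc]
      exact (le_maxOf (g := fun c : CrashVec n => c i) (hr l hl).2.2.1).trans hle

end Run

end CRR


namespace CRR

universe u

variable {n k : ℕ} {V : Type u} {v₀ : V}

/-! ## Steps of replicas -/

/-- The effect of the receipt of a message on the state of a replica. -/
inductive RecvStep (k : ℕ) (i : Fin n) (x : ℕ) (src : Proc n) :
    DMsg n V → DReplica n V → DReplica n V → Prop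
  | same (m s) : RecvStep k i x src m s s
  | state (s : DReplica n V) (id inc : ℕ) (j : Fin n) (hj : src = .replica j)
      (hs : s.stale = false) :
      RecvStep k i x src (.read id (.state inc)) s { s with reg := s.reg.raiseCV j inc }
  | tsVal (s : DReplica n V) (id inc : ℕ) (t : TS) (v : V) (hs : s.stale = false) :
      RecvStep k i x src (.write id (.tsVal t v) inc) s { s with reg := s.reg.raiseTS t v }
  | preCV (s : DReplica n V) (id inc : ℕ) (j : Fin n) (m : ℕ) :
      RecvStep k i x src (.write id (.preCV j m) inc) s
        { s with reg := (s.reg.raiseCV i inc).raisePreCV j m }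
  | cv (s : DReplica n V) (id inc : ℕ) (j : Fin n) (m : ℕ) :
      RecvStep k i x src (.write id (.cv j m) inc) s
        { s with reg := (s.reg.raiseCV i inc).raiseCV j m }
  | readPre (s : DReplica n V) (q : ReadCall n V) (j : Fin n) (y : ReadReply n V)
      (hj : src = .replica j) (hs : s.recovery = .readPre q) :
      RecvStep k i x src (.readAck q.id y) s { s with recovery := .readPre (q.record j y) }
  | readPreDone (s : DReplica n V) (q : ReadCall n V) (j : Fin n) (y : ReadReply n V)
      (hj : src = .replica j) (hs : s.recovery = .readPre q)
      (hc : (q.record j y).complete k = true) (m : ℕ)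
      (hm : m = maxOf (fun m => m) ((entries (q.record j y).acks).filterMap ReadReply.preCV?) + 1) :
      RecvStep k i x src (.readAck q.id y) s
        { s with recovery := .writePre m (WriteCall.start x (.preCV i m)) }
  | writePre (s : DReplica n V) (m : ℕ) (w w' : WriteCall n V) (j : Fin n) (msg : DMsg n V)
      (hj : src = .replica j) (hs : s.recovery = .writePre m w)
      (h : WriteCall.Step k x j msg w w') :
      RecvStep k i x src msg s { s with recovery := .writePre m w' }
  | writePreDone (s : DReplica n V) (m : ℕ) (w : WriteCall n V) (j : Fin n) (msg : DMsg n V)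
      (hj : src = .replica j) (hs : s.recovery = .writePre m w)
      (h : WriteCall.Finish k j msg w) :
      RecvStep k i x src msg s { s with
        reg := { s.reg with cv := Function.update s.reg.cv i m }
        recovery := .writeCV (WriteCall.start x (.cv i m)) }
  | writeCV (s : DReplica n V) (w w' : WriteCall n V) (j : Fin n) (msg : DMsg n V)
      (hj : src = .replica j) (hs : s.recovery = .writeCV w)
      (h : WriteCall.Step k x j msg w w') :
      RecvStep k i x src msg s { s with recovery := .writeCV w' }
  | writeCVDone (s : DReplica n V) (w : WriteCall n V) (j : Fin n) (msg : DMsg n V)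
      (hj : src = .replica j) (hs : s.recovery = .writeCV w)
      (h : WriteCall.Finish k j msg w) :
      RecvStep k i x src msg s { s with
        recovery := .readState (ReadCall.start x (.state (s.reg.cv i))) }
  | readState (s : DReplica n V) (q : ReadCall n V) (j : Fin n) (y : ReadReply n V)
      (hj : src = .replica j) (hs : s.recovery = .readState q) :
      RecvStep k i x src (.readAck q.id y) s { s with recovery := .readState (q.record j y) }
  | readStateDone (s : DReplica n V) (q : ReadCall n V) (j : Fin n) (y : ReadReply n V)
      (hj : src = .replica j) (hs : s.recovery = .readState q)
      (hc : (q.record j y).complete k = true) :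
      RecvStep k i x src (.readAck q.id y) s
        ⟨s.reg.absorb ((entries (q.record j y).acks).filterMap ReadReply.state?), false, .completed⟩

lemma recvStep_afterWritePre {i j : Fin n} {x : ℕ} {s : DReplica n V} {m : ℕ} {w : WriteCall n V}
    {r : WriteStep n V} {msg : DMsg n V} (hs : s.recovery = .writePre m w)
    (h : WriteCall.Move k x j msg w r) :
    RecvStep k i x (.replica j) msg s (dAfterWritePre i x s m r).state := by
  unfold dAfterWritePre
  rcases h with ⟨hd, h, -⟩ | ⟨hd, h⟩
  · rw [hd]
    exact .writePre s m w _ j msg rfl hs h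
  · rw [hd]
    exact .writePreDone s m w j msg rfl hs h

lemma recvStep_afterWriteCV {i j : Fin n} {x : ℕ} {s : DReplica n V} {w : WriteCall n V}
    {r : WriteStep n V} {msg : DMsg n V} (hs : s.recovery = .writeCV w)
    (h : WriteCall.Move k x j msg w r) :
    RecvStep k i x (.replica j) msg s (dAfterWriteCV i x s r).state := by
  unfold dAfterWriteCV
  rcases h with ⟨hd, h, -⟩ | ⟨hd, h⟩
  · rw [hd]
    exact .writeCV s w _ j msg rfl hs h
  · rw [hd]
    exact .writeCVDone s w j msg rfl hs h

lemma recvStep (i : Fin n) (x : ℕ) (src : Proc n) (m : DMsg n V) (s : DReplica n V)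
    (d : PUnit.{u + 1}) : RecvStep k i x src m s (dReplicaRecv k i x src m s d).state := by
  rcases m with ⟨id, req⟩ | ⟨id, y⟩ | ⟨id, req, inc⟩ | ⟨id, inc, cv⟩
  · simp only [dReplicaRecv]
    split_ifs with hs
    · exact .same _ _
    · split
      · exact .state s _ _ _ rfl (by simpa using hs)
      · exact .same _ _
  · rcases src with ⟨j⟩ | ⟨c⟩
    · simp only [dReplicaRecv, dOnReadAck]
      rcases hs : s.recovery with _ | q | ⟨m, w⟩ | w | q
      · exact .same _ _
      · dsimp only
        by_cases hid : id = q.id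
        · subst hid
          rw [if_pos rfl]
          split_ifs with hc
          · exact .readPreDone s q j y rfl hs hc _ rfl
          · exact .readPre s q j y rfl hs
        · rw [if_neg hid]
          exact .same _ _
      · exact recvStep_afterWritePre hs (WriteCall.onReadAck_move _ _ _ _ _)
      · exact recvStep_afterWriteCV hs (WriteCall.onReadAck_move _ _ _ _ _)
      · dsimp only
        by_cases hid : id = q.id
        · subst hid
          rw [if_pos rfl]
          split_ifs with hc
          · exact .readStateDone s q j y rfl hs hc
          · exact .readState s q j y rfl hs
        · rw [if_neg hid]
          exact .same _ _
    · exact .same _ _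
  · rcases req with ⟨t, v⟩ | ⟨j, m⟩ | ⟨j, m⟩
    · simp only [dReplicaRecv]
      split_ifs with hs
      · exact .same _ _
      · exact .tsVal s _ _ _ _ (by simpa using hs)
    · exact .preCV s _ _ _ _
    · exact .cv s _ _ _ _
  · rcases src with ⟨j⟩ | ⟨c⟩
    · simp only [dReplicaRecv, dOnWriteAck]
      rcases hs : s.recovery with _ | q | ⟨m, w⟩ | w | q
      · exact .same _ _
      · exact .same _ _
      · exact recvStep_afterWritePre hs (WriteCall.onWriteAck_move _ _ _ _ ⟨_, _⟩)
      · exact recvStep_afterWriteCV hs (WriteCall.onWriteAck_move _ _ _ _ ⟨_, _⟩)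
      · exact .same _ _
    · exact .same _ _

/-! ### The recovery invariant -/

namespace Run

variable (ρ : Run (algorithmD n k v₀))

lemma rep_cases (i : Fin n) (t : ℕ) : ρ.Restarts t i ∨ ρ.rep i (t + 1) = ρ.rep i t ∨
    ∃ src m, ρ.Delivers t src (.replica i) m ∧
      RecvStep k i (ρ.uid t) src m (ρ.rep i t) (ρ.rep i (t + 1)) := by
  by_cases hr : ρ.Restarts t i
  · exact .inl hr
  · by_cases hd : ∃ src m, ρ.Delivers t src (.replica i) m
    · obtain ⟨src, m, hd⟩ := hd
      refine .inr (.inr ⟨src, m, hd, ?_⟩)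
      rw [ρ.rep_deliver hd]
      exact recvStep _ _ _ _ _ _
    · exact .inr (.inl (ρ.rep_other (by simpa using hd) hr))

lemma not_restarts_of_delivers {t : ℕ} {i : Fin n} {p d : Proc n} {m : DMsg n V}
    (h : ρ.Delivers t p d m) : ¬ ρ.Restarts t i := by
  rintro ⟨rb, e, h'⟩
  unfold Delivers at h
  rw [h] at h'; cases h'

lemma stale_iff (i : Fin n) (t : ℕ) : ρ.stale i t = true ↔ ρ.recov i t ≠ .completed := by
  induction t with
  | zero => simp [stale, recov, rep_zero]
  | succ t ih =>
    rcases ρ.rep_cases i t with h | h | ⟨src, m, -, h⟩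
    · simp [stale, recov, ρ.rep_restart h]
    · simpa only [stale, recov, h] using ih
    · simp only [stale, recov] at ih ⊢
      generalize ρ.rep i t = s at h ih
      generalize ρ.rep i (t + 1) = s' at h ih
      rcases h with _ | _ | _ | _ | _ | _ | _ | _ | _ | _ | _ | _ | _ <;> simp_all

/-- Replica `i` adopts the incarnation number `m` in step `s`. -/
def Assigns (s : ℕ) (i : Fin n) (m : ℕ) : Prop :=
  ∃ w w', ρ.recov i s = .writePre m w ∧ ρ.recov i (s + 1) = .writeCV w'

/-- The last restart of replica `i` before time `t` is in step `r`. -/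
structure LastRestart (i : Fin n) (r t : ℕ) : Prop where
  lt : r < t
  restarts : ρ.Restarts r i
  not_restarts : ∀ s, r < s → s < t → ¬ ρ.Restarts s i

variable {ρ}

lemma LastRestart.succ {i : Fin n} {r t : ℕ} (h : ρ.LastRestart i r t) (ht : ¬ ρ.Restarts t i) :
    ρ.LastRestart i r (t + 1) :=
  ⟨h.lt.trans t.lt_succ_self, h.restarts, fun s h1 h2 => by
    rcases Nat.lt_succ_iff_lt_or_eq.1 h2 with h2 | rfl
    · exact h.not_restarts s h1 h2
    · exact ht⟩

variable (ρ)

/-- Apart from a restart, only the adoption of an incarnation number overwrites instead of raising.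
That this does not lower the entry is known only later, from persistence (`Persist.reg_le_succ`). -/
lemma reg_le {i : Fin n} {t : ℕ} (hr : ¬ ρ.Restarts t i) (ha : ∀ m, ¬ ρ.Assigns t i m) :
    (ρ.reg i t).Le (ρ.reg i (t + 1)) := by
  rcases ρ.rep_cases i t with h | h | ⟨src, m, -, h⟩
  · exact absurd h hr
  · simp only [reg, h]
    exact .refl _
  · simp only [Assigns, recov] at ha
    simp only [reg]
    generalize ρ.rep i t = s at h ha
    generalize ρ.rep i (t + 1) = s' at h ha
    rcases h with _ | _ | _ | _ | _ | _ | _ | _ | ⟨_, m, w, j, msg, hj, hs, hf⟩ | _ | _ | _ | _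
    · exact .refl _
    · exact RegState.le_raiseCV _ _ _
    · exact RegState.le_raiseTS _ _ _
    · exact (RegState.le_raiseCV _ _ _).trans (RegState.le_raisePreCV _ _ _)
    · exact (RegState.le_raiseCV _ _ _).trans (RegState.le_raiseCV _ _ _)
    · exact .refl _
    · exact .refl _
    · exact .refl _
    · exact absurd ⟨w, _, hs, rfl⟩ (ha m)
    · exact .refl _
    · exact .refl _
    · exact .refl _
    · exact RegState.le_absorb_self _ _

lemma reg_of_assigns {i : Fin n} {t m : ℕ} (h : ρ.Assigns t i m) :
    ρ.reg i (t + 1) = { ρ.reg i t with cv := Function.update (ρ.reg i t).cv i m } ∧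
      ∃ j msg w, ρ.Delivers t (.replica j) (.replica i) msg ∧ ρ.recov i t = .writePre m w ∧
        WriteCall.Finish k j msg w ∧
        ρ.recov i (t + 1) = .writeCV (WriteCall.start (ρ.uid t) (.cv i m)) := by
  obtain ⟨w, w', h1, h2⟩ := h
  rcases ρ.rep_cases i t with h | h | ⟨src, m, hd, h⟩
  · simp only [recov, ρ.rep_restart h] at h2
    cases h2
  · simp only [recov] at h1 h2
    rw [h, h1] at h2
    cases h2
  · simp only [recov] at h1 h2
    simp only [reg, recov]
    generalize ρ.rep i t = s at h h1 h2
    generalize ρ.rep i (t + 1) = s' at h h2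
    rcases h with _ | _ | _ | _ | _ | _ | _ | _ | ⟨_, m, w, j, msg, hj, hs, hf⟩ | _ | _ | _ | _ <;>
      simp_all
    obtain ⟨rfl, rfl⟩ := h1
    exact ⟨j, _, hd, hf⟩

lemma not_restarts_of_assigns {i : Fin n} {t m : ℕ} (h : ρ.Assigns t i m) : ¬ ρ.Restarts t i := by
  obtain ⟨-, j, msg, w, hd, -⟩ := ρ.reg_of_assigns h
  exact ρ.not_restarts_of_delivers hd

/-- The replies to a read of `preCV i`, given between the steps `r₀` and `s`, are less than `m`. -/
def PreCVRead (i : Fin n) (r₀ m s : ℕ) : Prop :=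
  ∃ (R : Finset (Fin n)) (r : Fin n → ℕ), k + 1 ≤ R.card ∧ ∀ l ∈ R, r₀ < r l ∧ r l < s ∧
    ρ.stale l (r l + 1) = false ∧ (ρ.reg l (r l + 1)).preCV i < m

/-- The current incarnation of `i`, which starts with step `r₀`, has not yet adopted an incarnation
number at time `t`. -/
def NoAssign (i : Fin n) (r₀ t : ℕ) : Prop := ∀ s m, r₀ ≤ s → s < t → ¬ ρ.Assigns s i m

/-- The current incarnation of `i`, which starts with step `r₀`, has adopted the incarnation number
`m` in step `s₁` before time `t`. -/
structure Assigned (i : Fin n) (r₀ s₁ m t : ℕ) : Prop where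
  last : ρ.LastRestart i r₀ t
  lt : r₀ < s₁
  lt' : s₁ < t
  assigns : ρ.Assigns s₁ i m
  unique : ∀ s m', r₀ ≤ s → s < t → ρ.Assigns s i m' → s = s₁
  le_cv : m ≤ (ρ.reg i t).cv i

/-- The current incarnation of `i` has completed its recovery before time `t`. -/
structure Recovered (i : Fin n) (r₀ s₁ m s₂ t : ℕ) (Q : Finset (Fin n)) (σ : Fin n → ℕ)
    (R : Finset (Fin n)) (r : Fin n → ℕ) : Prop where
  assigned : ρ.Assigned i r₀ s₁ m t
  lt : s₁ < s₂
  write : ρ.QuorumWrite (.cv i m) s₂ Q σ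
  card : k + 1 ≤ R.card
  lt' : ∀ l ∈ R, s₂ < r l
  lt_time : ∀ l ∈ R, r l + 1 < t
  stale : ∀ l ∈ R, ρ.stale l (r l + 1) = false
  le_cv : ∀ l ∈ R, m ≤ (ρ.reg l (r l + 1)).cv i
  le : ∀ l ∈ R, (ρ.reg l (r l + 1)).Le (ρ.reg i t)

/-- What is known about the recovery of replica `i` at time `t`. -/
def RecoveryOK (i : Fin n) (t : ℕ) : Recovery n V → Prop
  | .completed => (∀ s < t, ¬ ρ.Restarts s i) ∨
      ∃ r₀ s₁ m s₂ Q σ R r, ρ.Recovered i r₀ s₁ m s₂ t Q σ R r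
  | .readPre q => q.req = .preCV i ∧ ∃ r₀, q.id = ρ.uid r₀ ∧ ρ.LastRestart i r₀ t ∧
      ρ.NoAssign i r₀ t
  | .writePre m w => w.req = .preCV i m ∧ ∃ r₀, ρ.LastRestart i r₀ t ∧ ρ.NoAssign i r₀ t ∧
      ρ.PreCVRead i r₀ m t
  | .writeCV w => ∃ r₀ s₁ m, w.req = .cv i m ∧ ρ.Assigned i r₀ s₁ m t
  | .readState q => ∃ r₀ s₁ m s₂ inc Q σ, q.req = .state inc ∧ m ≤ inc ∧
      inc = (ρ.reg i s₂).cv i ∧ s₂ < t ∧ q.id = ρ.uid s₂ ∧ s₁ < s₂ ∧ ρ.Assigned i r₀ s₁ m t ∧ ρ.QuorumWrite (.cv i m) s₂ Q σ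

variable {ρ}

lemma Assigned.succ {i : Fin n} {r₀ s₁ m t : ℕ} (h : ρ.Assigned i r₀ s₁ m t)
    (hr : ¬ ρ.Restarts t i) (ha : ∀ m, ¬ ρ.Assigns t i m) : ρ.Assigned i r₀ s₁ m (t + 1) :=
  ⟨h.last.succ hr, h.lt, h.lt'.trans t.lt_succ_self, h.assigns, fun s m' h1 h2 h3 => by
    rcases Nat.lt_succ_iff_lt_or_eq.1 h2 with h2 | rfl
    · exact h.unique s m' h1 h2 h3
    · exact absurd h3 (ha m'), h.le_cv.trans ((ρ.reg_le hr ha).cv i)⟩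

lemma NoAssign.succ {i : Fin n} {r₀ t : ℕ} (h : ρ.NoAssign i r₀ t)
    (ha : ∀ m, ¬ ρ.Assigns t i m) : ρ.NoAssign i r₀ (t + 1) := fun s m h1 h2 => by
  rcases Nat.lt_succ_iff_lt_or_eq.1 h2 with h2 | rfl
  · exact h s m h1 h2
  · exact ha m

lemma PreCVRead.mono {i : Fin n} {r₀ m s s' : ℕ} (h : ρ.PreCVRead i r₀ m s) (hs : s ≤ s') :
    ρ.PreCVRead i r₀ m s' :=
  let ⟨R, r, h1, h2⟩ := h
  ⟨R, r, h1, fun l hl => ⟨(h2 l hl).1, (h2 l hl).2.1.trans_le hs, (h2 l hl).2.2⟩⟩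

/-- Steps in which neither the recovery nor an incarnation number changes. -/
lemma RecoveryOK.succ {i : Fin n} {t : ℕ} {f : Recovery n V} (h : ρ.RecoveryOK i t f)
    (hr : ¬ ρ.Restarts t i) (ha : ∀ m, ¬ ρ.Assigns t i m) : ρ.RecoveryOK i (t + 1) f := by
  rcases f with _ | q | ⟨m, w⟩ | w | q
  · rcases h with h | ⟨r₀, s₁, m, s₂, Q, σ, R, r, h⟩
    · refine .inl fun s hs => ?_
      rcases Nat.lt_succ_iff_lt_or_eq.1 hs with hs | rfl
      · exact h s hs
      · exact hr
    · exact .inr ⟨r₀, s₁, m, s₂, Q, σ, R, r, h.assigned.succ hr ha, h.lt, h.write, h.card, h.lt',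
        fun l hl => (h.lt_time l hl).trans t.lt_succ_self, h.stale, h.le_cv,
        fun l hl => (h.le l hl).trans (ρ.reg_le hr ha)⟩
  · obtain ⟨h1, r₀, h2, h3, h4⟩ := h
    exact ⟨h1, r₀, h2, h3.succ hr, h4.succ ha⟩
  · obtain ⟨h1, r₀, h2, h3, h4⟩ := h
    exact ⟨h1, r₀, h2.succ hr, h3.succ ha, h4.mono t.le_succ⟩
  · obtain ⟨r₀, s₁, m, h1, h2⟩ := h
    exact ⟨r₀, s₁, m, h1, h2.succ hr ha⟩
  · obtain ⟨r₀, s₁, m, s₂, inc, Q, σ, h1, h2, h3, h4, h5, h6, h7, h8⟩ := h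
    exact ⟨r₀, s₁, m, s₂, inc, Q, σ, h1, h2, h3, h4.trans t.lt_succ_self, h5, h6, h7.succ hr ha,
      h8⟩

lemma lastRestart_of_restarts {i : Fin n} {t : ℕ} (h : ρ.Restarts t i) :
    ρ.LastRestart i t (t + 1) :=
  ⟨t.lt_succ_self, h, fun s h1 h2 => by omega⟩

/-- Each completed quorum access of the recovery leaves its evidence in the invariant of the next
stage: the answers about `preCV`, the adoption, the write of `cv`, the collected states. Steps that
do not advance the recovery are covered by `RecoveryOK.succ`. -/
lemma recoveryOK (i : Fin n) (t : ℕ) : ρ.RecoveryOK i t (ρ.recov i t) := by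
  induction t with
  | zero =>
    have : ρ.recov i 0 = .completed := by simp [recov, rep_zero]
    rw [this]
    exact .inl fun s hs => absurd hs (Nat.not_lt_zero s)
  | succ t ih =>
    rcases ρ.rep_cases i t with h | h | ⟨src, msg, hd, h⟩
    · simp only [recov, ρ.rep_restart h]
      refine ⟨rfl, t, rfl, lastRestart_of_restarts h, fun s m h1 h2 h3 => ?_⟩
      have : s = t := by omega
      subst this
      exact ρ.not_restarts_of_assigns h3 h
    -- Equality of the states does not by itself exclude a restart.
    · by_cases hr : ρ.Restarts t i
      · simp only [recov, ρ.rep_restart hr] at *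
        have h' := congrArg DReplica.recovery h
        refine ⟨rfl, t, rfl, lastRestart_of_restarts hr, fun s m h1 h2 h3 => ?_⟩
        have : s = t := by omega
        subst this
        exact ρ.not_restarts_of_assigns h3 hr
      · have ha : ∀ m, ¬ ρ.Assigns t i m := by
          rintro m ⟨w, w', h1, h2⟩
          simp only [recov] at h1 h2
          rw [h, h1] at h2
          cases h2
        have := ih.succ hr ha
        simp only [recov, h] at this ⊢
        exact this
    · have hr : ¬ ρ.Restarts t i := ρ.not_restarts_of_delivers hd
      have key : (∀ m w w', ρ.recov i t = .writePre m w → ρ.recov i (t + 1) ≠ .writeCV w') →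
          ∀ m, ¬ ρ.Assigns t i m := by
        rintro h m ⟨w, w', h1, h2⟩
        exact h m w w' h1 h2
      have same : ρ.recov i (t + 1) = ρ.recov i t → ρ.RecoveryOK i (t + 1) (ρ.recov i (t + 1)) := by
        intro h
        rw [h]
        refine ih.succ hr (key fun m w w' h1 h2 => ?_)
        rw [h, h1] at h2; cases h2
      have step : ∀ f f', ρ.recov i t = f → ρ.recov i (t + 1) = f' →
          (∀ m w w', f = .writePre m w → f' ≠ .writeCV w') → ρ.RecoveryOK i (t + 1) f := by
        rintro f f' rfl rfl h
        exact ih.succ hr (key h)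
      have hph : ρ.ph (.replica i) t = (ρ.recov i t).phase := rfl
      have e1 : ρ.recov i t = (ρ.rep i t).recovery := rfl
      have e2 : ρ.recov i (t + 1) = (ρ.rep i (t + 1)).recovery := rfl
      have e3 : ρ.reg i t = (ρ.rep i t).reg := rfl
      have e4 : ρ.reg i (t + 1) = (ρ.rep i (t + 1)).reg := rfl
      generalize ρ.rep i t = s at h e1 e3
      generalize ρ.rep i (t + 1) = s' at h e2 e4
      rcases h with _ | _ | _ | _ | _ | ⟨_, q, j, y, rfl, hs⟩ | ⟨_, q, j, y, rfl, hs, hc, m, hm⟩ |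
        ⟨_, m, w, w', j, msg, rfl, hs, h⟩ | ⟨_, m, w, j, msg, rfl, hs, h⟩ |
        ⟨_, w, w', j, msg, rfl, hs, h⟩ | ⟨_, w, j, msg, rfl, hs, h⟩ | ⟨_, q, j, y, rfl, hs⟩ |
        ⟨_, q, j, y, rfl, hs, hc⟩
      · exact same (by rw [e1, e2])
      · exact same (by rw [e1, e2])
      · exact same (by rw [e1, e2])
      · exact same (by rw [e1, e2])
      · exact same (by rw [e1, e2])
      · rw [hs] at e1
        rw [e2]
        obtain ⟨hreq, r₀, hid, hlast, hna⟩ := step _ _ e1 e2 (by simp)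
        exact ⟨hreq, r₀, hid, hlast, hna⟩
      · rw [hs] at e1
        rw [e1] at hph
        obtain ⟨hreq, r₀, hid, hlast, hna⟩ := step _ _ e1 e2 (by simp)
        obtain ⟨s, hok⟩ := exists_readOK (.replica i) t q (by rw [hph]; rfl)
        -- The read of `preCV` was started by the restart itself, so its answers belong to the time
        -- after `r₀`.
        have : s = r₀ := ρ.uid_injective (by rw [← hok.id, hid])
        subst this
        obtain ⟨R, r, z, hR⟩ := exists_readQuorum hok hd hc
        rw [e2]
        refine ⟨rfl, s, hlast, hna, R, r, hR.card, fun l hl => ⟨hR.lt l hl,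
          (hR.lt' l hl).trans t.lt_succ_self, (hR.served l hl).stale', ?_⟩⟩
        have hz := (hR.served l hl).reply
        rw [show (q.record j y).req = .preCV i from hreq] at hz
        rw [hm]
        refine Nat.lt_succ_of_le (le_maxOf (g := fun m => m) ?_)
        exact List.mem_filterMap.2 ⟨z l, (hR.entries _).2 ⟨l, hl, rfl⟩, by rw [hz]; rfl⟩
      · rw [hs] at e1
        rw [e2]
        obtain ⟨hreq, r₀, hlast, hna, hp⟩ := step _ _ e1 e2 (by simp)
        exact ⟨h.req.1.trans hreq, r₀, hlast, hna, hp⟩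
      · rw [hs] at e1
        have hasg : ρ.Assigns t i m := ⟨w, _, e1, e2⟩
        rw [e1] at ih
        obtain ⟨hreq, r₀, hlast, hna, hp⟩ := ih
        rw [e2]
        refine ⟨r₀, t, m, rfl, hlast.succ hr, hlast.lt, t.lt_succ_self, hasg, ?_, ?_⟩
        · intro s m' h1 h2 h3
          rcases Nat.lt_succ_iff_lt_or_eq.1 h2 with h2 | rfl
          · exact absurd h3 (hna s m' h1 h2)
          · rfl
        · rw [e4]
          simp
      · rw [hs] at e1
        rw [e2]
        obtain ⟨r₀, s₁, m, hreq, hA⟩ := step _ _ e1 e2 (by simp)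
        exact ⟨r₀, s₁, m, h.req.1.trans hreq, hA⟩
      · rw [hs] at e1
        rw [e1] at hph ih
        obtain ⟨r₀, s₁, m, hreq', hA'⟩ := ih
        obtain ⟨Q, σ, hQ⟩ := exists_quorumWrite (p := .replica i) (w := w) (by rw [hph]; rfl) hd h
        rw [hreq'] at hQ
        rw [e2, ← e3]
        -- The step that completes the write of `cv` also opens the state read; thus `t` is both the
        -- end of the quorum write and the start of the read.
        refine ⟨r₀, s₁, m, t, _, Q, σ, rfl, hA'.le_cv, rfl, t.lt_succ_self, rfl, hA'.lt', hA'.succ hr (key ?_), hQ⟩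
        intro m w w' h1
        rw [e1] at h1; cases h1
      · rw [hs] at e1
        rw [e2]
        obtain ⟨r₀, s₁, m, s₂, inc, Q, σ, h⟩ := step _ _ e1 e2 (by simp)
        exact ⟨r₀, s₁, m, s₂, inc, Q, σ, h⟩
      · rw [hs] at e1
        rw [e1] at hph
        obtain ⟨r₀, s₁, m, s₂, inc, Q, σ, hreq, hinc, -, -, hid, hlt, hA, hQ⟩ := step _ _ e1 e2 (by simp)
        obtain ⟨s, hok⟩ := exists_readOK (.replica i) t q (by rw [hph]; rfl)
        have : s = s₂ := ρ.uid_injective (by rw [← hok.id, hid])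
        subst this
        obtain ⟨R, r, z, hR⟩ := exists_readQuorum hok hd hc
        rw [e2]
        refine .inr ⟨r₀, s₁, m, s, Q, σ, R, r, hA, hlt, hQ, hR.card, hR.lt, ?_, ?_, ?_, ?_⟩
        · exact fun l hl => Nat.succ_lt_succ (hR.lt' l hl)
        · exact fun l hl => (hR.served l hl).stale'
        -- Every replica that hands over its state has first raised its entry for `i` to `inc`,
        -- which is at least `m`.
        · exact fun l hl => hinc.trans ((hR.served l hl).state i inc rfl hreq)
        · intro l hl
          have hz := (hR.served l hl).reply
          rw [show (q.record j y).req = .state inc from hreq] at hz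
          rw [e4]
          refine RegState.le_absorb _ ?_
          exact List.mem_filterMap.2 ⟨z l, (hR.entries _).2 ⟨l, hl, rfl⟩, by rw [hz]; rfl⟩

/-- The adoption of an incarnation number `m` by `i` follows a read of `preCV i` with smaller
answers, by the same incarnation, and a write of `preCV i`. -/
lemma Assigns.spec {i : Fin n} {s m : ℕ} (h : ρ.Assigns s i m) :
    ∃ r₀, ρ.LastRestart i r₀ s ∧ ρ.NoAssign i r₀ s ∧ ρ.PreCVRead i r₀ m s ∧
      ∃ Q σ, ρ.QuorumWrite (.preCV i m) s Q σ := by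
  obtain ⟨-, j, msg, w, hd, h1, hf, -⟩ := ρ.reg_of_assigns h
  have hok := recoveryOK (ρ := ρ) i s
  rw [h1] at hok
  obtain ⟨hreq, r₀, hlast, hna, hp⟩ := hok
  refine ⟨r₀, hlast, hna, hp, ?_⟩
  rw [← hreq]
  exact exists_quorumWrite (p := .replica i) (by simp only [ph, h1]; rfl) hd hf

end Run

end CRR


namespace CRR

universe u

variable {n k : ℕ} {V : Type u} {v₀ : V}

namespace Run

variable {ρ : Run (algorithmD n k v₀)}

/-! ## Origin of incarnation numbers -/

lemma write_cases {p : Proc n} {t : ℕ} {w : WriteCall n V} (h : (ρ.ph p t).write = some w) :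
    (∃ c res T v, p = .client c ∧ ρ.cl c t = .store res w ∧ w.req = .tsVal T v) ∨
    (∃ i r₀ s₁ m, p = .replica i ∧ ρ.recov i t = .writeCV w ∧ w.req = .cv i m ∧
      ρ.Assigned i r₀ s₁ m t) ∨
    ∃ i m, p = .replica i ∧ ρ.recov i t = .writePre m w ∧ w.req = .preCV i m := by
  rcases p with i | c
  · have hok := recoveryOK (ρ := ρ) i t
    rcases hf : ρ.recov i t with _ | q | ⟨m, w'⟩ | w' | q <;> rw [hf] at hok <;>
      simp only [ph, hf, Recovery.phase, Phase.write, reduceCtorEq, Option.some.injEq] at h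
    · subst h
      exact .inr (.inr ⟨i, m, rfl, hf, hok.1⟩)
    · subst h
      obtain ⟨r₀, s₁, m, hreq, h⟩ := hok
      exact .inr (.inl ⟨i, r₀, s₁, m, rfl, hf, hreq, h⟩)
  · have hok := ρ.cl_storeOK c t
    rcases hf : ρ.cl c t with _ | ⟨op, q⟩ | ⟨res, w'⟩ <;>
      simp only [ph, hf, DClient.phase, Phase.write, reduceCtorEq, Option.some.injEq] at h
    subst h
    obtain ⟨⟨T, v, hreq⟩, -⟩ := hok _ _ hf
    exact .inl ⟨c, res, T, v, rfl, hf, hreq⟩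

/-- A State request is another way in which a number enters a crash vector; what it carries is an
entry of the requester itself, to which the induction in `assigns_of_cv` applies. -/
lemma inc_of_state_request {i : Fin n} {t inc : ℕ} {q : ReadCall n V}
    (h : (ρ.ph (.replica i) t).read = some q) (hreq : q.req = .state inc) :
    ∃ s < t, inc = (ρ.reg i s).cv i := by
  have hok := recoveryOK (ρ := ρ) i t
  have hinner : ∀ w, ρ.ph (.replica i) t = .wr w → False := by
    intro w hw
    obtain ⟨s, hs⟩ := exists_writeOK (ρ := ρ) (.replica i) t w (by rw [hw]; rfl)
    rw [hw] at h
    obtain ⟨-, s', -, h', -⟩ := hs.inner q h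
    rw [hreq] at h'; cases h'
  rcases hf : ρ.recov i t with _ | q' | ⟨m, w⟩ | w | q' <;> rw [hf] at hok <;>
    simp only [ph, hf, Recovery.phase, Phase.read, reduceCtorEq, Option.some.injEq] at h hinner
  · subst h
    obtain ⟨h', -⟩ := hok
    rw [hreq] at h'; cases h'
  · exact (hinner w rfl).elim
  · exact (hinner w rfl).elim
  · subst h
    obtain ⟨-, -, -, s₂, inc', -, -, h1, -, h2, h3, -⟩ := hok
    rw [hreq] at h1; cases h1
    exact ⟨s₂, h3, h2⟩

/-- Every positive entry for `i` of a crash vector is an incarnation number adopted by `i`. -/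
lemma assigns_of_cv (l i : Fin n) (t : ℕ) :
    (ρ.reg l t).cv i = 0 ∨ ∃ s < t, ρ.Assigns s i ((ρ.reg l t).cv i) := by
  induction t using Nat.strong_induction_on generalizing l with
  | _ t ih =>
  rcases t with _ | t
  · left
    simp [reg, rep_zero, RegState.initial]
  have old : ∀ l', ∀ t' ≤ t, (ρ.reg l' t').cv i = 0 ∨
      ∃ s < t + 1, ρ.Assigns s i ((ρ.reg l' t').cv i) := fun l' t' ht' =>
    (ih t' (by omega) l').imp_right fun ⟨s, h1, h2⟩ => ⟨s, by omega, h2⟩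
  have hmax : ∀ a b : ℕ, (a = 0 ∨ ∃ s < t + 1, ρ.Assigns s i a) →
      (b = 0 ∨ ∃ s < t + 1, ρ.Assigns s i b) →
      (max a b = 0 ∨ ∃ s < t + 1, ρ.Assigns s i (max a b)) := by
    intro a b ha hb
    rcases max_choice a b with h | h <;> rw [h] <;> assumption
  have raise : ∀ (s : RegState n V) (j : Fin n) (m : ℕ),
      (s.cv i = 0 ∨ ∃ s' < t + 1, ρ.Assigns s' i (s.cv i)) →
      (j = i → (m = 0 ∨ ∃ s < t + 1, ρ.Assigns s i m)) →
      ((s.raiseCV j m).cv i = 0 ∨ ∃ s' < t + 1, ρ.Assigns s' i ((s.raiseCV j m).cv i)) := by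
    intro s j m hs hm
    by_cases hij : i = j
    · subst hij
      simp only [RegState.raiseCV, Function.update_self]
      exact hmax _ _ hs (hm rfl)
    · simp only [RegState.raiseCV, Function.update_of_ne hij]
      exact hs
  -- The numbers in write requests: `inc` is an entry of the vector computed by the caller, and so
  -- zero or copied from some replica; the argument of a CV request is the number its sender has
  -- adopted.
  have hwrite : ∀ {p : Proc n} {id inc : ℕ} {req : WriteReq n V},
      ρ.Delivers t p (.replica l) (.write id req inc) →
      (l = i → (inc = 0 ∨ ∃ s < t + 1, ρ.Assigns s i inc)) ∧
      (∀ j m, req = .cv j m → j = i → (m = 0 ∨ ∃ s < t + 1, ρ.Assigns s i m)) := by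
    intro p id inc req hd
    obtain ⟨r, hr, hs⟩ := ρ.exists_sends_of_delivers hd
    obtain ⟨w, z, hw, -, hreq, -, hz, hinc⟩ := ρ.write_of_sends hs
    cases hz
    obtain ⟨s, hok⟩ := exists_writeOK p _ w hw
    constructor
    · rintro rfl
      rcases hok.cv l with h0 | ⟨l', r', hr', h0⟩
      · exact .inl (hinc.trans h0)
      · rw [hinc, h0]
        exact old _ _ (by omega)
    · rintro j m rfl rfl
      rcases write_cases hw with ⟨_, _, T, v, -, -, h⟩ | ⟨i, r₀, s₁, m', rfl, -, h, hA⟩ |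
        ⟨_, _, -, -, h⟩
      · rw [h] at hreq; cases hreq
      · rw [h] at hreq; cases hreq
        exact .inr ⟨s₁, by have := hA.lt'; omega, hA.assigns⟩
      · rw [h] at hreq; cases hreq
  rcases ρ.rep_cases l t with h | h | ⟨src, msg, hd, h⟩
  · left
    simp [reg, ρ.rep_restart h, RegState.initial]
  · simp only [reg, h]
    exact old l t le_rfl
  · have hph : ρ.ph (.replica l) t = (ρ.recov l t).phase := rfl
    have e1 : ρ.recov l t = (ρ.rep l t).recovery := rfl
    have e2 : ρ.recov l (t + 1) = (ρ.rep l (t + 1)).recovery := rfl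
    have e3 : ρ.reg l t = (ρ.rep l t).reg := rfl
    have e4 : ρ.reg l (t + 1) = (ρ.rep l (t + 1)).reg := rfl
    have hold := old l t le_rfl
    rw [e3] at hold
    rw [e4]
    generalize ρ.rep l t = s at h e1 e3 hold
    generalize ρ.rep l (t + 1) = s' at h e2 e4
    rcases h with _ | ⟨_, id, inc, j, rfl, -⟩ | _ | _ | _ | _ | _ | _ |
      ⟨_, m, w, j, msg, rfl, hs, h⟩ | _ | _ | _ | ⟨_, q, j, y, rfl, hs, hc⟩
    · exact hold
    · refine raise _ _ _ hold ?_
      rintro rfl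
      obtain ⟨r, hr, hs⟩ := ρ.exists_sends_of_delivers hd
      obtain ⟨q, hq, -, hreq⟩ := ρ.read_of_sends hs
      obtain ⟨s', hs', rfl⟩ := inc_of_state_request hq hreq
      exact old _ _ (by omega)
    · rw [RegState.raiseTS_cv]
      exact hold
    · exact raise _ _ _ hold (hwrite hd).1
    · exact raise _ _ _ (raise _ _ _ hold (hwrite hd).1) ((hwrite hd).2 _ _ rfl)
    · exact hold
    · exact hold
    · exact hold
    · by_cases hil : i = l
      · subst hil
        simp only [Function.update_self]
        rw [hs] at e1
        exact .inr ⟨t, t.lt_succ_self, w, _, e1, e2⟩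
      · simp only [Function.update_of_ne hil]
        exact hold
    · exact hold
    · exact hold
    · exact hold
    · rw [hs] at e1
      rw [e1] at hph
      have hok := recoveryOK (ρ := ρ) l t
      rw [e1] at hok
      obtain ⟨-, -, -, -, inc, -, -, hreq, -⟩ := hok
      obtain ⟨s, hok⟩ := exists_readOK (.replica l) t q (by rw [hph]; rfl)
      obtain ⟨R, r, z, hR⟩ := exists_readQuorum hok hd hc
      simp only [RegState.absorb_cv]
      refine hmax _ _ hold ?_
      rcases maxOf_eq_zero_or_mem (fun a : RegState n V => a.cv i)
        ((entries (q.record j y).acks).filterMap ReadReply.state?) with h0 | ⟨a, ha, h0⟩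
      · exact .inl h0
      · rw [h0]
        obtain ⟨b, hb, hba⟩ := List.mem_filterMap.1 ha
        obtain ⟨x, hx, rfl⟩ := (hR.entries b).1 hb
        have hz := (hR.served x hx).reply
        rw [show (q.record j y).req = .state inc from hreq] at hz
        rw [hz] at hba
        cases hba
        exact old _ _ (hR.lt' x hx)

/-! ## Persistence of quorum writes -/

/-- Disjoint quorums would have at least `(n - k) + (k + 1)` elements, more than the `n` replicas,
also if the subtraction is truncated. -/
lemma exists_mem_inter {Q R : Finset (Fin n)} (hQ : n - k ≤ Q.card) (hR : k + 1 ≤ R.card) :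
    ∃ x ∈ Q, x ∈ R := by
  by_contra h
  push Not at h
  have hd : Disjoint Q R := Finset.disjoint_left.2 h
  have := Finset.card_union_of_disjoint hd
  have h' := Finset.card_le_univ (Q ∪ R)
  rw [Fintype.card_fin] at h'
  omega

variable (ρ) in
/-- Quorum writes completed before time `t` are known to the replicas that acknowledged them, until
time `t`, whenever these are not stale. -/
def Persist (t : ℕ) : Prop :=
  ∀ req s Q σ, ρ.QuorumWrite req s Q σ → s < t → ∀ j ∈ Q, ∀ u ≤ t, σ j < u →
    ρ.stale j u = false → req.Holds (ρ.reg j u)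

/-- Before `v` was adopted, it was written to `preCV i` at a write quorum. A replica of this quorum
answers the read by the new incarnation, by persistence with at least `v`, and `m` exceeds all
answers. -/
lemma Persist.assigns_lt {t : ℕ} (hP : ρ.Persist t) {i : Fin n} {r₀ m s v s' : ℕ}
    (h : ρ.PreCVRead i r₀ m s) (hs : s ≤ t) (h' : ρ.Assigns s' i v) (hs' : s' < r₀) : v < m := by
  obtain ⟨R, r, hR, hr⟩ := h
  obtain ⟨-, -, -, -, Q, σ, hQ⟩ := h'.spec
  obtain ⟨l, hlQ, hlR⟩ := exists_mem_inter hQ.card hR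
  obtain ⟨h1, h2, h3, h4⟩ := hr l hlR
  have := hQ.lt l hlQ
  have h5 : v ≤ _ := hP _ _ _ _ hQ (by omega) l hlQ (r l + 1) (by omega) (by omega) h3
  exact h5.trans_lt h4

/-- A positive entry at a time up to the restart is a number adopted before it, so `assigns_lt`
applies. A zero entry is smaller because `m` exceeds at least one answer. -/
lemma Persist.cv_lt {t : ℕ} (hP : ρ.Persist t) {i l : Fin n} {r₀ m s u : ℕ}
    (h : ρ.PreCVRead i r₀ m s) (hs : s ≤ t) (hu : u ≤ r₀) : (ρ.reg l u).cv i < m := by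
  rcases assigns_of_cv (ρ := ρ) l i u with h0 | ⟨s', hs', ha⟩
  · rw [h0]
    obtain ⟨R, r, hR, hr⟩ := h
    obtain ⟨l, hl⟩ : R.Nonempty := Finset.card_pos.1 (by omega)
    have := (hr l hl).2.2.2
    omega
  · exact hP.assigns_lt h hs ha (by omega)

/-- The current incarnation has not adopted a number before, so a positive entry of `i` for itself
stems from a former incarnation. -/
lemma Persist.cv_le_of_assigns {t : ℕ} (hP : ρ.Persist t) {i : Fin n} {s m : ℕ}
    (h : ρ.Assigns s i m) (hs : s ≤ t) : (ρ.reg i s).cv i ≤ m := by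
  obtain ⟨r₀, hlast, hna, hp, -⟩ := h.spec
  rcases assigns_of_cv (ρ := ρ) i i s with h0 | ⟨s', hs', ha⟩
  · rw [h0]; exact Nat.zero_le _
  · refine (hP.assigns_lt hp hs ha ?_).le
    by_contra hlt
    exact hna s' _ (not_lt.1 hlt) hs' ha

/-- With persistence up to `t`, the adoption of a number is monotone as well, so that only restarts
lose information. -/
lemma Persist.reg_le_succ {t : ℕ} (hP : ρ.Persist t) {i : Fin n} {u : ℕ} (hu : u ≤ t)
    (hr : ¬ ρ.Restarts u i) : (ρ.reg i u).Le (ρ.reg i (u + 1)) := by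
  by_cases ha : ∃ m, ρ.Assigns u i m
  · obtain ⟨m, ha⟩ := ha
    rw [(ρ.reg_of_assigns ha).1]
    refine ⟨le_rfl, fun j => ?_, fun _ => le_rfl⟩
    by_cases hj : j = i
    · subst hj
      simp only [Function.update_self]
      exact hP.cv_le_of_assigns ha hu
    · simp only [Function.update_of_ne hj]
      exact le_rfl
  · exact ρ.reg_le hr (by simpa using ha)

lemma Persist.reg_mono {t : ℕ} (hP : ρ.Persist t) {i : Fin n} {a b : ℕ} (hab : a ≤ b)
    (hb : b ≤ t + 1) (hr : ∀ s, a ≤ s → s < b → ¬ ρ.Restarts s i) :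
    (ρ.reg i a).Le (ρ.reg i b) := by
  induction b, hab using Nat.le_induction with
  | base => exact .refl _
  | succ b hab ih =>
    exact (ih (by omega) fun s h1 h2 => hr s h1 (by omega)).trans
      (hP.reg_le_succ (by omega) (hr b hab (by omega)))

lemma LastRestart.unique {i : Fin n} {r r' t t' s : ℕ} (h : ρ.LastRestart i r t)
    (h' : ρ.LastRestart i r' t') (hr : r < s) (hr' : r' < s) (ht : s ≤ t) (ht' : s ≤ t') :
    r = r' := by
  rcases lt_trichotomy r r' with hlt | rfl | hlt
  · exact absurd h'.restarts (h.not_restarts r' hlt (by omega))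
  · rfl
  · exact absurd h.restarts (h'.not_restarts r hlt (by omega))

lemma Assigned.preCVRead {i : Fin n} {r₀ s₁ m t : ℕ} (h : ρ.Assigned i r₀ s₁ m t) :
    ρ.PreCVRead i r₀ m s₁ := by
  obtain ⟨r₀', hlast, -, hp, -⟩ := h.assigns.spec
  have : r₀ = r₀' := h.last.unique hlast h.lt hlast.lt h.lt'.le le_rfl
  subst this
  exact hp

/-- A replica that is not stale and has restarted has recovered since. -/
lemma exists_recovered {i : Fin n} {s t : ℕ} (hs : ρ.stale i t = false) (hst : s < t)
    (hr : ρ.Restarts s i) : ∃ r₀ s₁ m s₂ Q σ R r, ρ.Recovered i r₀ s₁ m s₂ t Q σ R r ∧ s ≤ r₀ := by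
  have hok := recoveryOK (ρ := ρ) i t
  have hc : ρ.recov i t = .completed := by
    by_contra h
    rw [(ρ.stale_iff i t).2 h] at hs
    cases hs
  rw [hc] at hok
  rcases hok with h | ⟨r₀, s₁, m, s₂, Q, σ, R, r, h⟩
  · exact absurd hr (h s hst)
  · refine ⟨r₀, s₁, m, s₂, Q, σ, R, r, h, ?_⟩
    by_contra hlt
    exact h.assigned.last.not_restarts s (not_le.1 hlt) hst hr

/-- A replica that restarted after its acknowledgement has recovered from a read quorum, which meets
`Q` in some `l`. Either `l` already had the information and passed it on, or `l` acknowledged with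
knowledge of the new incarnation number and the validation would have rejected the old
acknowledgement. -/
theorem persist (ρ : Run (algorithmD n k v₀)) (t : ℕ) : ρ.Persist t := by
  -- Two nested inductions: the one on `t` gives persistence of all quorum writes at earlier times,
  -- used for `preCV` and `cv`; the one on `u` gives the claim for the same quorum write at the
  -- earlier moment when `l` answers the recovery of `j`.
  induction t using Nat.strong_induction_on with
  | _ t ih =>
  intro req s Q σ hQ hst j hj u
  induction u using Nat.strong_induction_on generalizing j with
  | _ u ihu =>
  intro hut hσu hstale
  by_cases hres : ∃ s', σ j < s' ∧ s' < u ∧ ρ.Restarts s' j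
  swap
  · push Not at hres
    refine RegState.Le.holds ?_ (hQ.holds j hj)
    -- Monotonicity up to `u` needs persistence only up to `u - 1`, which is less than `t`.
    exact (ih (u - 1) (by omega)).reg_mono (by omega) (by omega) fun s' h1 h2 => hres s' (by omega) h2
  obtain ⟨s', hs', hs'u, hres⟩ := hres
  obtain ⟨r₀, s₁, m, s₂, Q₂, σ₂, R, r, hrec, hle⟩ := exists_recovered hstale hs'u hres
  have hA := hrec.assigned
  have hlt := hrec.lt
  obtain ⟨l, hlQ, hlR⟩ := exists_mem_inter hQ.card hrec.card
  have hlt' := hrec.lt' l hlR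
  have hltt := hrec.lt_time l hlR
  -- Did `l` acknowledge the write no later than it handed its state to the recovering `j`?
  by_cases hcase : σ l < r l + 1
  · exact (hrec.le l hlR).holds
      (ihu (r l + 1) hltt l hlQ (by omega) hcase (hrec.stale l hlR))
  -- Now `l` acknowledged after answering `j`, hence with knowledge of `m`, whereas `j` acknowledged
  -- before its restart with a number less than `m`. It remains to find `m` among the crash vectors
  -- of the validation.
  exfalso
  have hP₁ := ih s₁ (by have := hA.lt'; omega)
  have hcv : (ρ.reg j (σ j + 1)).cv j < m := hP₁.cv_lt hA.preCVRead le_rfl (by omega)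
  refine absurd hcv (not_lt.2 ?_)
  have hσl := hQ.lt l hlQ
  rcases hQ.valid with hv | ⟨Rv, rv, hRv, hv⟩
  · obtain ⟨-, hv'⟩ := hv j hj
    refine le_trans ?_ (hv' l hlQ)
    -- If `l` restarted between its answer and its acknowledgement, it forgot `m`; but its own
    -- recovery read took place after the write of CV(j, m) was complete and meets the quorum of
    -- that write.
    by_cases hres' : ∃ s', r l < s' ∧ s' < σ l + 1 ∧ ρ.Restarts s' l
    · obtain ⟨s'', h1, h2, h3⟩ := hres'
      obtain ⟨r₀', s₁', m', s₂', Q', σ', R', r', hrec', hle'⟩ :=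
        exists_recovered (hv l hlQ).1 h2 h3
      obtain ⟨x, hxQ, hxR⟩ := exists_mem_inter hrec.write.card hrec'.card
      have h4 := hrec'.lt
      have h5 := hrec'.lt' x hxR
      have h6 := hrec'.lt_time x hxR
      have h7 := hrec'.assigned.lt
      have h8 := hrec.write.lt x hxQ
      have h9 : m ≤ _ := ih (r' x + 1) (by omega) _ _ _ _ hrec.write (by omega) x hxQ (r' x + 1)
        le_rfl (by omega) (hrec'.stale x hxR)
      exact h9.trans ((hrec'.le x hxR).cv j)
    · push Not at hres'
      exact (hrec.le_cv l hlR).trans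
        (((ih (σ l) (by omega)).reg_mono (by omega) le_rfl fun s' h1 h2 =>
          hres' s' (by omega) h2).cv j)
  -- The readers of CV answered after the acknowledgement of `l`, hence after the write of CV(j, m)
  -- was complete, and one of them belongs to its quorum.
  · obtain ⟨x, hxQ, hxR⟩ := exists_mem_inter hrec.write.card hRv
    obtain ⟨h1, h2, h3⟩ := hv x hxR
    have h4 := (h3 l hlQ).1
    have h8 := hrec.write.lt x hxQ
    have h9 : m ≤ _ := ih (rv x + 1) (by omega) _ _ _ _ hrec.write (by omega) x hxQ (rv x + 1)
      le_rfl (by omega) h2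
    exact h9.trans (h3 j hj).2

/-- A read quorum whose replies follow a quorum write meets the replicas that know it. -/
lemma QuorumWrite.exists_holds {req : WriteReq n V} {s : ℕ} {Q : Finset (Fin n)} {σ : Fin n → ℕ}
    (h : ρ.QuorumWrite req s Q σ) {R : Finset (Fin n)} {r : Fin n → ℕ} (hR : k + 1 ≤ R.card)
    (hr : ∀ l ∈ R, s ≤ r l ∧ ρ.stale l (r l + 1) = false) :
    ∃ l ∈ R, req.Holds (ρ.reg l (r l + 1)) := by
  obtain ⟨l, hlQ, hlR⟩ := exists_mem_inter h.card hR
  obtain ⟨h1, h2⟩ := hr l hlR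
  have := h.lt l hlQ
  exact ⟨l, hlR, persist ρ _ _ _ _ _ h (by omega) l hlQ _ le_rfl (by omega) h2⟩

end Run

end CRR


namespace CRR

universe u

variable {n k : ℕ} {V : Type u} {v₀ : V}

/-! ## Steps of clients -/

/-- The first phase of an operation reads this. -/
def RegOp.req (n : ℕ) : RegOp V → ReadReq n
  | .read => .tsVal
  | .write _ => .ts

/-- The effect of the receipt of a message on the state of a client; the last argument is the
response. -/
inductive ClientRecv (k : ℕ) (v₀ : V) (c x : ℕ) (j : Fin n) :
    DMsg n V → DClient n V → DClient n V → Option (RegResp V) → Prop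
  | same (m s) : ClientRecv k v₀ c x j m s s none
  | record (op : RegOp V) (q : ReadCall n V) (y : ReadReply n V) :
      ClientRecv k v₀ c x j (.readAck q.id y) (.query op q) (.query op (q.record j y)) none
  | store (op : RegOp V) (q : ReadCall n V) (y : ReadReply n V)
      (hc : (q.record j y).complete k = true) :
      ClientRecv k v₀ c x j (.readAck q.id y) (.query op q)
        (dClientStore v₀ c x op (q.record j y).acks).state none
  | step (m : DMsg n V) (res : RegResp V) (w w' : WriteCall n V)
      (h : WriteCall.Step k x j m w w') : ClientRecv k v₀ c x j m (.store res w) (.store res w') none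
  | done (m : DMsg n V) (res : RegResp V) (w : WriteCall n V) (h : WriteCall.Finish k j m w) :
      ClientRecv k v₀ c x j m (.store res w) .idle (some res)

lemma dClientStore_resp (c x : ℕ) (op : RegOp V) (acks : Fin n → Option (ReadReply n V)) :
    (dClientStore v₀ c x op acks).resp = none := by
  unfold dClientStore
  split <;> rfl

lemma clientRecv (c x : ℕ) (j : Fin n) (m : DMsg n V) (s : DClient n V) :
    ClientRecv k v₀ c x j m s (dClientRecv k v₀ c x (.replica j) m s).state
      (dClientRecv k v₀ c x (.replica j) m s).resp := by
  unfold dClientRecv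
  split
  · rename_i op q j' id y hj
    cases hj
    dsimp only
    by_cases hid : id = q.id
    · subst hid
      rw [if_pos rfl]
      split_ifs with hc
      · rw [dClientStore_resp]
        exact .store op q y hc
      · exact .record op q y
    · rw [if_neg hid]
      exact .same _ _
  · rename_i res w j' id inc cv hj
    cases hj
    dsimp only
    rcases WriteCall.onWriteAck_move (k := k) w x j id ⟨inc, cv⟩ with ⟨hd, h, -⟩ | ⟨hd, h⟩
    · rw [hd]
      exact .step _ _ _ _ h
    · rw [hd]
      exact .done _ _ _ h
  · exact .same _ _

/-! ### The two phases of an operation -/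

namespace Run

variable (ρ : Run (algorithmD n k v₀))

lemma cl_cases (c t : ℕ) : (∃ op, ρ.Invokes t c op) ∨
    (ρ.cl c (t + 1) = ρ.cl c t ∧ ∀ r, ρ.resp t ≠ some (c, r)) ∨
    ∃ j m o, ρ.Delivers t (.replica j) (.client c) m ∧
      ClientRecv k v₀ c (ρ.uid t) j m (ρ.cl c t) (ρ.cl c (t + 1)) o ∧
      ∀ r, ρ.resp t = some (c, r) ↔ o = some r := by
  by_cases hi : ∃ op, ρ.Invokes t c op
  · exact .inl hi
  · right
    by_cases hd : ∃ src m, ρ.Delivers t src (.client c) m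
    · obtain ⟨src, m, hd⟩ := hd
      have hr : ∀ r, ρ.resp t = some (c, r) ↔
          (dClientRecv k v₀ c (ρ.uid t) src m (ρ.cl c t)).resp = some r := by
        intro r
        rw [ρ.resp_eq_some]
        constructor
        · rintro ⟨src', m', hd', h⟩
          unfold Delivers at hd hd'
          rw [hd] at hd'
          cases hd'
          exact h
        · exact fun h => ⟨src, m, hd, h⟩
      rcases src with ⟨j⟩ | ⟨c'⟩
      · refine .inr ⟨j, m, _, hd, ?_, hr⟩
        rw [ρ.cl_deliver hd]
        exact clientRecv _ _ _ _ _
      · left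
        rw [ρ.cl_deliver hd, dClientRecv_client]
        refine ⟨rfl, fun r => ?_⟩
        rw [Ne, hr, dClientRecv_client]
        simp
    · refine .inl ⟨ρ.cl_other (by simpa using hd) (by simpa using hi), fun r h => ?_⟩
      obtain ⟨src, m, h, -⟩ := ρ.resp_eq_some.1 h
      exact hd ⟨src, m, h⟩

lemma resp_of_invokes {t c : ℕ} {op : RegOp V} (h : ρ.Invokes t c op) (c' : ℕ) (r : RegResp V) :
    ρ.resp t ≠ some (c', r) := by
  intro hr
  obtain ⟨src, m, h', -⟩ := ρ.resp_eq_some.1 hr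
  unfold Delivers at h'
  unfold Invokes at h
  rw [h] at h'; cases h'

lemma resp_spec {t c : ℕ} {r : RegResp V} (h : ρ.resp t = some (c, r)) :
    ρ.cl c (t + 1) = .idle ∧ ∃ w j m, ρ.cl c t = .store r w ∧
      ρ.Delivers t (.replica j) (.client c) m ∧ WriteCall.Finish k j m w := by
  rcases ρ.cl_cases c t with ⟨op, hi⟩ | ⟨-, h'⟩ | ⟨j, m, o, hd, hc, hr⟩
  · exact absurd h (ρ.resp_of_invokes hi c r)
  · exact absurd h (h' r)
  · rw [hr] at h
    subst h
    generalize hs : ρ.cl c t = s at hc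
    generalize hs' : ρ.cl c (t + 1) = s' at hc
    generalize ho : some r = o at hc
    rcases hc with _ | _ | _ | _ | ⟨_, res, w, hf⟩ <;> cases ho
    exact ⟨rfl, w, j, m, rfl, hd, hf⟩

lemma pending_iff (c t : ℕ) : (ρ.cfg t).pending c = true ↔ ρ.cl c t ≠ .idle := by
  induction t with
  | zero => simp [pending_zero, cl_zero]
  | succ t ih =>
    rcases ρ.cl_cases c t with ⟨op, hi⟩ | ⟨h, h'⟩ | ⟨j, m, o, hd, hc, hr⟩
    · simp [ρ.pending_invoke hi, ρ.cl_invoke hi, dClientInvoke]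
    · by_cases hi : ∃ op, ρ.Invokes t c op
      · obtain ⟨op, hi⟩ := hi
        simp [ρ.pending_invoke hi, ρ.cl_invoke hi, dClientInvoke]
      · rw [ρ.pending_other (by simpa using hi) h', h, ih]
    · have hi : ∀ op, ¬ ρ.Invokes t c op := by
        intro op hi
        unfold Invokes at hi
        unfold Delivers at hd
        rw [hi] at hd; cases hd
      rcases o with _ | r
      · rw [ρ.pending_other hi (fun r h => by simpa using (hr r).1 h), ih]
        generalize ρ.cl c t = s at hc
        generalize ρ.cl c (t + 1) = s' at hc
        generalize ho : (none : Option (RegResp V)) = o at hc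
        rcases hc with _ | _ | ⟨op, q, y, hc⟩ | _ | _
        · rfl
        · simp
        · unfold dClientStore
          split <;> simp
        · simp
        · cases ho
      · have := (hr r).2 rfl
        rw [ρ.pending_resp this, (ρ.resp_spec this).1]
        simp

lemma not_idle_succ {c t : ℕ} (h : ρ.cl c t ≠ .idle) (hr : ∀ r, ρ.resp t ≠ some (c, r)) :
    ρ.cl c (t + 1) ≠ .idle := by
  rw [← pending_iff] at h ⊢
  by_cases hi : ∃ op, ρ.Invokes t c op
  · obtain ⟨op, hi⟩ := hi
    exact ρ.pending_invoke hi
  · rw [ρ.pending_other (by simpa using hi) hr, h]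

lemma idle_of_invokes {c t : ℕ} {op : RegOp V} (h : ρ.Invokes t c op) : ρ.cl c t = .idle := by
  by_contra hne
  rw [← ne_eq, ← pending_iff, ρ.pending_eq_false_of_invoke h] at hne
  cases hne

/-- The operation `op` invoked by `c` in step `o` enters its second phase in step `s`, in which it
stores the pair `(T, v)` and after which it returns `res`. -/
structure Stores (o c : ℕ) (op : RegOp V) (T : TS) (v : V) (res : RegResp V) (s : ℕ) : Prop where
  invokes : ρ.Invokes o c op
  lt : o < s
  query : ∀ u, o < u → u ≤ s → ∃ op' q, ρ.cl c u = .query op' q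
  store : ∃ w, ρ.cl c (s + 1) = .store res w ∧ w.req = .tsVal T v
  quorum : ∃ (R : Finset (Fin n)) (r : Fin n → ℕ), k + 1 ≤ R.card ∧ ∀ l ∈ R, o < r l ∧ r l < s ∧
    ρ.stale l (r l + 1) = false ∧ (ρ.reg l (r l + 1)).ts ≤ T ∧
    ((∃ v', op = .write v') → (ρ.reg l (r l + 1)).ts < T)
  write : ∀ v', op = .write v' → v = v' ∧ (ofLex T).2 = n + 1 + c ∧ res = .ack ∧ (toLex (0, 0) : TS) < T
  read : op = .read → res = .val v ∧
    ∃ l r, r < s ∧ (ρ.reg l (r + 1)).ts = T ∧ (ρ.reg l (r + 1)).val = v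

/-- What is known about the state of client `c` at time `t`. -/
def ClientOK (c t : ℕ) : DClient n V → Prop
  | .idle => True
  | .query op q => ∃ o < t, ρ.Invokes o c op ∧ q.id = ρ.uid o ∧ q.req = op.req n ∧
      ∀ u, o < u → u ≤ t → ∃ op' q, ρ.cl c u = .query op' q
  | .store res w => ∃ o op T v s, s < t ∧ ρ.Stores o c op T v res s ∧ w.req = .tsVal T v ∧
      ∀ u, s < u → u ≤ t → ∃ res' w, ρ.cl c u = .store res' w

variable {ρ}

lemma toLex_lt_of_fst {a b : ℕ} {T : TS} (h : (ofLex T).1 < a) : T < toLex (a, b) := by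
  rw [Prod.Lex.lt_iff]
  exact .inl h

lemma stores_of_record {c t o : ℕ} {op : RegOp V} {q : ReadCall n V} {j : Fin n}
    {y : ReadReply n V} (hcl : ρ.cl c t = .query op q) (ho : o < t) (hi : ρ.Invokes o c op)
    (hid : q.id = ρ.uid o) (hreq : q.req = op.req n)
    (hu : ∀ u, o < u → u ≤ t → ∃ op' q, ρ.cl c u = .query op' q)
    (hd : ρ.Delivers t (.replica j) (.client c) (.readAck q.id y))
    (hc : (q.record j y).complete k = true)
    (hs : ρ.cl c (t + 1) = (dClientStore v₀ c (ρ.uid t) op (q.record j y).acks).state) :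
    ∃ T v res w, ρ.Stores o c op T v res t ∧ ρ.cl c (t + 1) = .store res w ∧ w.req = .tsVal T v := by
  obtain ⟨s', hok⟩ := exists_readOK (ρ := ρ) (.client c) t q (by simp only [ph, hcl]; rfl)
  have : s' = o := ρ.uid_injective (by rw [← hok.id, hid])
  subst this
  obtain ⟨R, r, z, hR⟩ := exists_readQuorum hok hd hc
  have hserved := hR.served
  rw [show (q.record j y).req = op.req n from hreq] at hserved
  rcases op with _ | v
  · have hz : ∀ l ∈ R, z l = .tsVal (ρ.reg l (r l + 1)).ts (ρ.reg l (r l + 1)).val :=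
      fun l hl => (hserved l hl).reply
    unfold dClientStore at hs
    dsimp only at hs
    set L := (entries (q.record j y).acks).filterMap ReadReply.tsVal? with hL
    have hmem : ∀ p, p ∈ L ↔ ∃ l ∈ R, p = ((ρ.reg l (r l + 1)).ts, (ρ.reg l (r l + 1)).val) := by
      intro p
      rw [hL, List.mem_filterMap]
      constructor
      · rintro ⟨b, hb, hbp⟩
        obtain ⟨l, hl, rfl⟩ := (hR.entries b).1 hb
        rw [hz l hl] at hbp
        cases hbp
        exact ⟨l, hl, rfl⟩
      · rintro ⟨l, hl, rfl⟩
        exact ⟨z l, (hR.entries _).2 ⟨l, hl, rfl⟩, by rw [hz l hl]; rfl⟩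
    rcases hp : L.argmax Prod.fst with _ | p
    -- The default pair in `dClientStore` is never used, since a read quorum is not empty.
    · exfalso
      rw [List.argmax_eq_none] at hp
      obtain ⟨l, hl⟩ : R.Nonempty := Finset.card_pos.1 (by have := hR.card; omega)
      have := (hmem _).2 ⟨l, hl, rfl⟩
      rw [hp] at this
      cases this
    · rw [hp, Option.getD_some] at hs
      obtain ⟨l, hl, hpl⟩ := (hmem p).1 (List.argmax_mem hp)
      refine ⟨p.1, p.2, .val p.2, _, ⟨hi, ho, hu, ⟨_, hs, rfl⟩, ⟨R, r, hR.card, fun l hl =>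
        ⟨hR.lt l hl, hR.lt' l hl, (hserved l hl).stale', ?_, ?_⟩⟩, ?_, ?_⟩, hs, rfl⟩
      · exact List.le_of_mem_argmax ((hmem _).2 ⟨l, hl, rfl⟩) hp
      · rintro ⟨v', h⟩; cases h
      · rintro v' h; cases h
      · exact fun _ => ⟨rfl, l, r l, hR.lt' l hl, by rw [hpl], by rw [hpl]⟩
  · have hz : ∀ l ∈ R, z l = .ts (ρ.reg l (r l + 1)).ts :=
      fun l hl => (hserved l hl).reply
    unfold dClientStore at hs
    dsimp only at hs
    have hlt : ∀ l ∈ R, (ρ.reg l (r l + 1)).ts < toLex (maxOf (fun t : TS => (ofLex t).1)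
        ((entries (q.record j y).acks).filterMap ReadReply.ts?) + 1, n + 1 + c) := by
      intro l hl
      refine toLex_lt_of_fst (Nat.lt_succ_of_le (le_maxOf (g := fun t : TS => (ofLex t).1) ?_))
      exact List.mem_filterMap.2 ⟨z l, (hR.entries _).2 ⟨l, hl, rfl⟩, by rw [hz l hl]; rfl⟩
    refine ⟨_, v, .ack, _, ⟨hi, ho, hu, ⟨_, hs, rfl⟩, ⟨R, r, hR.card, fun l hl =>
        ⟨hR.lt l hl, hR.lt' l hl, (hserved l hl).stale', (hlt l hl).le, fun _ => hlt l hl⟩⟩,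
        ?_, ?_⟩, hs, rfl⟩
    · rintro v' h
      cases h
      -- The counter of a write is a successor, so no write has the timestamp of the initial value.
      exact ⟨rfl, rfl, rfl, toLex_lt_of_fst (Nat.succ_pos _)⟩
    · intro h; cases h

lemma clientOK (c t : ℕ) : ρ.ClientOK c t (ρ.cl c t) := by
  induction t with
  | zero => rw [cl_zero]; trivial
  | succ t ih =>
    rcases ρ.cl_cases c t with ⟨op, hi⟩ | ⟨h, -⟩ | ⟨j, m, o, hd, hc, -⟩
    · have h := ρ.cl_invoke hi
      rw [h]
      refine ⟨t, t.lt_succ_self, hi, rfl, ?_, ?_⟩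
      · cases op <;> rfl
      · intro u h1 h2
        have : u = t + 1 := by omega
        subst this
        exact ⟨_, _, h⟩
    · rcases hcl : ρ.cl c t with _ | ⟨op, q⟩ | ⟨res, w⟩ <;> rw [hcl] at h ih <;> rw [h]
      · trivial
      · obtain ⟨o, h1, h2, h3, h4, h5⟩ := ih
        refine ⟨o, h1.trans t.lt_succ_self, h2, h3, h4, fun u h6 h7 => ?_⟩
        rcases Nat.le_succ_iff.1 h7 with h7 | rfl
        · exact h5 u h6 h7
        · exact ⟨_, _, h⟩
      · obtain ⟨o, op, T, v, s, h1, h2, h3, h4⟩ := ih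
        refine ⟨o, op, T, v, s, h1.trans t.lt_succ_self, h2, h3, fun u h6 h7 => ?_⟩
        rcases Nat.le_succ_iff.1 h7 with h7 | rfl
        · exact h4 u h6 h7
        · exact ⟨_, _, h⟩
    · generalize hs : ρ.cl c t = s at hc ih
      generalize hs' : ρ.cl c (t + 1) = s' at hc
      rcases hc with _ | ⟨op, q, y⟩ | ⟨op, q, y, hc⟩ | ⟨_, res, w, w', h⟩ | ⟨_, res, w, h⟩
      · rcases s with _ | ⟨op, q⟩ | ⟨res, w⟩
        · trivial
        · obtain ⟨o, h1, h2, h3, h4, h5⟩ := ih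
          refine ⟨o, h1.trans t.lt_succ_self, h2, h3, h4, fun u h6 h7 => ?_⟩
          rcases Nat.le_succ_iff.1 h7 with h7 | rfl
          · exact h5 u h6 h7
          · exact ⟨_, _, hs'⟩
        · obtain ⟨o, op, T, v, s, h1, h2, h3, h4⟩ := ih
          refine ⟨o, op, T, v, s, h1.trans t.lt_succ_self, h2, h3, fun u h6 h7 => ?_⟩
          rcases Nat.le_succ_iff.1 h7 with h7 | rfl
          · exact h4 u h6 h7
          · exact ⟨_, _, hs'⟩
      · obtain ⟨o, h1, h2, h3, h4, h5⟩ := ih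
        refine ⟨o, h1.trans t.lt_succ_self, h2, h3, h4, fun u h6 h7 => ?_⟩
        rcases Nat.le_succ_iff.1 h7 with h7 | rfl
        · exact h5 u h6 h7
        · exact ⟨_, _, hs'⟩
      · obtain ⟨o, h1, h2, h3, h4, h5⟩ := ih
        obtain ⟨T, v, res, w, h6, h7, h8⟩ := stores_of_record hs h1 h2 h3 h4 h5 hd hc hs'
        rw [hs'] at h7
        rw [h7]
        refine ⟨o, op, T, v, t, t.lt_succ_self, h6, h8, fun u h9 h10 => ?_⟩
        have : u = t + 1 := by omega
        subst this
        exact ⟨_, _, hs'.trans h7⟩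
      · obtain ⟨o, op, T, v, s, h1, h2, h3, h4⟩ := ih
        refine ⟨o, op, T, v, s, h1.trans t.lt_succ_self, h2, h.req.1.trans h3, fun u h6 h7 => ?_⟩
        rcases Nat.le_succ_iff.1 h7 with h7 | rfl
        · exact h4 u h6 h7
        · exact ⟨_, _, hs'⟩
      · trivial

lemma Invokes.unique {o c c' : ℕ} {op op' : RegOp V} (h : ρ.Invokes o c op)
    (h' : ρ.Invokes o c' op') : c = c' ∧ op = op' := by
  unfold Invokes at h h'
  rw [h] at h'
  cases h'
  exact ⟨rfl, rfl⟩

/-- The second phase starts in the step in which the client first leaves the query state after `o`,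
so all data are determined by `o`. -/
lemma Stores.unique {o c c' : ℕ} {op op' : RegOp V} {T T' : TS} {v v' : V} {res res' : RegResp V}
    {s s' : ℕ} (h : ρ.Stores o c op T v res s) (h' : ρ.Stores o c' op' T' v' res' s') :
    c = c' ∧ op = op' ∧ T = T' ∧ v = v' ∧ res = res' ∧ s = s' := by
  obtain ⟨rfl, rfl⟩ := h.invokes.unique h'.invokes
  obtain ⟨w, hw, hreq⟩ := h.store
  obtain ⟨w', hw', hreq'⟩ := h'.store
  have hs : s = s' := by
    rcases lt_trichotomy s s' with hlt | rfl | hlt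
    · obtain ⟨_, _, h3⟩ := h'.query (s + 1) (by have := h.lt; omega) hlt
      rw [hw] at h3; cases h3
    · rfl
    · obtain ⟨_, _, h3⟩ := h.query (s' + 1) (by have := h'.lt; omega) hlt
      rw [hw'] at h3; cases h3
  subst hs
  rw [hw] at hw'
  cases hw'
  rw [hreq] at hreq'
  cases hreq'
  exact ⟨rfl, rfl, rfl, rfl, rfl, rfl⟩

/-- A returned operation has stored its pair at a write quorum. -/
lemma Returns.stores {o s : ℕ} {r : RegResp V} (h : ρ.Returns o s r) :
    ∃ c op T v s₁, ρ.Stores o c op T v r s₁ ∧ s₁ < s ∧ ∃ Q σ, ρ.QuorumWrite (.tsVal T v) s Q σ := by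
  obtain ⟨c, op, hi, hos, hr, hno⟩ := h
  obtain ⟨-, w, j, m, hw, hd, hf⟩ := ρ.resp_spec hr
  have hok := clientOK (ρ := ρ) c s
  rw [hw] at hok
  obtain ⟨o', op', T, v, s₁, h1, h2, h3, h4⟩ := hok
  have hQ := exists_quorumWrite (ρ := ρ) (p := .client c) (w := w) (by simp only [ph, hw]; rfl) hd hf
  rw [h3] at hQ
  -- The invocation remembered in the invariant is the one that returns here: otherwise the client
  -- would be idle, at the later of the two invocations, while the other operation is still pending.
  have hoo : o = o' := by
    rcases lt_trichotomy o o' with hlt | rfl | hlt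
    · exfalso
      have : ∀ u, o + 1 ≤ u → u ≤ o' → ρ.cl c u ≠ .idle := by
        intro u hu
        induction u, hu using Nat.le_induction with
        | base => intro _; rw [ρ.cl_invoke hi]; simp [dClientInvoke]
        | succ u hu ih =>
          intro hu'
          exact ρ.not_idle_succ (ih (by omega)) (hno u (by omega) (by have := h2.lt; omega))
      exact this o' hlt le_rfl (ρ.idle_of_invokes h2.invokes)
    · rfl
    · exfalso
      have hidle := ρ.idle_of_invokes hi
      by_cases hle : o ≤ s₁
      · obtain ⟨_, _, h5⟩ := h2.query o hlt hle
        rw [hidle] at h5; cases h5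
      · obtain ⟨_, _, h5⟩ := h4 o (by omega) hos
        rw [hidle] at h5; cases h5
  subst hoo
  exact ⟨c, op', T, v, s₁, h2, h1, hQ⟩

/-- A client invokes an operation only after its previous operation has returned. -/
lemma exists_returns {o o' c : ℕ} {op op' : RegOp V} (h : ρ.Invokes o c op)
    (h' : ρ.Invokes o' c op') (hlt : o < o') : ∃ s r, ρ.Returns o s r ∧ s < o' := by
  classical
  have hex : ∃ s, o ≤ s ∧ s < o' ∧ ∃ r, ρ.resp s = some (c, r) := by
    by_contra hno
    push Not at hno
    have : ∀ u, o + 1 ≤ u → u ≤ o' → ρ.cl c u ≠ .idle := by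
      intro u hu
      induction u, hu using Nat.le_induction with
      | base => intro _; rw [ρ.cl_invoke h]; simp [dClientInvoke]
      | succ u hu ih =>
        intro hu'
        exact ρ.not_idle_succ (ih (by omega)) (hno u (by omega) (by omega))
    exact this o' hlt le_rfl (ρ.idle_of_invokes h')
  obtain ⟨h1, h2, r, h3⟩ := Nat.find_spec hex
  refine ⟨Nat.find hex, r, ⟨c, op, h, h1, h3, fun u h4 h5 r' h6 => ?_⟩, h2⟩
  exact Nat.find_min hex h5 ⟨h4, h5.trans h2, r', h6⟩

/-- The origin of the pairs stored at the replicas. -/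
lemma tsVal_origin (l : Fin n) (t : ℕ) :
    ((ρ.reg l t).ts = toLex (0, 0) ∧ (ρ.reg l t).val = v₀) ∨
      ∃ o c v s, s < t ∧ ρ.Stores o c (.write v) (ρ.reg l t).ts (ρ.reg l t).val .ack s := by
  induction t using Nat.strong_induction_on generalizing l with
  | _ t ih =>
  rcases t with _ | t
  · left
    simp [reg, rep_zero, RegState.initial]
  have old : ∀ l', ∀ t' ≤ t, ∀ T v, T = (ρ.reg l' t').ts → v = (ρ.reg l' t').val →
      ((T = toLex (0, 0) ∧ v = v₀) ∨ ∃ o c v' s, s < t + 1 ∧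
        ρ.Stores o c (.write v') T v .ack s) := by
    rintro l' t' ht' T v rfl rfl
    exact (ih t' (by omega) l').imp_right fun ⟨o, c, v, s, h1, h2⟩ => ⟨o, c, v, s, by omega, h2⟩
  rcases ρ.rep_cases l t with h | h | ⟨src, msg, hd, h⟩
  · left
    simp [reg, ρ.rep_restart h, RegState.initial]
  · simp only [reg, h]
    exact old l t le_rfl _ _ rfl rfl
  · have hph : ρ.ph (.replica l) t = (ρ.recov l t).phase := rfl
    have e1 : ρ.recov l t = (ρ.rep l t).recovery := rfl
    have e3 : ρ.reg l t = (ρ.rep l t).reg := rfl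
    have e4 : ρ.reg l (t + 1) = (ρ.rep l (t + 1)).reg := rfl
    have hold := old l t le_rfl
    rw [e3] at hold
    rw [e4]
    generalize ρ.rep l t = s at h e1 e3 hold
    generalize ρ.rep l (t + 1) = s' at h e4
    rcases h with _ | _ | ⟨_, id, inc, T, v, hs⟩ | _ | _ | _ | _ | _ | _ | _ | _ | _ |
      ⟨_, q, j, y, rfl, hs, hc⟩
    · exact hold _ _ rfl rfl
    · exact hold _ _ rfl rfl
    · rcases RegState.raiseTS_tsVal s.reg T v with ⟨h1, h2⟩ | ⟨h1, h2⟩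
      · exact hold _ _ h1 h2
      · simp only [h1, h2]
        obtain ⟨r, hr, hs⟩ := ρ.exists_sends_of_delivers hd
        obtain ⟨w, -, hw, -, hreq, -⟩ := ρ.write_of_sends hs
        rcases write_cases hw with ⟨c, res, T', v', rfl, hcl, h⟩ | ⟨i, -, -, m', -, -, h, -⟩ |
          ⟨_, _, -, -, h⟩
        · rw [hreq] at h
          cases h
          have hok := clientOK (ρ := ρ) c (r + 1)
          rw [hcl] at hok
          obtain ⟨o, op, T', v', s₁, h3, h4, h5, -⟩ := hok
          rw [hreq] at h5
          cases h5
          -- The pair written back by a read was found at a replica earlier, so that the induction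
          -- hypothesis applies; a write brings its own pair.
          rcases op with _ | v'
          · obtain ⟨-, l', r', h5, h6, h7⟩ := h4.read rfl
            exact old l' (r' + 1) (by omega) _ _ h6.symm h7.symm
          · obtain ⟨rfl, -, rfl, -⟩ := h4.write _ rfl
            exact .inr ⟨o, c, v, s₁, by omega, h4⟩
        · rw [hreq] at h; cases h
        · rw [hreq] at h; cases h
    · exact hold _ _ rfl rfl
    · exact hold _ _ rfl rfl
    · exact hold _ _ rfl rfl
    · exact hold _ _ rfl rfl
    · exact hold _ _ rfl rfl
    · exact hold _ _ rfl rfl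
    · exact hold _ _ rfl rfl
    · exact hold _ _ rfl rfl
    · exact hold _ _ rfl rfl
    · rw [hs] at e1
      rw [e1] at hph
      have hok := recoveryOK (ρ := ρ) l t
      rw [e1] at hok
      obtain ⟨-, -, -, -, inc, -, -, hreq, -⟩ := hok
      obtain ⟨s₁, hok⟩ := exists_readOK (.replica l) t q (by rw [hph]; rfl)
      obtain ⟨R, r, z, hR⟩ := exists_readQuorum hok hd hc
      rcases RegState.absorb_tsVal s.reg ((entries (q.record j y).acks).filterMap ReadReply.state?)
        with ⟨h1, h2⟩ | ⟨a, ha, h1, h2⟩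
      · exact hold _ _ h1 h2
      · obtain ⟨b, hb, hba⟩ := List.mem_filterMap.1 ha
        obtain ⟨x, hx, rfl⟩ := (hR.entries b).1 hb
        have hz := (hR.served x hx).reply
        rw [show (q.record j y).req = .state inc from hreq] at hz
        rw [hz] at hba
        cases hba
        exact old x _ (hR.lt' x hx) _ _ h1 h2

/-- Operations that start their query after another operation has returned store a timestamp that
is not smaller, and larger in the case of writes. -/
lemma Stores.le_of_returns {o c : ℕ} {op : RegOp V} {T : TS} {v : V} {res : RegResp V} {s₁ : ℕ}
    {s : ℕ} {Q : Finset (Fin n)} {σ : Fin n → ℕ} (hQ : ρ.QuorumWrite (.tsVal T v) s Q σ)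
    {T' : TS} {v' : V} (h' : ρ.Stores o c op T' v' res s₁) (hs : s < o) :
    T ≤ T' ∧ ((∃ v'', op = .write v'') → T < T') := by
  obtain ⟨R, r, hR, hr⟩ := h'.quorum
  obtain ⟨l, hl, h : T ≤ _⟩ := hQ.exists_holds hR
    (fun l hl => ⟨by have := (hr l hl).1; omega, (hr l hl).2.2.1⟩)
  exact ⟨h.trans (hr l hl).2.2.2.1, fun hw => h.trans_lt ((hr l hl).2.2.2.2 hw)⟩

/-- Different writes have different timestamps. -/
lemma Stores.write_unique {o o' c c' : ℕ} {w w' v v' : V} {T : TS} {res res' : RegResp V}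
    {s s' : ℕ} (h : ρ.Stores o c (.write w) T v res s)
    (h' : ρ.Stores o' c' (.write w') T v' res' s') : o = o' := by
  obtain ⟨-, hT, -⟩ := h.write _ rfl
  obtain ⟨-, hT', -⟩ := h'.write _ rfl
  -- The second component of the timestamp, `n + 1 + c`, identifies the client.
  have : c = c' := by omega
  subst this
  -- Writes of one client are sequential: the earlier one has returned before the later one is
  -- invoked, which therefore stores a larger timestamp.
  have key : ∀ {o o' : ℕ} {w w' v v' : V} {T : TS} {res res' : RegResp V} {s s' : ℕ},
      ρ.Stores o c (.write w) T v res s → ρ.Stores o' c (.write w') T v' res' s' →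
      ¬ o < o' := by
    intro o o' w w' v v' T res res' s s' h h' hlt
    obtain ⟨s₂, r, hr, hs⟩ := exists_returns h.invokes h'.invokes hlt
    obtain ⟨c₂, op₂, T₂, v₂, s₃, h2, -, Q, σ, hQ⟩ := hr.stores
    obtain ⟨-, -, rfl, rfl, -⟩ := h2.unique h
    exact lt_irrefl _ ((h'.le_of_returns hQ hs).2 ⟨_, rfl⟩)
  exact le_antisymm (not_lt.1 (key h' h)) (not_lt.1 (key h h'))

end Run

end CRR


namespace CRR

universe u

variable {n k : ℕ} {V : Type u} {v₀ : V}

namespace Run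

variable (ρ : Run (algorithmD n k v₀))

/-! ## Linearizability -/

open Classical in
/-- The timestamp stored by an operation. -/
noncomputable def opTS (o : ℕ) : TS :=
  if h : ∃ T c op v res s, ρ.Stores o c op T v res s then h.choose else toLex (0, 0)

open Classical in
/-- Operations are ordered by their timestamps, the write before the reads, the reads by the times
of their invocations. -/
noncomputable def opKey (o : ℕ) : TS ×ₗ (ℕ ×ₗ ℕ) :=
  toLex (ρ.opTS o, toLex (if ρ.IsRead o then 1 else 0, o))

/-- The operations that take effect: those that return, and the writes whose values are returned. -/
def effective : Set ℕ :=
  {o | (∃ s r, ρ.Returns o s r) ∨ ((∃ c v T w s, ρ.Stores o c (.write v) T w .ack s) ∧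
    ∃ o' s r, ρ.Returns o' s r ∧ ρ.opTS o' = ρ.opTS o)}

/-- The rank in the order of the keys. It is meaningful for effective operations, where the set of
predecessors is finite by `finite_lt_opKey`. -/
noncomputable def opPos (o : ℕ) : ℕ := {o' | o' ∈ ρ.effective ∧ ρ.opKey o' < ρ.opKey o}.ncard

variable {ρ}

lemma Stores.opTS {o c : ℕ} {op : RegOp V} {T : TS} {v : V} {res : RegResp V} {s : ℕ}
    (h : ρ.Stores o c op T v res s) : ρ.opTS o = T := by
  have hex : ∃ T c op v res s, ρ.Stores o c op T v res s := ⟨T, c, op, v, res, s, h⟩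
  unfold Run.opTS
  rw [dif_pos hex]
  obtain ⟨c', op', v', res', s', h'⟩ := hex.choose_spec
  exact (h'.unique h).2.2.1

lemma Stores.isRead_iff {o c : ℕ} {op : RegOp V} {T : TS} {v : V} {res : RegResp V} {s : ℕ}
    (h : ρ.Stores o c op T v res s) : ρ.IsRead o ↔ op = .read := by
  constructor
  · rintro ⟨c', h'⟩
    exact (h.invokes.unique h').2
  · rintro rfl
    exact ⟨c, h.invokes⟩

lemma exists_stores_of_effective {o : ℕ} (h : o ∈ ρ.effective) :
    (∃ c op v res s, ρ.Stores o c op (ρ.opTS o) v res s) ∧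
      ∃ o' s r, ρ.Returns o' s r ∧ ρ.opTS o' = ρ.opTS o := by
  rcases h with ⟨s, r, h⟩ | ⟨⟨c, v, T, w, s, h⟩, h'⟩
  · obtain ⟨c, op, T, v, s₁, h', -⟩ := h.stores
    refine ⟨⟨c, op, v, r, s₁, ?_⟩, o, s, r, h, rfl⟩
    rw [h'.opTS]
    exact h'
  · refine ⟨⟨c, .write v, w, .ack, s, ?_⟩, h'⟩
    rw [h.opTS]
    exact h

/-- The timestamps of operations that do not overlap. -/
lemma opTS_le_of_returns {o o' s : ℕ} {r : RegResp V} (h : ρ.Returns o s r)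
    (h' : o' ∈ ρ.effective) (hs : s < o') :
    ρ.opTS o ≤ ρ.opTS o' ∧ (¬ ρ.IsRead o' → ρ.opTS o < ρ.opTS o') := by
  obtain ⟨c, op, T, v, s₁, h1, -, Q, σ, hQ⟩ := h.stores
  obtain ⟨⟨c', op', v', res', s', h2⟩, -⟩ := exists_stores_of_effective h'
  rw [h1.opTS]
  refine ⟨(h2.le_of_returns hQ hs).1, fun hr => (h2.le_of_returns hQ hs).2 ?_⟩
  rw [h2.isRead_iff] at hr
  rcases op' with _ | v''
  · exact absurd rfl hr
  · exact ⟨v'', rfl⟩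

lemma opKey_injective : Function.Injective ρ.opKey := by
  intro o o' h
  have := congrArg (fun x => (ofLex (ofLex x).2).2) h
  exact this

lemma opKey_lt_iff {o o' : ℕ} : ρ.opKey o < ρ.opKey o' ↔ ρ.opTS o < ρ.opTS o' ∨
    ρ.opTS o = ρ.opTS o' ∧ (¬ ρ.IsRead o ∧ ρ.IsRead o' ∨
      (ρ.IsRead o ↔ ρ.IsRead o') ∧ o < o') := by
  unfold opKey
  rw [Prod.Lex.lt_iff]
  simp only [ofLex_toLex, Prod.Lex.lt_iff]
  by_cases h1 : ρ.IsRead o <;> by_cases h2 : ρ.IsRead o' <;> simp [h1, h2]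

/-- Some operation with the timestamp of `o` returns, say at time `s`. An effective operation
invoked after both `s` and `o` has at least this timestamp, a larger one if it is a write, and among
reads of equal timestamp it comes later. So all predecessors are invoked up to `max s o`. -/
lemma finite_lt_opKey {o : ℕ} (h : o ∈ ρ.effective) :
    {o' | o' ∈ ρ.effective ∧ ρ.opKey o' < ρ.opKey o}.Finite := by
  obtain ⟨-, o₁, s, r, hr, hT⟩ := exists_stores_of_effective h
  refine (Set.finite_Iic (max s o)).subset ?_
  rintro o' ⟨h', hlt⟩
  by_contra hle
  have hle : max s o < o' := not_le.1 hle
  have := opTS_le_of_returns hr h' ((le_max_left _ _).trans_lt hle)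
  have ho := (le_max_right _ _).trans_lt hle
  rw [hT] at this
  rw [opKey_lt_iff] at hlt
  rcases hlt with hlt | ⟨heq, ⟨hnr, -⟩ | ⟨-, hlt⟩⟩
  · exact absurd this.1 (not_le.2 hlt)
  · exact absurd heq (this.2 hnr).ne'
  · omega

lemma opPos_lt {o o' : ℕ} (h : o ∈ ρ.effective) (h' : o' ∈ ρ.effective)
    (hlt : ρ.opKey o < ρ.opKey o') : ρ.opPos o < ρ.opPos o' := by
  refine Set.ncard_lt_ncard ⟨fun x hx => ⟨hx.1, hx.2.trans hlt⟩, fun hsub => ?_⟩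
    (finite_lt_opKey h')
  exact lt_irrefl _ (hsub (show o ∈ _ from ⟨h, hlt⟩)).2

lemma opPos_lt_iff {o o' : ℕ} (h : o ∈ ρ.effective) (h' : o' ∈ ρ.effective) :
    ρ.opPos o < ρ.opPos o' ↔ ρ.opKey o < ρ.opKey o' := by
  refine ⟨fun hlt => ?_, opPos_lt h h'⟩
  by_contra hle
  rcases (not_lt.1 hle).eq_or_lt with heq | hlt'
  · rw [opKey_injective heq] at hlt
    exact lt_irrefl _ hlt
  · exact lt_asymm hlt (opPos_lt h' h hlt')

theorem linearizable (ρ : Run (algorithmD n k v₀)) : ρ.Linearizable v₀ := by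
  refine ⟨ρ.effective, ρ.opPos, ?_, fun o s r h => .inl ⟨s, r, h⟩, ?_, ?_, ?_, ?_⟩
  · intro o ho
    obtain ⟨⟨c, op, v, res, s, h⟩, -⟩ := exists_stores_of_effective ho
    exact ⟨c, op, h.invokes⟩
  · intro o ho o' ho' heq
    rcases lt_trichotomy (ρ.opKey o) (ρ.opKey o') with hlt | heq' | hlt
    · exact absurd heq (opPos_lt ho ho' hlt).ne
    · exact opKey_injective heq'
    · exact absurd heq (opPos_lt ho' ho hlt).ne'
  · intro o ho o' ho' s r hr hs
    refine opPos_lt ho ho' (opKey_lt_iff.2 ?_)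
    have := opTS_le_of_returns hr ho' hs
    have hos : o ≤ s := by obtain ⟨c, op, -, h, -⟩ := hr; exact h
    -- With equal timestamps the later operation must be a read, and the key puts a write, or a read
    -- invoked earlier, before it.
    rcases this.1.lt_or_eq with hlt | heq
    · exact .inl hlt
    · refine .inr ⟨heq, ?_⟩
      have h' : ρ.IsRead o' := by
        by_contra hnr
        exact absurd heq (this.2 hnr).ne
      by_cases h : ρ.IsRead o
      · exact .inr ⟨by simp [h, h'], by omega⟩
      · exact .inl ⟨h, h'⟩
  · rintro o ho v s r ⟨c, hw⟩ hr
    obtain ⟨c', op, T, v', s₁, h, -⟩ := hr.stores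
    obtain ⟨rfl, rfl⟩ := hw.unique h.invokes
    exact (h.write _ rfl).2.2.1
  · rintro o ho s r hread hr
    have hread' := hread
    obtain ⟨c, hrd⟩ := hread
    obtain ⟨c', op, T, v, s₁, h, -⟩ := hr.stores
    obtain ⟨rfl, rfl⟩ := hrd.unique h.invokes
    obtain ⟨rfl, l, r', hr', hts, hval⟩ := h.read rfl
    have hT := h.opTS
    -- The pair returned by the read is the initial one or was stored by a write.
    rcases tsVal_origin (ρ := ρ) l (r' + 1) with ⟨h1, h2⟩ | ⟨w, cw, vw, sw, -, hw⟩
    · right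
      rw [hts] at h1
      rw [hval] at h2
      subst h2
      refine ⟨rfl, ?_⟩
      rintro w hwL v' ⟨cw, hwi⟩ hlt
      rw [opPos_lt_iff hwL ho, opKey_lt_iff, hT] at hlt
      obtain ⟨⟨c₂, op₂, v₂, res₂, s₂, hw⟩, -⟩ := exists_stores_of_effective hwL
      obtain ⟨rfl, rfl⟩ := hwi.unique hw.invokes
      have := (hw.write _ rfl).2.2.2
      rw [h1] at hlt
      rcases hlt with hlt | ⟨heq, -⟩
      · exact lt_asymm hlt this
      · exact absurd heq this.ne'
    · left
      rw [hts, hval] at hw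
      obtain ⟨rfl, -⟩ := hw.write _ rfl
      have hTw := hw.opTS
      -- The write may never return. It belongs to the linearization because an operation with its
      -- timestamp does.
      have hwL : w ∈ ρ.effective := .inr ⟨⟨_, _, _, _, _, hw⟩, o, s, _, hr, by rw [hT, hTw]⟩
      have hnr : ¬ ρ.IsRead w := by rw [hw.isRead_iff]; simp
      refine ⟨w, hwL, v, ⟨cw, hw.invokes⟩, rfl, opPos_lt hwL ho (opKey_lt_iff.2 (.inr ⟨?_, .inl
        ⟨hnr, hread'⟩⟩)), ?_⟩
      · rw [hT, hTw]
      -- A write placed before the read has a timestamp that is at most `T`; with `T` itself it is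
      -- the same write.
      · rintro w' hw'L v' ⟨cw', hwi⟩ hlt
        rw [opPos_lt_iff hw'L ho, opKey_lt_iff, hT] at hlt
        obtain ⟨⟨c₂, op₂, v₂, res₂, s₂, hw'⟩, -⟩ := exists_stores_of_effective hw'L
        obtain ⟨rfl, rfl⟩ := hwi.unique hw'.invokes
        rcases hlt with hlt | ⟨heq, -⟩
        · exact (opPos_lt hw'L hwL (opKey_lt_iff.2 (.inl (by rwa [hTw])))).le
        · rw [heq] at hw'
          exact (congrArg ρ.opPos (hw'.write_unique hw)).le

end Run

end CRR


namespace CRR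

universe u

variable {n k : ℕ} {V : Type u} {v₀ : V}

/-! ## Termination of quorum accesses -/

lemma card_le_count {α : Type*} {f : Fin n → Option α} {E : Finset (Fin n)}
    (h : ∀ j ∈ E, (f j).isSome = true) : E.card ≤ count f :=
  Finset.card_le_card fun j hj => Finset.mem_filter.2 ⟨Finset.mem_univ _, h j hj⟩

lemma count_none {α : Type*} : count (fun _ : Fin n => (none : Option α)) = 0 := by
  simp [count]

lemma exists_max_ge {f : ℕ → ℕ} {T C : ℕ} (h : ∀ t ≥ T, f t ≤ C) :
    ∃ t ≥ T, ∀ t' ≥ T, f t' ≤ f t := by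
  have hne : (f '' Set.Ici T).Nonempty := ⟨f T, T, Set.mem_Ici.2 le_rfl, rfl⟩
  have hb : BddAbove (f '' Set.Ici T) := ⟨C, by rintro _ ⟨t, ht, rfl⟩; exact h t ht⟩
  obtain ⟨t, ht, he⟩ := Nat.sSup_mem hne hb
  exact ⟨t, ht, fun t' ht' => he ▸ le_csSup hb ⟨t', ht', rfl⟩⟩

lemma Phase.Step.read_mono {x : ℕ} {j : Fin n} {m : DMsg n V} {f f' : Phase n V}
    {q q' : ReadCall n V} (h : Phase.Step k x j m f f') (hq : f.read = some q)
    (hq' : f'.read = some q') :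
    q'.req = q.req ∧ (∀ i, (q.acks i).isSome = true → (q'.acks i).isSome = true) ∧
      ∀ y, m = .readAck q.id y → (q'.acks j).isSome = true := by
  have hrec : ∀ (q : ReadCall n V) (y : ReadReply n V), (q.record j y).req = q.req ∧
      (∀ i, (q.acks i).isSome = true → ((q.record j y).acks i).isSome = true) ∧
      ((q.record j y).acks j).isSome = true := by
    intro q y
    refine ⟨rfl, fun i hi => ?_, by simp [ReadCall.record]⟩
    by_cases hij : i = j
    · subst hij; simp [ReadCall.record]
    · simpa [ReadCall.record, Function.update_of_ne hij] using hi
  rcases h with _ | ⟨q₀, h⟩ | ⟨q₀, y, hm, hc⟩ | ⟨w, w', h⟩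
  · cases hq
  · cases hq; cases hq'
    exact ⟨rfl, fun _ => id, fun y hy => absurd hy (h y)⟩
  · cases hq; cases hq'
    exact ⟨(hrec q y).1, (hrec q y).2.1, fun _ _ => (hrec q y).2.2⟩
  · rcases h with ⟨_, _, h1, h2⟩ | ⟨_, a, h⟩ | ⟨_, a, h, _, _⟩ | ⟨_, q₀, y, h, hc⟩ |
      ⟨_, _, w'', S, hv, hd⟩
    · have hq : w.inner = some q := hq
      have hq' : w.inner = some q' := hq'
      rw [hq] at hq'; cases hq'
      exact ⟨rfl, fun _ => id, fun y hy => absurd hy (h2 q y hq)⟩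
    · have hq : w.inner = some q := hq
      have hq' : w.inner = some q' := hq'
      rw [hq] at hq'; cases hq'
      exact ⟨rfl, fun _ => id, by simp⟩
    · have hq : w.inner = some q := hq
      rw [h] at hq; cases hq
    · have hq : w.inner = some q := hq
      rw [h] at hq; cases hq
      cases hq'
      exact ⟨(hrec q y).1, (hrec q y).2.1, fun _ _ => (hrec q y).2.2⟩
    · rw [WriteCall.validate_call] at hq'
      cases hq'

lemma Phase.mem_sends_of_read {f : Phase n V} {q : ReadCall n V} (h : f.read = some q)
    (l : Fin n) : (.replica l, .read q.id q.req) ∈ f.sends := by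
  have : (Proc.replica l, DMsg.read q.id q.req) ∈ q.sends := mem_readCall_sends.2 ⟨l, rfl, rfl⟩
  rcases f with _ | q' | w
  · cases h
  · cases h; exact this
  · have h : w.inner = some q := h
    simpa only [Phase.sends, WriteCall.resend, h] using this

lemma WriteCall.mem_resend {w : WriteCall n V} (h : w.inner = none) {z : Fin n}
    (hz : w.Q z = none) : (.replica z, .write w.id w.req (w.cv z)) ∈ w.resend := by
  rw [WriteCall.resend, h]
  exact mem_writeCall_sends.2 ⟨z, hz, rfl, rfl⟩

namespace Run

variable {ρ : Run (algorithmD n k v₀)}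

/-- The step that brings the last missing reply ends the call, so a call in progress never has a
full quorum. -/
lemma read_incomplete (p : Proc n) (t : ℕ) (q : ReadCall n V) (hq : (ρ.ph p t).read = some q) :
    ¬ q.complete k = true := by
  have start : ∀ x req, ¬ (ReadCall.start x req : ReadCall n V).complete k = true := by
    intro x req
    simp [ReadCall.complete, ReadCall.start, count_none]
  induction t generalizing q with
  | zero => rw [ρ.ph_zero] at hq; cases hq
  | succ t ih =>
    rcases ρ.ph_cases t p with h | h | ⟨j, m, hd, h | ⟨-, h⟩⟩
    · rw [h] at hq
      exact ih q hq
    · obtain ⟨req, h⟩ := ρ.ph_begins h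
      rw [h] at hq; cases hq
      exact start _ _
    · rcases h.read hq with h | ⟨q', y, -, -, rfl, hc⟩ | rfl
      · exact ih q h
      · exact hc
      · exact start _ _
    · obtain ⟨req, rfl⟩ := h.read hq
      exact start _ _

/-- A validation that leaves `n - k` acknowledgements ends the call. The hypothesis `k < n` serves
the fresh call, whose `Q` is empty. -/
lemma count_Q_lt (hk : k < n) (p : Proc n) (t : ℕ) (w : WriteCall n V)
    (hw : (ρ.ph p t).write = some w) (hin : w.inner = none) : count w.Q < n - k := by
  have start : ∀ x req, count (WriteCall.start x req : WriteCall n V).Q < n - k := by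
    intro x req
    simp only [WriteCall.start, count_none]
    omega
  induction t generalizing w with
  | zero => rw [ρ.ph_zero] at hw; cases hw
  | succ t ih =>
    rcases ρ.ph_cases t p with h | h | ⟨j, m, hd, h | ⟨-, h⟩⟩
    · rw [h] at hw
      exact ih w hw hin
    · obtain ⟨req, h⟩ := ρ.ph_begins h
      rw [h] at hw; cases hw
    · obtain ⟨w', hw', -, h⟩ := h.write hw
      have ih := ih w' (by rw [hw']; rfl)
      rcases h with _ | _ | _ | _ | ⟨_, _, w'', S, hv, hd⟩
      · exact ih hin
      · exact ih hin
      · cases hin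
      · cases hin
      · by_contra hlt
        rw [WriteCall.validate_done_iff.2 (not_lt.1 hlt)] at hd
        cases hd
    · obtain ⟨req, rfl⟩ := h.write hw
      exact start _ _

/-- Equal identifiers mean the same call: one started in step `t` has the identifier `ρ.uid t`,
which a call present at time `t` cannot have. -/
lemma ph_read_succ {p : Proc n} {t : ℕ} {q q' : ReadCall n V} (hq : (ρ.ph p t).read = some q)
    (hq' : (ρ.ph p (t + 1)).read = some q') (hid : q'.id = q.id) :
    q'.req = q.req ∧ (∀ i, (q.acks i).isSome = true → (q'.acks i).isSome = true) ∧
      ∀ j y, ρ.Delivers t (.replica j) p (.readAck q.id y) → (q'.acks j).isSome = true := by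
  obtain ⟨s, hok⟩ := exists_readOK p t q hq
  have hne : q.id ≠ ρ.uid t := by
    rw [hok.id]
    intro h
    have := ρ.uid_injective h
    have := hok.lt
    omega
  by_cases hb : ρ.Begins t p
  · obtain ⟨req, h⟩ := ρ.ph_begins hb
    rw [h] at hq'; cases hq'
    exact absurd hid.symm hne
  · by_cases hd : ∃ j m, ρ.Delivers t (.replica j) p m
    · obtain ⟨j, m, hd⟩ := hd
      obtain ⟨l, ⟨-, ⟨h, -⟩ | ⟨-, h, -⟩⟩, -⟩ := ρ.ph_delivers hd
      · obtain ⟨h1, h2, h3⟩ := h.read_mono hq hq'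
        refine ⟨h1, h2, fun j' y hd' => ?_⟩
        unfold Delivers at hd hd'
        rw [hd] at hd'
        cases hd'
        exact h3 y rfl
      · obtain ⟨req, rfl⟩ := h.read hq'
        exact absurd hid.symm hne
    · push Not at hd
      rw [ρ.ph_other hd hb, hq] at hq'
      cases hq'
      exact ⟨rfl, fun _ => id, fun j y h => absurd h (hd j _)⟩

variable (ρ) in
/-- Process `p` is up from time `t` on. -/
def UpFrom (p : Proc n) (t : ℕ) : Prop := ∀ t' ≥ t, ρ.Up p t'

lemma UpFrom.mono {p : Proc n} {t t' : ℕ} (h : ρ.UpFrom p t) (ht : t ≤ t') : ρ.UpFrom p t' :=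
  fun s hs => h s (ht.trans hs)

lemma UpFrom.not_restarts {i : Fin n} {t : ℕ} (h : ρ.UpFrom (.replica i) t) {s : ℕ} (hs : t ≤ s) :
    ¬ ρ.Restarts s i := fun hr => ρ.not_up_of_restarts hr (h s hs)

lemma recov_completed_succ {i : Fin n} {t : ℕ} (h : ρ.recov i t = .completed)
    (hr : ¬ ρ.Restarts t i) : ρ.recov i (t + 1) = .completed := by
  rcases ρ.rep_cases i t with h' | h' | ⟨src, m, -, h'⟩
  · exact absurd h' hr
  · simpa only [recov, h'] using h
  · simp only [recov] at h ⊢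
    generalize ρ.rep i t = s at h h'
    generalize ρ.rep i (t + 1) = s' at h'
    rcases h' with _ | _ | _ | _ | _ | _ | _ | _ | _ | _ | _ | _ | _ <;> simp_all

lemma stale_eq_false_of_le {i : Fin n} {t t' : ℕ} (h : ρ.stale i t = false) (ht : t ≤ t')
    (hr : ∀ s, t ≤ s → s < t' → ¬ ρ.Restarts s i) : ρ.stale i t' = false := by
  rw [← Bool.not_eq_true, stale_iff, not_not] at h ⊢
  induction t', ht using Nat.le_induction with
  | base => exact h
  | succ t' ht ih =>
    exact recov_completed_succ (ih fun s h1 h2 => hr s h1 (by omega)) (hr t' ht t'.lt_succ_self)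

/-! ### Round trips -/

lemma read_roundtrip (hR : ρ.ReliableChannels) {p : Proc n} {l : Fin n} {T s id : ℕ}
    {req : ReadReq n} (hp : ρ.UpFrom p T) (hl : ρ.UpFrom (.replica l) T)
    (hst : ρ.stale l T = false) (hs : T ≤ s) (h : ρ.Sends s p (.replica l) (.read id req)) :
    ∃ r > s, ∃ y, ρ.Delivers r (.replica l) p (.readAck id y) := by
  obtain ⟨r, hr, hd⟩ := hR p (.replica l) T (fun t ht => ⟨hp t ht, hl t ht⟩) s hs _ h
  have hst' := stale_eq_false_of_le hst (t' := r) (by omega) fun s h1 _ => hl.not_restarts h1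
  obtain ⟨y, -, hy⟩ := ρ.read_served hd hst'
  obtain ⟨r', hr', hd'⟩ := hR (.replica l) p T (fun t ht => ⟨hl t ht, hp t ht⟩) r (by omega) _ hy
  exact ⟨r', by omega, y, hd'⟩

lemma write_roundtrip (hR : ρ.ReliableChannels) {p : Proc n} {l : Fin n} {T s id inc : ℕ}
    {req : WriteReq n V} (hp : ρ.UpFrom p T) (hl : ρ.UpFrom (.replica l) T)
    (hst : req.IsTSVal → ρ.stale l T = false) (hs : T ≤ s)
    (h : ρ.Sends s p (.replica l) (.write id req inc)) :
    ∃ r > s, ∃ a r', T ≤ r' ∧ ρ.Delivers r (.replica l) p (.writeAck id a.inc a.cv) ∧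
      ρ.WriteServed p id req l r' a ∧ (¬ req.IsTSVal → inc ≤ a.inc) := by
  obtain ⟨r, hr, hd⟩ := hR p (.replica l) T (fun t ht => ⟨hp t ht, hl t ht⟩) s hs _ h
  have hst' : req.IsTSVal → ρ.stale l r = false := fun h =>
    stale_eq_false_of_le (hst h) (t' := r) (by omega) fun s h1 _ => hl.not_restarts h1
  obtain ⟨a, h1, h2, h3⟩ := ρ.write_served hd hst'
  obtain ⟨r', hr', hd'⟩ := hR (.replica l) p T (fun t ht => ⟨hl t ht, hp t ht⟩) r (by omega) _ h2
  exact ⟨r', by omega, a, r, by omega, hd', h1, h3⟩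

/-! ### Termination of `read_quorum` -/

/-- In an endless call, ticks retransmit the request to every replica of `S`; these stay up and not
stale, so their replies arrive and remain recorded, which makes the call complete, against
`read_incomplete`. -/
theorem read_call_ends (hF : ρ.Fair) (hR : ρ.ReliableChannels) {p : Proc n} {T : ℕ}
    {S : Finset (Fin n)} (hp : ρ.UpFrom p T) (hS : k + 1 ≤ S.card)
    (hup : ∀ l ∈ S, ρ.UpFrom (.replica l) T) (hst : ∀ l ∈ S, ρ.stale l T = false)
    {t id : ℕ} (ht : T ≤ t) : ∃ t' ≥ t, ¬ ∃ q, (ρ.ph p t').read = some q ∧ q.id = id := by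
  by_contra hno
  push Not at hno
  have : Nonempty (ReadCall n V) := ⟨ReadCall.start 0 .cv⟩
  choose! f hf hid using hno
  have hreq : ∀ t' ≥ t, (f t').req = (f t).req := by
    intro t' ht'
    induction t', ht' using Nat.le_induction with
    | base => rfl
    | succ t' ht' ih =>
      exact (ph_read_succ (hf t' ht') (hf (t' + 1) (by omega))
        (by rw [hid t' ht', hid (t' + 1) (by omega)])).1.trans ih
  have hack : ∀ l ∈ S, ∀ᶠ t' in Filter.atTop, ((f t').acks l).isSome = true := by
    intro l hl
    obtain ⟨s, hs, htick⟩ := hF p ⟨T, hp⟩ t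
    have hsend : ρ.Sends s p (.replica l) (.read (f s).id (f s).req) :=
      ρ.sends_of_tick htick (Phase.mem_sends_of_read (hf s hs) l)
    obtain ⟨r, hr, y, hd⟩ := read_roundtrip hR hp (hup l hl) (hst l hl) (ht.trans hs) hsend
    refine Filter.eventually_atTop.2 ⟨r + 1, fun t' ht' => ?_⟩
    induction t', ht' using Nat.le_induction with
    | base =>
      refine (ph_read_succ (hf r (by omega)) (hf (r + 1) (by omega))
        (by rw [hid r (by omega), hid (r + 1) (by omega)])).2.2 l y ?_
      rw [hid s (by omega)] at hd
      rw [hid r (by omega)]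
      exact hd
    | succ t' ht' ih =>
      exact (ph_read_succ (hf t' (by omega)) (hf (t' + 1) (by omega))
        (by rw [hid t' (by omega), hid (t' + 1) (by omega)])).2.1 l ih
  obtain ⟨t', h1, h2⟩ := (((Finset.eventually_all S).2 hack).and (Filter.eventually_ge_atTop t)).exists
  refine read_incomplete p t' _ (hf t' h2) (decide_eq_true ?_)
  exact hS.trans (card_le_count h1)

end Run

end CRR


namespace CRR

universe u

variable {n k : ℕ} {V : Type u} {v₀ : V}

/-! ## Termination of `write_quorum` -/

namespace WriteCall

/-- Replica `j` has acknowledged the call `w` with an incarnation number that is at least `B`. -/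
def Has (w : WriteCall n V) (j : Fin n) (B : ℕ) : Prop :=
  ∃ a, (w.Q j = some a ∨ w.M j = some a) ∧ B ≤ a.inc

lemma Has.collect {w : WriteCall n V} {i : Fin n} {B : ℕ} (h : w.Has i B) (j : Fin n)
    (a : WAck n) : (w.collect j a).Has i B := by
  obtain ⟨b, hb | hb, hB⟩ := h
  · exact ⟨b, .inl hb, hB⟩
  · by_cases hij : i = j
    · subst hij
      obtain ⟨a', h1, h2⟩ := mergeAck_good (y := some a) (.inl hb)
      exact ⟨a', .inr (by simp [WriteCall.collect, h1]), hB.trans h2⟩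
    · exact ⟨b, .inr (by simpa [WriteCall.collect, Function.update_of_ne hij] using hb), hB⟩

lemma Has.merged {w : WriteCall n V} {i : Fin n} {B : ℕ} (h : w.Has i B) (j : Fin n)
    (a : WAck n) : ∃ b, (w.merged j a).Q i = some b ∧ B ≤ b.inc := by
  obtain ⟨b, hb, hB⟩ := h.collect j a
  obtain ⟨a', h1, h2⟩ := mergeAck_good hb
  exact ⟨a', h1, hB.trans h2⟩

lemma has_collect (w : WriteCall n V) (j : Fin n) (a : WAck n) : (w.collect j a).Has j a.inc := by
  obtain ⟨a', h1, h2⟩ := mergeAck_good (x := w.M j) (y := some a) (.inr rfl)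
  exact ⟨a', .inr (by simp [WriteCall.collect, h1]), h2⟩

lemma has_merged (w : WriteCall n V) (j : Fin n) (a : WAck n) :
    ∃ b, (w.merged j a).Q j = some b ∧ a.inc ≤ b.inc := by
  obtain ⟨b, hb, hB⟩ := has_collect w j a
  obtain ⟨a', h1, h2⟩ := mergeAck_good hb
  exact ⟨a', h1, hB.trans h2⟩

lemma validate_Q {w : WriteCall n V} {S : List (CrashVec n)} {i : Fin n} {a : WAck n}
    (h : w.Q i = some a) (hB : (w.validate k S).call.cv i ≤ a.inc) :
    (w.validate k S).call.Q i = some a := by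
  rw [validate_call] at hB ⊢
  exact Option.filter_eq_some_iff.2 ⟨h, decide_eq_true hB⟩

/-- Merging can only increase the recorded number, and a validation keeps an acknowledgement whose
number is at least the new entry of `cv`; thus the bound on `w'.cv i` is all that is needed. -/
lemma Step.has {x : ℕ} {j i : Fin n} {m : DMsg n V} {w w' : WriteCall n V} {B : ℕ}
    (h : Step k x j m w w') (hB : w.Has i B) (hcv : w'.cv i ≤ B) : w'.Has i B := by
  rcases h with _ | ⟨_, a, h⟩ | ⟨_, a, h, _, _⟩ | ⟨_, q, y, h, hc⟩ | ⟨_, _, w'', S, hv, hd⟩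
  · exact hB
  · exact hB.collect j a
  · obtain ⟨b, hb, hle⟩ := hB.merged j a
    exact ⟨b, .inl hb, hle⟩
  · exact hB
  · rcases hv with ⟨_, a, _, _, _⟩ | ⟨_, q, y, _, _⟩
    · obtain ⟨b, hb, hle⟩ := hB.merged j a
      exact ⟨b, .inl (validate_Q hb (hcv.trans hle)), hle⟩
    · obtain ⟨b, hb | hb, hle⟩ := hB
      · exact ⟨b, .inl (validate_Q hb (hcv.trans hle)), hle⟩
      · exact ⟨b, .inr (by rw [validate_call]; exact hb), hle⟩

lemma Step.of_ack {x : ℕ} {j : Fin n} {a : WAck n} {w w' : WriteCall n V}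
    (h : Step k x j (.writeAck w.id a.inc a.cv) w w') :
    (w' = w.collect j a ∧ (w.inner = none → count (w.merged j a).Q < n - k)) ∨
    (∃ q, w' = { w.merged j a with inner := some q }) ∨
    ∃ S, Validates k j (.writeAck w.id a.inc a.cv) w (w.merged j a) S ∧
      w' = ((w.merged j a).validate k S).call := by
  generalize hm : (DMsg.writeAck w.id a.inc a.cv : DMsg n V) = m at h
  rcases h with ⟨_, _, h, _⟩ | ⟨_, b, h⟩ | ⟨_, b, h, _, _⟩ | ⟨_, q, y, h, hc⟩ |
    ⟨_, _, w'', S, hv, hd⟩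
  · exact absurd hm.symm (h _ _)
  · obtain ⟨i, c⟩ := a
    obtain ⟨i', c'⟩ := b
    cases hm
    exact .inl ⟨rfl, h⟩
  · obtain ⟨i, c⟩ := a
    obtain ⟨i', c'⟩ := b
    cases hm
    exact .inr (.inl ⟨_, rfl⟩)
  · cases hm
  · rcases hv with ⟨_, b, h, hc, hreq⟩ | ⟨_, q, y, _, _⟩
    · obtain ⟨i, c⟩ := a
      obtain ⟨i', c'⟩ := b
      cases hm
      exact .inr (.inr ⟨_, .direct w ⟨i, c⟩ h hc hreq, rfl⟩)
    · cases hm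

lemma Step.has_ack {x : ℕ} {j : Fin n} {a : WAck n} {w w' : WriteCall n V}
    (h : Step k x j (.writeAck w.id a.inc a.cv) w w') (hcv : w'.cv j ≤ a.inc) :
    w'.Has j a.inc := by
  obtain ⟨b, hb, hle⟩ := has_merged w j a
  rcases h.of_ack with ⟨rfl, -⟩ | ⟨q, rfl⟩ | ⟨S, -, rfl⟩
  · exact has_collect w j a
  · exact ⟨b, .inl hb, hle⟩
  · exact ⟨b, .inl (validate_Q hb (hcv.trans hle)), hle⟩

end WriteCall

/-! ### Calls of `write_quorum` that go on forever -/

namespace Run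

variable {ρ : Run (algorithmD n k v₀)}

lemma ph_write_succ {p : Proc n} {t : ℕ} {w w' : WriteCall n V} (hw : (ρ.ph p t).write = some w)
    (hw' : (ρ.ph p (t + 1)).write = some w') (hid : w'.id = w.id) :
    ((∀ j m, ¬ ρ.Delivers t (.replica j) p m) ∧ w' = w) ∨
    ∃ j m, ρ.Delivers t (.replica j) p m ∧ WriteCall.Step k (ρ.uid t) j m w w' ∧
      ∀ w'' S, WriteCall.Validates k j m w w'' S → ∀ e ∈ w'.resend, ρ.Sends t p e.1 e.2 := by
  obtain ⟨s, hok⟩ := exists_writeOK p t w hw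
  have hne : w.id ≠ ρ.uid t := by
    rw [hok.id]
    intro h
    have := ρ.uid_injective h
    have := hok.lt
    omega
  by_cases hb : ρ.Begins t p
  · obtain ⟨req, h⟩ := ρ.ph_begins hb
    rw [h] at hw'; cases hw'
  · by_cases hd : ∃ j m, ρ.Delivers t (.replica j) p m
    · obtain ⟨j, m, hd⟩ := hd
      obtain ⟨l, ⟨-, ⟨h, hs⟩ | ⟨-, h, -⟩⟩, hl⟩ := ρ.ph_delivers hd
      · obtain ⟨w₁, h1, h2, h3⟩ := h.write hw'
        rw [h1] at hw; cases hw
        refine .inr ⟨j, m, hd, h3, fun w'' S hv e he => (hl _ _).2 (hs _ _ _ h1 hv _ ?_)⟩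
        rw [h2]; exact he
      · obtain ⟨req, rfl⟩ := h.write hw'
        exact absurd hid.symm hne
    · push Not at hd
      rw [ρ.ph_other hd hb, hw] at hw'
      cases hw'
      exact .inl ⟨hd, rfl⟩

/-- From time `T` on, process `p` executes the call `id` of `write_quorum`. -/
structure Writing (ρ : Run (algorithmD n k v₀)) (p : Proc n) (T id : ℕ)
    (W : ℕ → WriteCall n V) : Prop where
  write : ∀ t ≥ T, (ρ.ph p t).write = some (W t)
  id : ∀ t ≥ T, (W t).id = id

variable (ρ) in
/-- In step `t`, the set `Q` of the write call of `p` is validated. -/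
def ValidatesAt (p : Proc n) (W : ℕ → WriteCall n V) (t : ℕ) : Prop :=
  ∃ j m w' S, ρ.Delivers t (.replica j) p m ∧ WriteCall.Validates k j m (W t) w' S ∧
    W (t + 1) = (w'.validate k S).call ∧ ∀ e ∈ (W (t + 1)).resend, ρ.Sends t p e.1 e.2

namespace Writing

variable {p : Proc n} {T id : ℕ} {W : ℕ → WriteCall n V}

lemma step (h : ρ.Writing p T id W) {t : ℕ} (ht : T ≤ t) :
    ((∀ j m, ¬ ρ.Delivers t (.replica j) p m) ∧ W (t + 1) = W t) ∨
    ∃ j m, ρ.Delivers t (.replica j) p m ∧ WriteCall.Step k (ρ.uid t) j m (W t) (W (t + 1)) ∧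
      ∀ w'' S, WriteCall.Validates k j m (W t) w'' S →
        ∀ e ∈ (W (t + 1)).resend, ρ.Sends t p e.1 e.2 :=
  ph_write_succ (h.write t ht) (h.write (t + 1) (by omega))
    (by rw [h.id t ht, h.id (t + 1) (by omega)])

lemma step_of_ack (h : ρ.Writing p T id W) {t : ℕ} (ht : T ≤ t) {j : Fin n} {m : DMsg n V}
    (hd : ρ.Delivers t (.replica j) p m) :
    WriteCall.Step k (ρ.uid t) j m (W t) (W (t + 1)) := by
  rcases h.step ht with ⟨h', -⟩ | ⟨j', m', hd', h', -⟩
  · exact absurd hd (h' j m)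
  · unfold Delivers at hd hd'
    rw [hd] at hd'
    cases hd'
    exact h'

lemma req (h : ρ.Writing p T id W) {t : ℕ} (ht : T ≤ t) : (W t).req = (W T).req := by
  induction t, ht using Nat.le_induction with
  | base => rfl
  | succ t ht ih =>
    rcases h.step ht with ⟨-, h'⟩ | ⟨j, m, hd, h', -⟩
    · rw [h', ih]
    · rw [h'.req.1, ih]

lemma has_mono (h : ρ.Writing p T id W) {t t' : ℕ} (ht : T ≤ t) (ht' : t ≤ t') {j : Fin n} {B : ℕ}
    (hB : (W t).Has j B) (hcv : ∀ s ≥ t, (W s).cv j ≤ B) : (W t').Has j B := by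
  induction t', ht' using Nat.le_induction with
  | base => exact hB
  | succ t' ht' ih =>
    rcases h.step (ht.trans ht') with ⟨-, h'⟩ | ⟨j, m, hd, h', -⟩
    · rwa [h']
    · exact h'.has ih (hcv _ (by omega))

lemma sends_of_validates (h : ρ.Writing p T id W) {t : ℕ} (ht : T ≤ t) {j : Fin n} {m : DMsg n V}
    {w' : WriteCall n V} {S : List (CrashVec n)} (hd : ρ.Delivers t (.replica j) p m)
    (hv : WriteCall.Validates k j m (W t) w' S) :
    ∀ e ∈ (W (t + 1)).resend, ρ.Sends t p e.1 e.2 := by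
  rcases h.step ht with ⟨h', -⟩ | ⟨j', m', hd', -, h'⟩
  · exact absurd hd (h' j m)
  · unfold Delivers at hd hd'
    rw [hd] at hd'
    cases hd'
    exact h' _ _ hv

/-- What happens in steps that do not validate. -/
lemma step_of_not_validates (h : ρ.Writing p T id W) {t : ℕ} (ht : T ≤ t)
    (hv : ¬ ρ.ValidatesAt p W t) :
    W (t + 1) = W t ∨
    (∃ j a, W (t + 1) = (W t).collect j a) ∨
    (∃ j a x, (W t).inner = none ∧
      W (t + 1) = { (W t).merged j a with inner := some (ReadCall.start x .cv) }) ∨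
    ∃ q j y, (W t).inner = some q ∧ W (t + 1) = { W t with inner := some (q.record j y) } := by
  rcases h.step ht with ⟨-, h'⟩ | ⟨j, m, hd, h', hs⟩
  · exact .inl h'
  · generalize hw : W t = w at *
    generalize hw' : W (t + 1) = w' at *
    rcases h' with _ | ⟨_, a, h⟩ | ⟨_, a, h, _, _⟩ | ⟨_, q, y, h, hc⟩ | ⟨_, _, w'', S, hval, hdone⟩
    · exact .inl rfl
    · exact .inr (.inl ⟨j, a, rfl⟩)
    · exact .inr (.inr (.inl ⟨j, a, _, h, rfl⟩))
    · exact .inr (.inr (.inr ⟨q, j, y, h, rfl⟩))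
    · exact absurd ⟨j, m, w'', S, hd, hw ▸ hval, hw', hw' ▸ hs _ _ hval⟩ hv

lemma cv_of_not_validates (h : ρ.Writing p T id W) {t : ℕ} (ht : T ≤ t)
    (hv : ¬ ρ.ValidatesAt p W t) : (W (t + 1)).cv = (W t).cv := by
  rcases h.step_of_not_validates ht hv with h' | ⟨j, a, h'⟩ | ⟨j, a, x, -, h'⟩ |
    ⟨q, j, y, -, h'⟩ <;> rw [h'] <;> rfl

/-- The vector `cv` changes only in validations, so its value at `t` was set by the last validation
before. -/
lemma exists_validatesAt_cv (h : ρ.Writing p T id W) {t₀ t : ℕ} (ht₀ : T ≤ t₀)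
    (hv : ρ.ValidatesAt p W t₀) (ht : t₀ < t) :
    ∃ t₁ ≥ t₀, ρ.ValidatesAt p W t₁ ∧ (W (t₁ + 1)).cv = (W t).cv := by
  induction t, ht using Nat.le_induction with
  | base => exact ⟨t₀, le_rfl, hv, rfl⟩
  | succ t ht ih =>
    by_cases hv' : ρ.ValidatesAt p W t
    · exact ⟨t, by omega, hv', rfl⟩
    · obtain ⟨t₁, h1, h2, h3⟩ := ih
      exact ⟨t₁, h1, h2, h3.trans (h.cv_of_not_validates (by omega) hv').symm⟩

lemma cv_eq_zero_or_assigns (h : ρ.Writing p T id W) {t : ℕ} (ht : T ≤ t) (j : Fin n) :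
    (W t).cv j = 0 ∨ ∃ s, ρ.Assigns s j ((W t).cv j) := by
  obtain ⟨s, hok⟩ := exists_writeOK p t _ (h.write t ht)
  rcases hok.cv j with h0 | ⟨l, r, -, h0⟩
  · exact .inl h0
  · rw [h0]
    exact (assigns_of_cv l j (r + 1)).imp_right fun ⟨s, _, hs⟩ => ⟨s, hs⟩

lemma read_eq (h : ρ.Writing p T id W) {t : ℕ} (ht : T ≤ t) : (ρ.ph p t).read = (W t).inner := by
  have := h.write t ht
  rcases hf : ρ.ph p t with _ | q | w <;> rw [hf] at this <;> cases this
  rfl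

end Writing

/-- The conditions under which a call of `write_quorum` by `p` terminates: from time `T` on, the
caller and the replicas in `E` and `S` are up, and the acknowledgements from `E` are going to be
valid. -/
structure WriteLive (ρ : Run (algorithmD n k v₀)) (p : Proc n) (T : ℕ) (E S : Finset (Fin n))
    (ts : Prop) : Prop where
  caller : ρ.UpFrom p T
  card : n - k ≤ E.card
  up : ∀ j ∈ E, ρ.UpFrom (.replica j) T
  bounded : ∀ j ∈ E, ∃ C, ∀ s v, ρ.Assigns s j v → v ≤ C
  readCard : k + 1 ≤ S.card
  readUp : ∀ l ∈ S, ρ.UpFrom (.replica l) T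
  readActive : ∀ l ∈ S, ρ.stale l T = false
  active : ts → ∀ j ∈ E, ρ.stale j T = false
  current : ts → ∀ j ∈ E, ∀ r ≥ T, ∀ s v, ρ.Assigns s j v → v ≤ (ρ.reg j r).cv j

namespace Writing

variable {p : Proc n} {T id : ℕ} {W : ℕ → WriteCall n V} {E S : Finset (Fin n)}

/-- A write request sent to a replica in `E` is acknowledged. -/
lemma exists_ack (hR : ρ.ReliableChannels) (h : ρ.Writing p T id W)
    (hL : ρ.WriteLive p T E S (W T).req.IsTSVal) {s : ℕ} (hs : T ≤ s) {j : Fin n} (hj : j ∈ E)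
    {t : ℕ} (ht : T ≤ t)
    (hsend : ρ.Sends s p (.replica j) (.write id (W T).req ((W t).cv j))) :
    ∃ r > s, ∃ a : WAck n, ρ.Delivers r (.replica j) p (.writeAck id a.inc a.cv) ∧
      (W t).cv j ≤ a.inc := by
  obtain ⟨r, hr, a, r', hr', hd, hserved, hinc⟩ := write_roundtrip hR hL.caller (hL.up j hj)
    (fun hts => hL.active hts j hj) hs hsend
  refine ⟨r, hr, a, hd, ?_⟩
  by_cases hts : (W T).req.IsTSVal
  · rw [hserved.inc]
    rcases h.cv_eq_zero_or_assigns ht j with h0 | ⟨s', ha⟩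
    · rw [h0]; exact Nat.zero_le _
    · exact hL.current hts j hj _ (by omega) _ _ ha
  · exact hinc hts

/-- An inner read ends by `read_call_ends`, and it can only end with a validation. While there is
none, retransmissions collect acknowledgements from all of `E`; these are enough to start a
validation, directly or by an inner read. -/
lemma exists_validatesAt (hF : ρ.Fair) (hR : ρ.ReliableChannels) (hk : k < n)
    (h : ρ.Writing p T id W) (hL : ρ.WriteLive p T E S (W T).req.IsTSVal) {t : ℕ} (ht : T ≤ t) :
    ∃ t' ≥ t, ρ.ValidatesAt p W t' := by
  by_contra hno
  push Not at hno
  by_cases hin : ∃ t₀ ≥ t, ∃ q, (W t₀).inner = some q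
  · obtain ⟨t₀, ht₀, q, hq⟩ := hin
    obtain ⟨t', ht', hend⟩ := read_call_ends hF hR hL.caller hL.readCard hL.readUp hL.readActive
      (id := q.id) (ht.trans ht₀)
    apply hend
    rw [h.read_eq (by omega)]
    clear hend
    induction t', ht' using Nat.le_induction with
    | base => exact ⟨q, hq, rfl⟩
    | succ t' ht' ih =>
      obtain ⟨q', hq', hid⟩ := ih
      rcases h.step_of_not_validates (by omega) (hno t' (by omega)) with
        h' | ⟨j, a, h'⟩ | ⟨j, a, x, h'', h'⟩ | ⟨q'', j, y, h'', h'⟩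
      · rw [h']; exact ⟨q', hq', hid⟩
      · rw [h']; exact ⟨q', hq', hid⟩
      · rw [hq'] at h''; cases h''
      · rw [hq'] at h''; cases h''
        exact ⟨q'.record j y, by rw [h'], hid⟩
  -- In this case the call waits for acknowledgements forever: `Q` and `cv` are frozen, and
  -- acknowledgements are only collected in `M`.
  · push Not at hin
    have hin' : ∀ t₀ ≥ t, (W t₀).inner = none := fun t₀ h₀ =>
      Option.eq_none_iff_forall_ne_some.2 (hin t₀ h₀)
    have hstep : ∀ t₀ ≥ t, W (t₀ + 1) = W t₀ ∨ ∃ j a, W (t₀ + 1) = (W t₀).collect j a := by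
      intro t₀ h₀
      rcases h.step_of_not_validates (by omega) (hno t₀ h₀) with
        h' | h' | ⟨j, a, x, h'', h'⟩ | ⟨q, j, y, h'', h'⟩
      · exact .inl h'
      · exact .inr h'
      · exact absurd (by rw [h']) (hin (t₀ + 1) (by omega) (ReadCall.start x .cv))
      · rw [hin' t₀ h₀] at h''; cases h''
    have hQ : ∀ t₀ ≥ t, (W t₀).Q = (W t).Q ∧ (W t₀).cv = (W t).cv := by
      intro t₀ h₀
      induction t₀, h₀ using Nat.le_induction with
      | base => exact ⟨rfl, rfl⟩
      | succ t₀ h₀ ih =>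
        rcases hstep t₀ h₀ with h' | ⟨j, a, h'⟩ <;> rw [h'] <;> exact ih
    have hhas : ∀ j B, ∀ t₀ ≥ t, (W t₀).Has j B → ∀ t₁ ≥ t₀, (W t₁).Has j B := by
      intro j B t₀ h₀ hB t₁ h₁
      induction t₁, h₁ using Nat.le_induction with
      | base => exact hB
      | succ t₁ h₁ ih =>
        rcases hstep t₁ (by omega) with h' | ⟨j, a, h'⟩ <;> rw [h']
        · exact ih
        · exact ih.collect _ _
    -- every replica outside `Q` answers again and again
    have hack : ∀ j ∈ E, (W t).Q j = none → ∀ t₀ ≥ t, ∃ r ≥ t₀, ∃ a : WAck n,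
        ρ.Delivers r (.replica j) p (.writeAck id a.inc a.cv) := by
      intro j hj hj' t₀ h₀
      obtain ⟨s, hs, htick⟩ := hF p ⟨T, hL.caller⟩ t₀
      have hmem := WriteCall.mem_resend (hin' s (by omega)) (z := j)
        (by rw [(hQ s (by omega)).1, hj'])
      have hsend : ρ.Sends s p (.replica j) (.write id (W T).req ((W s).cv j)) := by
        refine ρ.sends_of_tick htick ?_
        have hw := h.write s (by omega)
        rcases hf : ρ.ph p s with _ | q | w <;> rw [hf] at hw <;> cases hw
        rw [h.id s (by omega), h.req (by omega)] at hmem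
        exact hmem
      obtain ⟨r, hr, a, hd, -⟩ := h.exists_ack hR hL (by omega) hj (by omega : T ≤ s) hsend
      exact ⟨r, by omega, a, hd⟩
    have hrec : ∀ j (a : WAck n) r, t ≤ r →
        ρ.Delivers r (.replica j) p (.writeAck id a.inc a.cv) →
        W (r + 1) = (W r).collect j a ∧ count ((W r).merged j a).Q < n - k := by
      intro j a r hr hd
      have hst := h.step_of_ack (by omega) hd
      rw [← h.id r (by omega)] at hst hd
      rcases hst.of_ack with ⟨h1, h2⟩ | ⟨q, h'⟩ | ⟨S, hv, h'⟩
      · exact ⟨h1, h2 (hin' r hr)⟩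
      · exact absurd (by rw [h']) (hin (r + 1) (by omega) q)
      · exact absurd ⟨_, _, _, _, hd, hv, h', h.sends_of_validates (by omega) hd hv⟩ (hno r hr)
    have hall : ∀ j ∈ E, ∀ᶠ t' in Filter.atTop, (W t').Has j 0 := by
      intro j hj
      rcases hq : (W t).Q j with _ | a
      · obtain ⟨r, hr, a, hd⟩ := hack j hj hq t le_rfl
        refine Filter.eventually_atTop.2 ⟨r + 1, hhas j 0 (r + 1) (by omega) ?_⟩
        rw [(hrec j a r hr hd).1]
        obtain ⟨b, hb, -⟩ := WriteCall.has_collect (W r) j a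
        exact ⟨b, hb, Nat.zero_le _⟩
      · exact Filter.eventually_atTop.2 ⟨t, hhas j 0 t le_rfl ⟨a, .inl hq, Nat.zero_le _⟩⟩
    obtain ⟨t', h1, h2⟩ :=
      (((Finset.eventually_all E).2 hall).and (Filter.eventually_ge_atTop t)).exists
    -- The size of the merged set is examined only when an acknowledgement arrives. A replica of `E`
    -- outside `Q`, which keeps being asked, sends one after all of `E` has been recorded.
    obtain ⟨j, hj, hjQ⟩ : ∃ j ∈ E, (W t).Q j = none := by
      by_contra hne
      push Not at hne
      have := card_le_count (f := (W t).Q) (E := E) fun j hj =>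
        Option.isSome_iff_ne_none.2 (hne j hj)
      have := count_Q_lt hk p t _ (h.write t ht) (hin' t le_rfl)
      have := hL.card
      omega
    obtain ⟨r, hr, a, hd⟩ := hack j hj hjQ t' h2
    have hlt := (hrec j a r (by omega) hd).2
    have := card_le_count (f := ((W r).merged j a).Q) (E := E) fun i hi => by
      obtain ⟨b, hb, -⟩ := (hhas i 0 t' h2 (h1 i hi) r hr).merged j a
      rw [hb]; rfl
    have := hL.card
    omega

/-- Eventually, every replica in `E` has given an acknowledgement that passes all validations. -/
lemma exists_settled (hF : ρ.Fair) (hR : ρ.ReliableChannels) (hk : k < n)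
    (h : ρ.Writing p T id W) (hL : ρ.WriteLive p T E S (W T).req.IsTSVal) {j : Fin n}
    (hj : j ∈ E) : ∃ B t, T ≤ t ∧ ∀ t' ≥ t, (W t').Has j B ∧ (W t').cv j ≤ B := by
  obtain ⟨t₀, ht₀, hv₀⟩ := h.exists_validatesAt hF hR hk hL (le_refl T)
  obtain ⟨C, hC⟩ := hL.bounded j hj
  -- The entry for `j` is zero or an incarnation number of `j`, and these are bounded; so it attains
  -- a maximum after the first validation.
  obtain ⟨tm, htm, hmax⟩ := exists_max_ge (f := fun t => (W t).cv j) (T := t₀ + 1) (C := C) (by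
    intro t ht
    rcases h.cv_eq_zero_or_assigns (by omega : T ≤ t) j with h0 | ⟨s, hs⟩
    · simp [h0]
    · exact hC s _ hs)
  -- Back to the validation that produced the maximal entry: there the requests are sent anew with
  -- this entry, unless `j` has remained in `Q` and has already passed it.
  obtain ⟨t₁, ht₁, ⟨i, m, w', S', hd, hv, hW, hsend⟩, hcv⟩ := h.exists_validatesAt_cv ht₀ hv₀ htm
  have hmax' : ∀ s ≥ t₁ + 1, (W s).cv j ≤ (W (t₁ + 1)).cv j := fun s hs => by
    rw [hcv]; exact hmax s (by omega)
  have hin : (W (t₁ + 1)).inner = none := by rw [hW, WriteCall.validate_call]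
  have hT : T ≤ t₁ + 1 := by omega
  suffices ∃ t ≥ t₁ + 1, (W t).Has j ((W (t₁ + 1)).cv j) by
    obtain ⟨t, ht, hh⟩ := this
    exact ⟨_, t, by omega, fun t' ht' =>
      ⟨h.has_mono (by omega) ht' hh fun s hs => hmax' s (by omega), hmax' t' (by omega)⟩⟩
  rcases hq : (W (t₁ + 1)).Q j with _ | a
  · have := hsend _ (WriteCall.mem_resend hin hq)
    rw [h.id _ hT, h.req hT] at this
    obtain ⟨r, hr, a, hda, hle⟩ := h.exists_ack hR hL (by omega) hj hT this
    have hst := h.step_of_ack (by omega) hda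
    rw [← h.id r (by omega)] at hst
    obtain ⟨b, hb, hb'⟩ := hst.has_ack ((hmax' (r + 1) (by omega)).trans hle)
    exact ⟨r + 1, by omega, b, hb, hle.trans hb'⟩
  · obtain ⟨s, hok⟩ := exists_writeOK p _ _ (h.write _ hT)
    exact ⟨t₁ + 1, le_rfl, a, .inl hq, hok.le_inc hin j a hq⟩

/-- After some time all replicas of `E` have given acknowledgements that pass every validation. The
next validation may still concern a set `Q` fixed before, when its inner read was opened; its end
`t₂` is awaited. The following one, at `t₃`, keeps all of `E`, at least `n - k` replicas, and would
complete the call. -/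
theorem absurd (hF : ρ.Fair) (hR : ρ.ReliableChannels) (hk : k < n) (h : ρ.Writing p T id W)
    (hL : ρ.WriteLive p T E S (W T).req.IsTSVal) : False := by
  have : ∀ j, ∃ B t, j ∈ E → T ≤ t ∧ ∀ t' ≥ t, (W t').Has j B ∧ (W t').cv j ≤ B := by
    intro j
    by_cases hj : j ∈ E
    · obtain ⟨B, t, h⟩ := h.exists_settled hF hR hk hL hj
      exact ⟨B, t, fun _ => h⟩
    · exact ⟨0, 0, fun h => False.elim (hj h)⟩
  choose B N hBN using this
  set t₁ := max T (E.sup N) with ht₁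
  have hset : ∀ t ≥ t₁, ∀ j ∈ E, (W t).Has j (B j) ∧ (W t).cv j ≤ B j := fun t ht j hj =>
    (hBN j hj).2 t ((Finset.le_sup hj).trans ((le_max_right _ _).trans ht))
  have hT : T ≤ t₁ := le_max_left _ _
  obtain ⟨t₂, ht₂, ⟨i, m, w', S', -, -, hW, -⟩⟩ := h.exists_validatesAt hF hR hk hL hT
  have hin : (W (t₂ + 1)).inner = none := by rw [hW, WriteCall.validate_call]
  -- a validation that starts after `t₂` uses acknowledgements that pass it
  have hinv : ∀ t ≥ t₂ + 1, ∀ q, (W t).inner = some q →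
      ∀ j ∈ E, ∃ a, (W t).Q j = some a ∧ B j ≤ a.inc := by
    intro t ht
    induction t, ht using Nat.le_induction with
    | base => intro q hq; rw [hin] at hq; cases hq
    | succ t ht ih =>
      by_cases hv : ρ.ValidatesAt p W t
      · obtain ⟨i, m, w', S', -, -, hW, -⟩ := hv
        intro q hq
        rw [hW, WriteCall.validate_call] at hq
        cases hq
      · rcases h.step_of_not_validates (by omega) hv with
          h' | ⟨j, a, h'⟩ | ⟨j, a, x, h'', h'⟩ | ⟨q, j, y, h'', h'⟩ <;> rw [h']
        · exact ih
        · exact ih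
        · exact fun q _ i hi => (hset t (by omega) i hi).1.merged j a
        · exact fun q' _ => ih q h''
  obtain ⟨t₃, ht₃, ⟨i, m, w', S', -, hv, hW, -⟩⟩ :=
    h.exists_validatesAt hF hR hk hL (by omega : T ≤ t₂ + 1)
  have hin₃ : (W (t₃ + 1)).inner = none := by rw [hW, WriteCall.validate_call]
  have hQ : ∀ j ∈ E, ∃ a, w'.Q j = some a ∧ B j ≤ a.inc := by
    intro j hj
    generalize hw : W t₃ = w at hv
    rcases hv with ⟨_, a, _, _, _⟩ | ⟨_, q, y, hq, _⟩
    · exact (hw ▸ (hset t₃ (by omega) j hj).1).merged i a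
    · exact hw ▸ hinv t₃ ht₃ q (hw ▸ hq) j hj
  have h1 := card_le_count (f := (W (t₃ + 1)).Q) (E := E) fun j hj => by
    obtain ⟨a, ha, hle⟩ := hQ j hj
    have := (hset (t₃ + 1) (by omega) j hj).2
    rw [hW] at this ⊢
    rw [WriteCall.validate_Q ha (this.trans hle)]
    rfl
  have h2 := count_Q_lt hk p _ _ (h.write (t₃ + 1) (by omega)) hin₃
  have := hL.card
  omega

end Writing

theorem write_call_ends (hF : ρ.Fair) (hR : ρ.ReliableChannels) (hk : k < n) {p : Proc n}
    {T : ℕ} {E S : Finset (Fin n)} {ts : Prop} (hL : ρ.WriteLive p T E S ts) {id : ℕ}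
    (h : ∀ t ≥ T, ∃ w, (ρ.ph p t).write = some w ∧ w.id = id ∧ (w.req.IsTSVal → ts)) : False := by
  have : Nonempty (WriteCall n V) := let ⟨w, _⟩ := h T le_rfl; ⟨w⟩
  choose! W hw hid hts using h
  exact Writing.absurd hF hR hk ⟨hw, hid⟩
    { hL with
      active := fun h => hL.active (hts T le_rfl h)
      current := fun h => hL.current (hts T le_rfl h) }

end Run

end CRR


namespace CRR

universe u

variable {n k : ℕ} {V : Type u} {v₀ : V}

/-! ## Wait freedom -/

/-- The identifier of the quorum access. -/
def Phase.callId : Phase n V → Option ℕ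
  | .idle => none
  | .rd q => some q.id
  | .wr w => some w.id

lemma Phase.Step.write_none {x : ℕ} {j : Fin n} {m : DMsg n V} {f f' : Phase n V}
    (h : Phase.Step k x j m f f') : f'.write = none ↔ f.write = none := by
  rcases h with _ | _ | _ | _ <;> simp [Phase.write]

namespace Run

lemma up_of_neverCrashes {A : Implementation n V} {ρ : Run A} {p : Proc n}
    (h : ρ.NeverCrashes p) (t : ℕ) : ρ.Up p t := by
  unfold Up
  induction t with
  | zero =>
    rw [ρ.cfg_zero]
    cases p <;> rfl
  | succ t ih =>
    have hc := h t
    rw [ρ.cfg_succ]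
    rcases p with l | c <;>
      rcases ha : ρ.act t with ⟨d, op⟩ | ⟨src, ⟨j⟩ | ⟨d⟩, m⟩ | ⟨⟨j⟩ | ⟨d⟩⟩ | ⟨⟨j⟩ | ⟨d⟩⟩ |
        ⟨j, rb, e⟩ | _ <;>
      simp only [Config.perform, Config.clientOutcome, Config.replicaOutcome, Config.up] at ih ⊢ <;>
      first
      | exact ih
      | (rw [Function.update_apply]; split_ifs with he; exacts [rfl, ih])
      | (rw [Function.update_of_ne]
         · exact ih
         · rintro rfl; exact hc ha)

variable {ρ : Run (algorithmD n k v₀)}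

/-! ### Every quorum access comes to an end -/

lemma callId_ne {p : Proc n} {t x : ℕ} (h : (ρ.ph p t).callId = some x) : x ≠ ρ.uid t := by
  have key : ∃ s < t, x = ρ.uid s := by
    rcases hf : ρ.ph p t with _ | q | w <;> rw [hf] at h <;> cases h
    · obtain ⟨s, hs⟩ := exists_readOK p t q (by rw [hf]; rfl)
      exact ⟨s, hs.lt, hs.id⟩
    · obtain ⟨s, hs⟩ := exists_writeOK p t w (by rw [hf]; rfl)
      exact ⟨s, hs.lt, hs.id⟩
  obtain ⟨s, hs, rfl⟩ := key
  exact fun h => hs.ne (ρ.uid_injective h)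

lemma ph_kind {p : Proc n} {t x : ℕ} (h : (ρ.ph p t).callId = some x)
    (h' : (ρ.ph p (t + 1)).callId = some x) :
    ((ρ.ph p (t + 1)).write = none ↔ (ρ.ph p t).write = none) := by
  have hne := callId_ne h
  rcases ρ.ph_cases t p with e | hb | ⟨j, m, hd, hs | ⟨-, hf⟩⟩
  · rw [e]
  · obtain ⟨req, e⟩ := ρ.ph_begins hb
    rw [e] at h'; cases h'
    exact absurd rfl hne
  · exact hs.write_none
  · exfalso
    rcases hf with e | ⟨req, e⟩ | ⟨req, e⟩ <;> rw [e] at h' <;> cases h' <;> exact hne rfl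

lemma WriteLive.mono {p : Proc n} {T T' : ℕ} {E S : Finset (Fin n)} {ts : Prop}
    (h : ρ.WriteLive p T E S ts) (hT : T ≤ T') : ρ.WriteLive p T' E S ts where
  caller := h.caller.mono hT
  card := h.card
  up := fun j hj => (h.up j hj).mono hT
  bounded := h.bounded
  readCard := h.readCard
  readUp := fun l hl => (h.readUp l hl).mono hT
  readActive := fun l hl => stale_eq_false_of_le (h.readActive l hl) hT
    fun _ hs _ => (h.readUp l hl).not_restarts hs
  active := fun hts j hj => stale_eq_false_of_le (h.active hts j hj) hT
    fun _ hs _ => (h.up j hj).not_restarts hs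
  current := fun hts j hj r hr => h.current hts j hj r (hT.trans hr)

/-- A quorum access does not go on forever. -/
theorem call_ends (hF : ρ.Fair) (hR : ρ.ReliableChannels) (hk : k < n) {p : Proc n} {T : ℕ}
    {E S : Finset (Fin n)} {ts : Prop} (hL : ρ.WriteLive p T E S ts)
    (hts : ∀ t w, (ρ.ph p t).write = some w → w.req.IsTSVal → ts) {t : ℕ} (ht : T ≤ t) (x : ℕ) :
    ∃ t' ≥ t, (ρ.ph p t').callId ≠ some x := by
  by_contra hno
  push Not at hno
  have hkind : ∀ t' ≥ t, ((ρ.ph p t').write = none ↔ (ρ.ph p t).write = none) := by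
    intro t' ht'
    induction t', ht' using Nat.le_induction with
    | base => rfl
    | succ t' ht' ih => exact (ph_kind (hno t' ht') (hno (t' + 1) (by omega))).trans ih
  by_cases hw : (ρ.ph p t).write = none
  · obtain ⟨t', ht', h⟩ := read_call_ends hF hR hL.caller hL.readCard hL.readUp hL.readActive
      (id := x) ht
    have h1 := (hkind t' ht').2 hw
    have h2 := hno t' ht'
    rcases hf : ρ.ph p t' with _ | q | w <;> rw [hf] at h h1 h2 <;> cases h1 <;> cases h2
    exact h ⟨q, rfl, rfl⟩
  · refine write_call_ends hF hR hk (hL.mono ht) (id := x) fun t' ht' => ?_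
    have h1 := (hkind t' ht').not.2 hw
    have h2 := hno t' ht'
    have h3 := hts t'
    rcases hf : ρ.ph p t' with _ | q | w <;> rw [hf] at h1 h2 h3 <;> cases h2
    · exact absurd rfl h1
    · exact ⟨w, rfl, rfl, h3 w rfl⟩

/-- A process that goes through `N` quorum accesses gets to the end. -/
lemma exists_rank (hF : ρ.Fair) (hR : ρ.ReliableChannels) (hk : k < n) {p : Proc n} {T : ℕ}
    {E S : Finset (Fin n)} {ts : Prop} (hL : ρ.WriteLive p T E S ts)
    (hts : ∀ t w, (ρ.ph p t).write = some w → w.req.IsTSVal → ts) {f : ℕ → ℕ} {N : ℕ}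
    (hidle : ∀ t ≥ T, f t < N → ∃ x, (ρ.ph p t).callId = some x)
    (hf : ∀ t ≥ T, f t < f (t + 1) ∨
      f (t + 1) = f t ∧ (ρ.ph p (t + 1)).callId = (ρ.ph p t).callId) :
    ∃ t ≥ T, N ≤ f t := by
  by_contra hno
  push Not at hno
  -- Where the bounded rank `f` attains its maximum it cannot increase any more, so the same quorum
  -- access would go on forever.
  obtain ⟨t, ht, hmax⟩ := exists_max_ge (f := f) (T := T) (C := N) fun t ht => (hno t ht).le
  obtain ⟨x, hx⟩ := hidle t ht (hno t ht)
  have hconst : ∀ t' ≥ t, f t' = f t ∧ (ρ.ph p t').callId = some x := by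
    intro t' ht'
    induction t', ht' using Nat.le_induction with
    | base => exact ⟨rfl, hx⟩
    | succ t' ht' ih =>
      rcases hf t' (by omega) with h | ⟨h1, h2⟩
      · have := hmax (t' + 1) (by omega)
        omega
      · exact ⟨h1.trans ih.1, h2.trans ih.2⟩
  obtain ⟨t', ht', hne⟩ := call_ends hF hR hk hL hts ht x
  exact hne (hconst t' ht').2

/-! ### Incarnation numbers -/

lemma Assigns.unique {i : Fin n} {s v v' : ℕ} (h : ρ.Assigns s i v) (h' : ρ.Assigns s i v') :
    v = v' := by
  obtain ⟨w, w', h1, -⟩ := h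
  obtain ⟨w₁, w₁', h2, -⟩ := h'
  rw [h1] at h2
  cases h2
  rfl

/-- An incarnation adopts at most one number, and after `T` there is no new incarnation; so there is
no adoption after the first one from `T` on, and only finitely many steps have to be considered. -/
lemma exists_assigns_le {i : Fin n} {T : ℕ} (h : ρ.UpFrom (.replica i) T) :
    ∃ C, ∀ s v, ρ.Assigns s i v → v ≤ C := by
  have hfin : ∀ N, ∃ C, ∀ s < N, ∀ v, ρ.Assigns s i v → v ≤ C := by
    intro N
    induction N with
    | zero => exact ⟨0, fun s hs => absurd hs (Nat.not_lt_zero s)⟩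
    | succ N ih =>
      obtain ⟨C, hC⟩ := ih
      by_cases hN : ∃ v, ρ.Assigns N i v
      · obtain ⟨v, hv⟩ := hN
        refine ⟨max C v, fun s hs v' hv' => ?_⟩
        rcases Nat.lt_succ_iff_lt_or_eq.1 hs with hs | rfl
        · exact (hC s hs v' hv').trans (le_max_left _ _)
        · exact hv'.unique hv ▸ le_max_right _ _
      · refine ⟨C, fun s hs v' hv' => ?_⟩
        rcases Nat.lt_succ_iff_lt_or_eq.1 hs with hs | rfl
        · exact hC s hs v' hv'
        · exact absurd ⟨v', hv'⟩ hN
  by_cases hex : ∃ s ≥ T, ∃ v, ρ.Assigns s i v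
  · obtain ⟨s₀, hs₀, v₀, hv₀⟩ := hex
    obtain ⟨C, hC⟩ := hfin (s₀ + 1)
    refine ⟨C, fun s v hv => hC s ?_ v hv⟩
    by_contra hlt
    obtain ⟨r, hlast, hna, -⟩ := hv.spec
    have : r < T := not_le.1 fun hr => h.not_restarts hr hlast.restarts
    exact hna s₀ v₀ (by omega) (by omega) hv₀
  · obtain ⟨C, hC⟩ := hfin T
    exact ⟨C, fun s v hv => hC s (not_le.1 fun hs => hex ⟨s, hs, v, hv⟩) v hv⟩

/-- A recovered replica that stays up knows its own incarnation number. -/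
lemma assigns_le_cv {i : Fin n} {T r : ℕ} (h : ρ.UpFrom (.replica i) T)
    (hst : ρ.stale i r = false) (hr : T ≤ r) {s v : ℕ} (hv : ρ.Assigns s i v) :
    v ≤ (ρ.reg i r).cv i := by
  obtain ⟨r₀, hlast, hna, -⟩ := hv.spec
  have hlt : r₀ < T := not_le.1 fun hr => h.not_restarts hr hlast.restarts
  obtain ⟨r₁, s₁, m, s₂, Q, σ, R, ρ', hrec, hle⟩ :=
    exists_recovered hst (hlt.trans_le hr) hlast.restarts
  have hA := hrec.assigned
  have hm := hA.le_cv
  -- The number was adopted by a former incarnation, by the current one before `r`, or at `r` or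
  -- later; the last is impossible, as the current incarnation already has its number.
  rcases lt_or_ge s r₁ with hs | hs
  · exact ((persist ρ s₁).assigns_lt hA.preCVRead le_rfl hv hs).le.trans hm
  · rcases lt_or_ge s r with hs' | hs'
    · have := hA.unique s v hs hs' hv
      subst this
      exact (hv.unique hA.assigns) ▸ hm
    · have h1 := hA.lt
      have h2 := hA.lt'
      exact absurd hA.assigns (hna s₁ m (by omega) (by omega))

/-! ### Recovery -/

end Run

/-- The number of quorum accesses of the `on restart` block that have been completed. -/
def Recovery.rank : Recovery n V → ℕ
  | .readPre _ => 0
  | .writePre _ _ => 1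
  | .writeCV _ => 2
  | .readState _ => 3
  | .completed => 4

lemma RecvStep.rank {i : Fin n} {x : ℕ} {src : Proc n} {m : DMsg n V} {s s' : DReplica n V}
    (h : RecvStep k i x src m s s') : s.recovery.rank < s'.recovery.rank ∨
      s'.recovery.rank = s.recovery.rank ∧ s'.recovery.phase.callId = s.recovery.phase.callId := by
  rcases h with _ | ⟨_, _, _, _, _, _⟩ | ⟨_, _, _, _, _, _⟩ | ⟨_, _, _, _, _⟩ | ⟨_, _, _, _, _⟩ |
    ⟨_, q, j, y, hj, hs⟩ | ⟨_, q, j, y, hj, hs, hc, m, hm⟩ | ⟨_, m, w, w', j, msg, hj, hs, h⟩ |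
    ⟨_, m, w, j, msg, hj, hs, h⟩ | ⟨_, w, w', j, msg, hj, hs, h⟩ | ⟨_, w, j, msg, hj, hs, h⟩ |
    ⟨_, q, j, y, hj, hs⟩ | ⟨_, q, j, y, hj, hs, hc⟩
  · exact .inr ⟨rfl, rfl⟩
  · exact .inr ⟨rfl, rfl⟩
  · exact .inr ⟨rfl, rfl⟩
  · exact .inr ⟨rfl, rfl⟩
  · exact .inr ⟨rfl, rfl⟩
  · rw [hs]; exact .inr ⟨rfl, rfl⟩
  · rw [hs]; exact .inl (by simp [Recovery.rank])
  · rw [hs]; exact .inr ⟨rfl, congrArg some h.req.2⟩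
  · rw [hs]; exact .inl (by simp [Recovery.rank])
  · rw [hs]; exact .inr ⟨rfl, congrArg some h.req.2⟩
  · rw [hs]; exact .inl (by simp [Recovery.rank])
  · rw [hs]; exact .inr ⟨rfl, rfl⟩
  · rw [hs]; exact .inl (by simp [Recovery.rank])

namespace Run

variable {ρ : Run (algorithmD n k v₀)}

lemma rank_succ {i : Fin n} {t : ℕ} (h : ¬ ρ.Restarts t i) :
    (ρ.recov i t).rank < (ρ.recov i (t + 1)).rank ∨
      (ρ.recov i (t + 1)).rank = (ρ.recov i t).rank ∧
        (ρ.ph (.replica i) (t + 1)).callId = (ρ.ph (.replica i) t).callId := by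
  rcases ρ.rep_cases i t with h' | h' | ⟨src, m, -, h'⟩
  · exact absurd h' h
  · simp [recov, ph, h']
  · exact h'.rank

lemma not_isTSVal_of_replica {i : Fin n} {t : ℕ} {w : WriteCall n V}
    (h : (ρ.ph (.replica i) t).write = some w) : ¬ w.req.IsTSVal := by
  rcases write_cases h with ⟨c, res, T, v, hp, -⟩ | ⟨i', r₀, s₁, m, -, -, hreq, -⟩ |
    ⟨i', m, -, -, hreq⟩
  · cases hp
  · rw [hreq]; exact fun h => h
  · rw [hreq]; exact fun h => h

/-- While `k + 1` replicas are active, replicas that stay up recover. -/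
theorem exists_recovered_from (hF : ρ.Fair) (hR : ρ.ReliableChannels) (hk : k < n) {T : ℕ}
    {E S : Finset (Fin n)} (hE : n - k ≤ E.card) (hup : ∀ j ∈ E, ρ.UpFrom (.replica j) T)
    (hS : k + 1 ≤ S.card) (hSE : S ⊆ E) (hst : ∀ l ∈ S, ρ.stale l T = false) :
    ∃ T' ≥ T, ∀ j ∈ E, ρ.stale j T' = false := by
  have hone : ∀ j ∈ E, ∃ t ≥ T, ρ.stale j t = false := by
    intro j hj
    -- Stale replicas serve the write requests of recoveries, so neither activity nor current
    -- incarnation numbers are required of `E`. This avoids a circle among replicas that recover at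
    -- the same time.
    have hL : ρ.WriteLive (.replica j) T E S False :=
      { caller := hup j hj
        card := hE
        up := hup
        bounded := fun i hi => exists_assigns_le (hup i hi)
        readCard := hS
        readUp := fun l hl => hup l (hSE hl)
        readActive := hst
        active := False.elim
        current := False.elim }
    obtain ⟨t, ht, h⟩ := exists_rank hF hR hk hL (f := fun t => (ρ.recov j t).rank) (N := 4)
      (fun t w hw => not_isTSVal_of_replica hw)
      (by
        intro t _ h
        simp only [ph]
        rcases hr : ρ.recov j t with _ | q | ⟨m, w⟩ | w | q
        · rw [hr] at h; exact absurd h (lt_irrefl 4)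
        all_goals exact ⟨_, rfl⟩)
      (fun t ht => rank_succ ((hup j hj).not_restarts ht))
    refine ⟨t, ht, ?_⟩
    rw [← Bool.not_eq_true, stale_iff, not_not]
    rcases hr : ρ.recov j t with _ | q | ⟨m, w⟩ | w | q <;> simp [hr, Recovery.rank] at h ⊢
  have : ∀ j, ∃ t ≥ T, j ∈ E → ρ.stale j t = false := by
    intro j
    by_cases hj : j ∈ E
    · obtain ⟨t, ht, h⟩ := hone j hj
      exact ⟨t, ht, fun _ => h⟩
    · exact ⟨T, le_rfl, fun h => absurd h hj⟩
  choose N hNT hN using this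
  refine ⟨max T (E.sup N), le_max_left _ _, fun j hj => ?_⟩
  exact stale_eq_false_of_le (hN j hj) ((Finset.le_sup hj).trans (le_max_right _ _))
    fun s hs _ => (hup j hj).not_restarts ((hNT j).trans hs)

end Run

/-- The number of quorum accesses that a client has completed. -/
def DClient.rank : DClient n V → ℕ
  | .query _ _ => 0
  | .store _ _ => 1
  | .idle => 2

namespace Run

variable {ρ : Run (algorithmD n k v₀)}

lemma client_rank_succ {c t : ℕ} (h : ∀ op, ¬ ρ.Invokes t c op) :
    (ρ.cl c t).rank < (ρ.cl c (t + 1)).rank ∨ (ρ.cl c (t + 1)).rank = (ρ.cl c t).rank ∧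
      (ρ.ph (.client c) (t + 1)).callId = (ρ.ph (.client c) t).callId := by
  rcases ρ.cl_cases c t with ⟨op, hi⟩ | ⟨h', -⟩ | ⟨j, m, o, hd, hc, -⟩
  · exact absurd hi (h op)
  · simp [ph, h']
  · simp only [ph]
    generalize ρ.cl c t = s at hc
    generalize ρ.cl c (t + 1) = s' at hc
    rcases hc with _ | _ | ⟨op, q, y, hc⟩ | ⟨m, res, w, w', h⟩ | _
    · exact .inr ⟨rfl, rfl⟩
    · exact .inr ⟨rfl, rfl⟩
    · cases op <;> exact .inl (by simp [DClient.rank, dClientStore])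
    · exact .inr ⟨rfl, congrArg some h.req.2⟩
    · exact .inl (by simp [DClient.rank])

/-- Once the eventually up replicas are all up, those active at that moment serve as read quorum for
the recoveries of the others. When all have recovered, both quorum accesses of an operation come to
an end. -/
theorem waitFree_of_alwaysActive (hF : ρ.Fair) (hR : ρ.ReliableChannels) (hk : k < n)
    (hth : ∃ t, ρ.ThresholdFrom k t) (hact : ρ.AlwaysActive k) : ρ.WaitFree := by
  classical
  intro o c op hi hc
  set E : Finset (Fin n) := Finset.univ.filter ρ.EventuallyUp with hEdef
  have hmem : ∀ i, i ∈ E ↔ ρ.EventuallyUp i := fun i => by simp [hEdef]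
  have hE : n - k ≤ E.card := by
    obtain ⟨t, ht⟩ := hth
    -- A replica that is not eventually up counts as faulty whatever the time `t` is.
    have h1 : Eᶜ.card ≤ k := by
      refine le_trans ?_ ht
      rw [← Set.ncard_coe_finset]
      refine Set.ncard_le_ncard (fun i hi => .inl ?_) (Set.toFinite _)
      simpa [hEdef] using hi
    rw [Finset.card_compl, Fintype.card_fin] at h1
    omega
  have hup : ∃ T, ∀ i ∈ E, ρ.UpFrom (.replica i) T := by
    have : ∀ i, ∃ t, i ∈ E → ρ.UpFrom (.replica i) t := by
      intro i
      by_cases hi : i ∈ E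
      · obtain ⟨t, ht⟩ := (hmem i).1 hi
        exact ⟨t, fun _ => ht⟩
      · exact ⟨0, fun h => absurd h hi⟩
    choose N hN using this
    exact ⟨E.sup N, fun i hi => (hN i hi).mono (Finset.le_sup hi)⟩
  obtain ⟨T, hup⟩ := hup
  -- Activity is needed at the single time `T` only, since these replicas stay up and hence active
  -- afterwards.
  obtain ⟨S, hS, hSact⟩ := hact T
  have hSE : S ⊆ E := fun i hi => (hmem i).2 (hSact i hi).1
  obtain ⟨T', hT', hst⟩ := exists_recovered_from hF hR hk hE hup hS.ge hSE fun l hl => by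
    rw [← Bool.not_eq_true, stale_iff]
    exact (hSact l hl).2.2
  have hL : ρ.WriteLive (.client c) (max T' (o + 1)) E S True :=
    (show ρ.WriteLive (.client c) T' E S True from
    { caller := fun t _ => up_of_neverCrashes hc t
      card := hE
      up := fun j hj => (hup j hj).mono hT'
      bounded := fun i hi => exists_assigns_le (hup i hi)
      readCard := hS.ge
      readUp := fun l hl => (hup l (hSE hl)).mono hT'
      readActive := fun l hl => hst l (hSE hl)
      active := fun _ => hst
      current := fun _ j hj r hr s v hv =>
        assigns_le_cv (hup j hj) (stale_eq_false_of_le (hst j hj) hr fun s hs _ =>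
          (hup j hj).not_restarts (hT'.trans hs)) (hT'.trans hr) hv }).mono (le_max_left _ _)
  by_contra hno
  push Not at hno
  have hresp : ∀ u ≥ o, ∀ r, ρ.resp u ≠ some (c, r) := by
    intro u
    induction u using Nat.strong_induction_on with
    | _ u ih =>
    intro hu r hr
    exact hno u r ⟨c, op, hi, hu, hr, fun u' h1 h2 => ih u' h2 h1⟩
  have hidle : ∀ u ≥ o + 1, ρ.cl c u ≠ .idle := by
    intro u hu
    induction u, hu using Nat.le_induction with
    | base => rw [ρ.cl_invoke hi]; simp [dClientInvoke]
    | succ u hu ih => exact ρ.not_idle_succ ih (hresp u (by omega))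
  obtain ⟨t, ht, h⟩ := exists_rank hF hR hk hL (f := fun t => (ρ.cl c t).rank) (N := 2)
    (fun _ _ _ _ => trivial)
    (by
      intro t _ h
      simp only [ph]
      rcases hr : ρ.cl c t with _ | ⟨op, q⟩ | ⟨res, w⟩
      · rw [hr] at h; exact absurd h (lt_irrefl 2)
      all_goals exact ⟨_, rfl⟩)
    (fun t ht => client_rank_succ fun op' hi' =>
      hidle t ((le_max_right _ _).trans ht) (ρ.idle_of_invokes hi'))
  refine hidle t ((le_max_right _ _).trans ht) ?_
  rcases hr : ρ.cl c t with _ | ⟨op, q⟩ | ⟨res, w⟩ <;> simp [hr, DClient.rank] at h ⊢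

/-! ### Replicas that never crash -/

lemma recov_of_neverCrashes {i : Fin n} (h : ρ.NeverCrashes (.replica i)) (t : ℕ) :
    ρ.recov i t = .completed := by
  induction t with
  | zero => simp [recov, rep_zero]
  | succ t ih =>
    exact recov_completed_succ ih fun hr => ρ.not_up_of_restarts hr (up_of_neverCrashes h t)

/-- At most `k` replicas are faulty and at most `b` are benign. The remaining ones, at least `n - k
- b ≥ k + 1`, never crash and so never enter the restart block. -/
lemma alwaysActive_of_benignBound {b : ℕ} (hn : 2 * k + b + 1 ≤ n) (h : ρ.ThresholdFrom k 0)
    (hb : ρ.BenignBound b) : ρ.AlwaysActive k := by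
  classical
  intro t
  set F : Finset (Fin n) := Finset.univ.filter (ρ.FaultyFrom 0)
  set B : Finset (Fin n) := Finset.univ.filter ρ.Benign
  have hF : F.card ≤ k := by
    refine le_trans (le_of_eq ?_) h
    rw [← Set.ncard_coe_finset]
    congr 1
    ext i; simp [F]
  have hB : B.card ≤ b := by
    refine le_trans (le_of_eq ?_) hb
    rw [← Set.ncard_coe_finset]
    congr 1
    ext i; simp [B]
  have hcard : k + 1 ≤ (F ∪ B)ᶜ.card := by
    rw [Finset.card_compl, Fintype.card_fin]
    have := Finset.card_union_le F B
    omega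
  obtain ⟨S, hS, hSc⟩ := Finset.exists_subset_card_eq hcard
  refine ⟨S, hSc, fun i hi => ?_⟩
  have hi : ¬ ρ.FaultyFrom 0 i ∧ ¬ ρ.Benign i := by simpa [F, B] using hS hi
  have hnc : ρ.NeverCrashes (.replica i) := by
    by_contra hc
    exact hi.2 ⟨hi.1, hc⟩
  exact ⟨⟨0, fun t' _ => up_of_neverCrashes hnc t'⟩, up_of_neverCrashes hnc t,
    not_not.2 (recov_of_neverCrashes hnc t)⟩

end Run

end CRR


namespace CRR

universe u

variable {n k : ℕ} {V : Type u} {v₀ : V}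

/-! ## Good-case latency: upper bound -/

namespace Run

variable {ρ : Run (algorithmD n k v₀)}

lemma stale_of_neverCrashes {i : Fin n} (h : ρ.NeverCrashes (.replica i)) (t : ℕ) :
    ρ.stale i t = false := by
  rw [← Bool.not_eq_true, stale_iff, not_not]
  exact recov_of_neverCrashes h t

/-- A positive entry would be an adopted incarnation number, and the adoption is preceded by a
restart. Hence validations purge no replica that never crashes. -/
lemma cv_of_neverCrashes {i : Fin n} (h : ρ.NeverCrashes (.replica i)) (l : Fin n) (t : ℕ) :
    (ρ.reg l t).cv i = 0 := by
  rcases assigns_of_cv (ρ := ρ) l i t with h0 | ⟨s, -, hs⟩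
  · exact h0
  · obtain ⟨r, hlast, -⟩ := hs.spec
    exact absurd (up_of_neverCrashes h r) (ρ.not_up_of_restarts hlast.restarts)

lemma call_cv_of_neverCrashes {i : Fin n} (h : ρ.NeverCrashes (.replica i)) {p : Proc n} {t : ℕ}
    {w : WriteCall n V} (hw : (ρ.ph p t).write = some w) : w.cv i = 0 := by
  obtain ⟨s, hs⟩ := exists_writeOK p t w hw
  rcases hs.cv i with h0 | ⟨l, r, -, h0⟩
  · exact h0
  · rw [h0, cv_of_neverCrashes h]

variable {τ : ℕ → ℝ}

lemma read_roundtrip_time (hc : ∀ i, ρ.NeverCrashes (.replica i)) (hτ : ρ.UnitDelay τ) {p : Proc n}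
    (hp : ρ.NeverCrashes p) {s id : ℕ} {req : ReadReq n} (l : Fin n)
    (h : ρ.Sends s p (.replica l) (.read id req)) :
    ∃ r > s, ∃ y, ρ.Delivers r (.replica l) p (.readAck id y) ∧ τ r ≤ τ s + 2 := by
  obtain ⟨r, hr, hd, h1⟩ := hτ.2 p _ hp (hc l) s _ h
  obtain ⟨y, -, hy⟩ := ρ.read_served hd (stale_of_neverCrashes (hc l) r)
  obtain ⟨r', hr', hd', h2⟩ := hτ.2 _ p (hc l) hp r _ hy
  exact ⟨r', by omega, y, hd', by linarith⟩

lemma write_roundtrip_time (hc : ∀ i, ρ.NeverCrashes (.replica i)) (hτ : ρ.UnitDelay τ)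
    {p : Proc n} (hp : ρ.NeverCrashes p) {s id inc : ℕ} {req : WriteReq n V} (l : Fin n)
    (h : ρ.Sends s p (.replica l) (.write id req inc)) :
    ∃ r > s, ∃ a : WAck n, ρ.Delivers r (.replica l) p (.writeAck id a.inc a.cv) ∧
      τ r ≤ τ s + 2 := by
  obtain ⟨r, hr, hd, h1⟩ := hτ.2 p _ hp (hc l) s _ h
  obtain ⟨a, -, ha, -⟩ := ρ.write_served hd fun _ => stale_of_neverCrashes (hc l) r
  obtain ⟨r', hr', hd', h2⟩ := hτ.2 _ p (hc l) hp r _ ha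
  exact ⟨r', by omega, a, hd', by linarith⟩

lemma time_sup_le {r : Fin n → ℕ} {x : ℝ} (hn : 0 < n) (h : ∀ l, τ (r l) ≤ x) :
    ∃ l, r l = Finset.univ.sup r ∧ τ (Finset.univ.sup r) ≤ x := by
  obtain ⟨l, -, hl⟩ := Finset.exists_mem_eq_sup Finset.univ ⟨⟨0, hn⟩, Finset.mem_univ _⟩ r
  exact ⟨l, hl.symm, hl ▸ h l⟩

lemma eq_of_query {c t : ℕ} {op : RegOp V} {q : ReadCall n V} (h : ρ.cl c t = .query op q) :
    ρ.ph (.client c) t = .rd q := by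
  simp only [ph, h]; rfl

lemma eq_of_store {c t : ℕ} {res : RegResp V} {w : WriteCall n V} (h : ρ.cl c t = .store res w) :
    ρ.ph (.client c) t = .wr w := by
  simp only [ph, h]; rfl

/-- The first phase takes at most two message delays. -/
lemma exists_store (hk : k < n) (hc : ∀ i, ρ.NeverCrashes (.replica i)) (hτ : ρ.UnitDelay τ)
    {o c : ℕ} {op : RegOp V} (hi : ρ.Invokes o c op) (hp : ρ.NeverCrashes (.client c)) :
    ∃ s > o, τ s ≤ τ o + 2 ∧ ∃ res req, ρ.cl c (s + 1) = .store res (WriteCall.start (ρ.uid s) req) ∧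
      ∀ l, ρ.Sends s (.client c) (.replica l) (.write (ρ.uid s) req 0) := by
  set q₀ : ReadCall n V := ReadCall.start (ρ.uid o) (op.req n) with hq₀
  have hcl : ρ.cl c (o + 1) = .query op q₀ := by
    rw [ρ.cl_invoke hi]
    cases op <;> rfl
  have hsend : ∀ l : Fin n, ρ.Sends o (.client c) (.replica l) (.read q₀.id q₀.req) := fun l =>
    ρ.sends_of_invoke hi (mem_readCall_sends.2 ⟨l, rfl, by cases op <;> rfl⟩)
  choose r hr y hd hτr using fun l => read_roundtrip_time hc hτ hp l (hsend l)
  obtain ⟨-, -, hR⟩ := time_sup_le (by omega) hτr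
  set R := Finset.univ.sup r with hRdef
  have hrR : ∀ l, r l ≤ R := fun l => Finset.le_sup (Finset.mem_univ l)
  have hoR : o < R := (hr ⟨0, by omega⟩).trans_le (hrR _)
  let Q : ℕ → Prop := fun u => ∃ op' q, ρ.cl c u = .query op' q ∧ q.id = q₀.id
  -- The query ends by the time `R` of the last reply: otherwise the replies of all `n` replicas
  -- would be recorded in an incomplete call.
  obtain ⟨s, hs, hsR, hQs, hQs'⟩ : ∃ s > o, s ≤ R ∧ Q s ∧ ¬ Q (s + 1) := by
    by_contra hno
    push Not at hno
    have hQ : ∀ u ≥ o + 1, u ≤ R + 1 → Q u := by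
      intro u hu
      induction u, hu using Nat.le_induction with
      | base => exact fun _ => ⟨op, q₀, hcl, rfl⟩
      | succ u hu ih => exact fun h => hno u hu (by omega) (ih (by omega))
    have hack : ∀ l, ∀ u ≥ r l + 1, u ≤ R + 1 → ∀ op' q, ρ.cl c u = .query op' q →
        (q.acks l).isSome = true := by
      intro l u hu
      induction u, hu using Nat.le_induction with
      | base =>
        intro hle op' q hq
        obtain ⟨op₁, q₁, hq₁, hid₁⟩ := hQ (r l) (hr l) (by omega)
        obtain ⟨op₂, q₂, hq₂, hid₂⟩ := hQ (r l + 1) (by have := hr l; omega) (by omega)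
        rw [hq] at hq₂; cases hq₂
        exact (ph_read_succ (by rw [eq_of_query hq₁]; rfl) (by rw [eq_of_query hq]; rfl)
          (hid₂.trans hid₁.symm)).2.2 l (y l) (by rw [hid₁]; exact hd l)
      | succ u hu ih =>
        intro hle op' q hq
        obtain ⟨op₁, q₁, hq₁, hid₁⟩ := hQ u (by have := hr l; omega) (by omega)
        obtain ⟨op₂, q₂, hq₂, hid₂⟩ := hQ (u + 1) (by have := hr l; omega) (by omega)
        rw [hq] at hq₂; cases hq₂
        exact (ph_read_succ (by rw [eq_of_query hq₁]; rfl) (by rw [eq_of_query hq]; rfl)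
          (hid₂.trans hid₁.symm)).2.1 l (ih (by omega) op₁ q₁ hq₁)
    obtain ⟨op', q, hq, -⟩ := hQ (R + 1) (by omega) le_rfl
    refine read_incomplete (.client c) (R + 1) q (by rw [eq_of_query hq]; rfl) (decide_eq_true ?_)
    have := card_le_count (f := q.acks) (E := Finset.univ) fun l _ =>
      hack l (R + 1) (by have := hrR l; omega) le_rfl op' q hq
    rw [Finset.card_univ, Fintype.card_fin] at this
    omega
  obtain ⟨op', q, hq, hid⟩ := hQs
  refine ⟨s, hs, (hτ.1 hsR).trans hR, ?_⟩
  rcases ρ.cl_cases c s with ⟨op₁, hi₁⟩ | ⟨h, -⟩ | ⟨j, m, x, hdel, hcr, -⟩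
  · have := ρ.idle_of_invokes hi₁
    rw [hq] at this; cases this
  · exact absurd ⟨op', q, h.trans hq, hid⟩ hQs'
  · obtain ⟨res, req, hst⟩ : ∃ res req,
        ρ.cl c (s + 1) = .store res (WriteCall.start (ρ.uid s) req) := by
      generalize hs' : ρ.cl c (s + 1) = s' at hcr
      rw [hq] at hcr
      rcases hcr with _ | ⟨_, _, y⟩ | ⟨_, _, y, hcomp⟩ | _ | _
      · exact absurd ⟨op', q, hs', hid⟩ hQs'
      · exact absurd ⟨op', q.record j y, hs', hid⟩ hQs'
      · cases op' <;> exact ⟨_, _, rfl⟩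
    refine ⟨res, req, hst, fun l => ?_⟩
    obtain ⟨L, ⟨-, hmove⟩, hL⟩ := ρ.ph_delivers hdel
    rw [eq_of_query hq, eq_of_store hst] at hmove
    rcases hmove with ⟨hstep, -⟩ | ⟨-, -, hall⟩
    · cases hstep
    · exact (hL _ _).2 (hall _ (WriteCall.mem_resend (w := WriteCall.start (ρ.uid s) req) rfl rfl))

/-- Without crashes, every operation returns within four message delays. -/
theorem exists_returns_time (hk : k < n) (hc : ∀ i, ρ.NeverCrashes (.replica i))
    (hτ : ρ.UnitDelay τ) {o c : ℕ} {op : RegOp V} (hi : ρ.Invokes o c op)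
    (hp : ρ.NeverCrashes (.client c)) : ∃ s r, ρ.Returns o s r ∧ τ s ≤ τ o + 4 := by
  classical
  by_contra hno
  push Not at hno
  have hresp : ∀ u ≥ o, τ u ≤ τ o + 4 → ∀ r, ρ.resp u ≠ some (c, r) := by
    intro u
    induction u using Nat.strong_induction_on with
    | _ u ih =>
    intro hu hle r hr
    refine absurd (hno u r ⟨c, op, hi, hu, hr, fun u' h1 h2 => ?_⟩) (not_lt.2 hle)
    exact ih u' h2 h1 ((hτ.1 h2.le).trans hle)
  obtain ⟨s, hs, hτs, res, req, hst, hsend⟩ := exists_store hk hc hτ hi hp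
  set w₀ : WriteCall n V := WriteCall.start (ρ.uid s) req
  choose r hr a hd hτr using fun l => write_roundtrip_time hc hτ hp l (hsend l)
  -- Among the chosen acknowledgements, that of `j` arrives last, in step `R`; this is within four
  -- units of the invocation.
  obtain ⟨j, hj, hR⟩ := time_sup_le (by omega) hτr
  set R := Finset.univ.sup r with hRdef
  have hrR : ∀ l, r l ≤ R := fun l => Finset.le_sup (Finset.mem_univ l)
  have hsR : s < R := (hr ⟨0, by omega⟩).trans_le (hrR _)
  have hstore : ∀ u ≥ s + 1, u ≤ R + 1 → ∃ w, ρ.cl c u = .store res w ∧ w.id = w₀.id := by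
    intro u hu
    induction u, hu using Nat.le_induction with
    | base => exact fun _ => ⟨w₀, hst, rfl⟩
    | succ u hu ih =>
      intro hle
      obtain ⟨w, hw, hid⟩ := ih (by omega)
      have hτu : τ u ≤ τ o + 4 := (hτ.1 (by omega : u ≤ R)).trans (by linarith)
      rcases ρ.cl_cases c u with ⟨op₁, hi₁⟩ | ⟨h, -⟩ | ⟨i, m, x, hdel, hcr, hrsp⟩
      · have := ρ.idle_of_invokes hi₁
        rw [hw] at this; cases this
      · exact ⟨w, h.trans hw, hid⟩
      · have hnone : ∀ r, x ≠ some r := fun r hx => hresp u (by omega) hτu r ((hrsp r).2 hx)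
        generalize hs' : ρ.cl c (u + 1) = s' at hcr
        rw [hw] at hcr
        rcases hcr with _ | _ | _ | ⟨_, _, _, w', h⟩ | _
        · exact ⟨w, rfl, hid⟩
        · exact ⟨w', rfl, h.req.2.trans hid⟩
        · exact absurd rfl (hnone _)
  have hwrite : ∀ u w, ρ.cl c u = .store res w → (ρ.ph (.client c) u).write = some w :=
    fun u w hw => by rw [eq_of_store hw]; rfl
  have hack : ∀ l, ∀ u ≥ r l + 1, u ≤ R + 1 → ∀ w, ρ.cl c u = .store res w → w.Has l 0 := by
    intro l u hu
    induction u, hu using Nat.le_induction with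
    | base =>
      intro hle w hw
      obtain ⟨w₁, hw₁, hid₁⟩ := hstore (r l) (hr l) (by omega)
      obtain ⟨w₂, hw₂, hid₂⟩ := hstore (r l + 1) (by have := hr l; omega) (by omega)
      rw [hw] at hw₂; cases hw₂
      have h0 := call_cv_of_neverCrashes (hc l) (hwrite _ _ hw)
      rcases ph_write_succ (hwrite _ _ hw₁) (hwrite _ _ hw) (hid₂.trans hid₁.symm) with
        ⟨h', -⟩ | ⟨i, m, hdel, hstep, -⟩
      · exact absurd (hd l) (h' _ _)
      · have hdl := hd l
        unfold Delivers at hdel hdl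
        rw [hdl] at hdel
        cases hdel
        rw [show ρ.uid s = w₁.id from hid₁.symm] at hstep
        obtain ⟨b, hb, -⟩ := hstep.has_ack (h0 ▸ Nat.zero_le _)
        exact ⟨b, hb, Nat.zero_le _⟩
    | succ u hu ih =>
      intro hle w hw
      obtain ⟨w₁, hw₁, hid₁⟩ := hstore u (by have := hr l; omega) (by omega)
      obtain ⟨w₂, hw₂, hid₂⟩ := hstore (u + 1) (by have := hr l; omega) (by omega)
      rw [hw] at hw₂; cases hw₂
      have h0 := call_cv_of_neverCrashes (hc l) (hwrite _ _ hw)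
      rcases ph_write_succ (hwrite _ _ hw₁) (hwrite _ _ hw) (hid₂.trans hid₁.symm) with
        ⟨-, rfl⟩ | ⟨i, m, -, hstep, -⟩
      · exact ih (by omega) _ hw₁
      · exact hstep.has (ih (by omega) _ hw₁) h0.le
  -- the last acknowledgement completes the call
  obtain ⟨w₁, hw₁, hid₁⟩ := hstore R hsR (by omega)
  obtain ⟨w₂, hw₂, hid₂⟩ := hstore (R + 1) (by omega) le_rfl
  have hin : w₂.inner = none := (ρ.cl_storeOK c (R + 1) res w₂ hw₂).2
  have hin₁ : w₁.inner = none := (ρ.cl_storeOK c R res w₁ hw₁).2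
  have hdj := hd j
  rw [hj] at hdj
  rcases ph_write_succ (hwrite _ _ hw₁) (hwrite _ _ hw₂) (hid₂.trans hid₁.symm) with
    ⟨h', -⟩ | ⟨i, m, hdel, hstep, -⟩
  · exact absurd hdj (h' _ _)
  · unfold Delivers at hdel hdj
    rw [hdj] at hdel
    cases hdel
    rw [show ρ.uid s = w₁.id from hid₁.symm] at hstep
    have hmerged : ∀ l, ∃ b, (w₁.merged j (a j)).Q l = some b := by
      intro l
      by_cases hl : l = j
      · subst hl
        obtain ⟨b, hb, -⟩ := WriteCall.has_merged w₁ l (a l)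
        exact ⟨b, hb⟩
      -- A step delivers only one message, so the other acknowledgements arrived strictly before
      -- step `R` and are already recorded.
      · have hne : r l ≠ R := by
          intro he
          have hdl := hd l
          unfold Delivers at hdl
          rw [he, hdj] at hdl
          cases hdl
          exact hl rfl
        obtain ⟨b, hb, -⟩ := (hack l R (by have := hrR l; omega) (by omega) _ hw₁).merged j (a j)
        exact ⟨b, hb⟩
    have hfull : ∀ f : Fin n → Option (WAck n), (∀ l, ∃ b, f l = some b) → n - k ≤ count f := by
      intro f hf
      have := card_le_count (f := f) (E := Finset.univ) fun l _ => by
        obtain ⟨b, hb⟩ := hf l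
        rw [hb]; rfl
      rw [Finset.card_univ, Fintype.card_fin] at this
      omega
    rcases hstep.of_ack with ⟨-, h⟩ | ⟨q, rfl⟩ | ⟨S, -, rfl⟩
    · exact absurd (hfull _ hmerged) (not_le.2 (h hin₁))
    · cases hin
    · refine absurd (hfull _ fun l => ?_) (not_le.2 (count_Q_lt hk _ _ _ (hwrite _ _ hw₂) hin))
      obtain ⟨b, hb⟩ := hmerged l
      refine ⟨b, WriteCall.validate_Q hb ?_⟩
      rw [call_cv_of_neverCrashes (hc l) (hwrite _ _ hw₂)]
      exact Nat.zero_le _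

end Run

end CRR


namespace CRR

universe u

variable {n k : ℕ} {V : Type u} {v₀ : V}

/-! ## Good-case latency: lower bound

A run in which messages are delivered in the order in which they have been sent, each of them one
unit of time later. -/

/-- A configuration, the pending actions with their times, and the current time. -/
structure Fifo (A : Implementation n V) : Type u where
  cfg : Config A
  queue : List (Action A × ℕ)
  now : ℕ

namespace Fifo

variable {A : Implementation n V}

def act (s : Fifo A) : Action A := (s.queue.head?.map Prod.fst).getD .skip

def time (s : Fifo A) : ℕ := (s.queue.head?.map Prod.snd).getD s.now

def next (x : ℕ) (s : Fifo A) : Fifo A where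
  cfg := (s.cfg.perform x s.act).next
  queue := s.queue.tail ++
    (s.cfg.perform x s.act).sent.map fun p => (.deliver p.src p.dst p.msg, s.time + 1)
  now := s.time

/-- The first client invokes `op`, and all messages are delivered. -/
def sim (A : Implementation n V) (op : RegOp V) : ℕ → Fifo A
  | 0 => ⟨Config.initial A, [(.invoke 0 op, 0)], 0⟩
  | t + 1 => (sim A op t).next t

variable (op : RegOp V)

/-- All pending times lie within one unit of the present, so a message appended with the current
time plus one keeps the queue sorted; first-in first-out is then the order of time. -/
lemma queue_spec (t : ℕ) :
    (sim A op t).queue.Pairwise (fun e e' => e.2 ≤ e'.2) ∧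
    (∀ e ∈ (sim A op t).queue, (sim A op t).now ≤ e.2 ∧ e.2 ≤ (sim A op t).now + 1) := by
  induction t with
  | zero => simp [sim]
  | succ t ih =>
    obtain ⟨h1, h2⟩ := ih
    simp only [sim]
    generalize sim A op t = s at h1 h2
    obtain ⟨g, _ | ⟨e, Q⟩, x⟩ := s
    · simp [next, act, Config.perform]
    · rw [List.pairwise_cons] at h1
      have he := h2 e (by simp)
      have hQ : ∀ e' ∈ Q, e.2 ≤ e'.2 ∧ e'.2 ≤ e.2 + 1 := fun e' he' =>
        ⟨h1.1 e' he', by have := h2 e' (by simp [he']); omega⟩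
      simp only [next, time, List.head?_cons, Option.map_some, Option.getD_some, List.tail_cons]
      refine ⟨List.pairwise_append.2 ⟨h1.2, ?_, ?_⟩, ?_⟩
      · rw [List.pairwise_map]
        exact List.pairwise_of_forall fun _ _ => le_rfl
      · intro e' he' f hf
        obtain ⟨p, -, rfl⟩ := List.mem_map.1 hf
        exact (hQ e' he').2
      · intro e' he'
        rcases List.mem_append.1 he' with he' | he'
        · exact hQ e' he'
        · obtain ⟨p, -, rfl⟩ := List.mem_map.1 he'
          simp

lemma now_le_time (t : ℕ) : (sim A op t).now ≤ (sim A op t).time := by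
  have := (queue_spec (A := A) op t).2
  generalize sim A op t = s at this
  obtain ⟨g, _ | ⟨e, Q⟩, x⟩ := s
  · exact le_rfl
  · exact (this e (by simp)).1

lemma time_mono : Monotone fun t => (sim A op t).time :=
  monotone_nat_of_le_succ fun t => now_le_time op (t + 1)

lemma exists_sent (t : ℕ) : ∀ e ∈ (sim A op (t + 1)).queue, ∃ src dst m, e.1 = .deliver src dst m ∧
    ∃ s < t + 1, (⟨src, dst, m⟩ : Packet A) ∈
      ((sim A op s).cfg.perform s (sim A op s).act).sent ∧ e.2 = (sim A op s).time + 1 := by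
  have hnew : ∀ t, ∀ e ∈ ((sim A op t).cfg.perform t (sim A op t).act).sent.map fun p =>
      ((.deliver p.src p.dst p.msg, (sim A op t).time + 1) : Action A × ℕ),
      ∃ src dst m, e.1 = .deliver src dst m ∧ ∃ s < t + 1, (⟨src, dst, m⟩ : Packet A) ∈
      ((sim A op s).cfg.perform s (sim A op s).act).sent ∧ e.2 = (sim A op s).time + 1 := by
    intro t e he
    obtain ⟨⟨src, dst, m⟩, hp, rfl⟩ := List.mem_map.1 he
    exact ⟨src, dst, m, rfl, t, t.lt_succ_self, hp, rfl⟩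
  induction t with
  | zero =>
    intro e he
    rcases List.mem_append.1 he with he | he
    · simp [sim] at he
    · exact hnew 0 e he
  | succ t ih =>
    intro e he
    rcases List.mem_append.1 he with he | he
    · obtain ⟨src, dst, m, h, s, hs, h'⟩ := ih e (List.mem_of_mem_tail he)
      exact ⟨src, dst, m, h, s, by omega, h'⟩
    · exact hnew (t + 1) e he

lemma act_cases (t : ℕ) : (t = 0 ∧ (sim A op t).act = .invoke 0 op) ∨ (sim A op t).act = .skip ∨
    ∃ src dst m, (sim A op t).act = .deliver src dst m ∧ ∃ s < t, (⟨src, dst, m⟩ : Packet A) ∈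
      ((sim A op s).cfg.perform s (sim A op s).act).sent ∧
        (sim A op t).time = (sim A op s).time + 1 := by
  rcases t with _ | t
  · exact .inl ⟨rfl, rfl⟩
  · right
    have := exists_sent (A := A) op t
    rcases hq : (sim A op (t + 1)).queue with _ | ⟨e, Q⟩
    · exact .inl (by simp [act, hq])
    · obtain ⟨src, dst, m, h, h'⟩ := this e (by simp [hq])
      exact .inr ⟨src, dst, m, by simp [act, hq, h], by simpa [time, hq] using h'⟩

lemma up (t : ℕ) (p : Proc n) : (sim A op t).cfg.up p := by
  induction t with
  | zero => cases p <;> rfl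
  | succ t ih =>
    simp only [sim, next]
    rcases act_cases (A := A) op t with ⟨-, h⟩ | h | ⟨src, dst, m, h, -⟩ <;> rw [h]
    · cases p <;> exact ih
    · exact ih
    · rcases dst with j | d
      · rcases p with l | c
        · simp only [Config.perform, Config.replicaOutcome, Config.up, Function.update_apply]
          split_ifs
          · rfl
          · exact ih
        · exact ih
      · cases p <;> exact ih

/-- The run. -/
def run (A : Implementation n V) (op : RegOp V) : Run A where
  cfg t := (sim A op t).cfg
  act t := (sim A op t).act
  uid := id
  uid_injective := Function.injective_id
  cfg_zero := rfl
  cfg_succ _ := rfl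
  enabled t := by
    rcases act_cases (A := A) op t with ⟨rfl, h⟩ | h | ⟨src, dst, m, h, -⟩ <;> rw [h]
    · exact ⟨rfl, rfl⟩
    · trivial
    · exact up op t dst
  deliver_sent t src dst m h := by
    rcases act_cases (A := A) op t with ⟨-, h'⟩ | h' | ⟨src', dst', m', h', s, hs, hm, -⟩ <;>
      rw [h'] at h <;> cases h
    exact ⟨s, hs, hm⟩
  restart_keep t i d h := by
    rcases act_cases (A := A) op t with ⟨-, h'⟩ | h' | ⟨src', dst', m', h', -⟩ <;>
      rw [h'] at h <;> cases h
  restart_rollback t i d h := by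
    rcases act_cases (A := A) op t with ⟨-, h'⟩ | h' | ⟨src', dst', m', h', -⟩ <;>
      rw [h'] at h <;> cases h

lemma run_neverCrashes (p : Proc n) : (run A op).NeverCrashes p := by
  intro t h
  change (sim A op t).act = _ at h
  rcases act_cases (A := A) op t with ⟨-, h'⟩ | h' | ⟨src', dst', m', h', -⟩ <;>
    rw [h'] at h <;> cases h

lemma run_invokes : (run A op).Invokes 0 0 op := rfl

/-- One entry leaves the front of the queue per step and new ones are appended at the end, so the
entry at position `i` is executed `i` steps later. -/
lemma act_of_getElem {t i : ℕ} {e : Action A × ℕ} (h : (sim A op t).queue[i]? = some e) :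
    (sim A op (t + i)).act = e.1 ∧ (sim A op (t + i)).time = e.2 := by
  induction i generalizing t with
  | zero =>
    rw [← List.head?_eq_getElem?] at h
    simp [act, time, h]
  | succ i ih =>
    rw [show t + (i + 1) = t + 1 + i by omega]
    apply ih
    simp only [sim, next]
    rw [← List.getElem?_tail] at h
    obtain ⟨hlt, -⟩ := List.getElem?_eq_some_iff.1 h
    rw [List.getElem?_append_left hlt, h]

lemma run_unitDelay : (run A op).UnitDelay fun t => ((sim A op t).time : ℝ) := by
  refine ⟨fun a b h => Nat.cast_le.2 (time_mono op h), fun p q _ _ s m hm => ?_⟩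
  have hmem : ((.deliver p q m, (sim A op s).time + 1) : Action A × ℕ) ∈
      (sim A op (s + 1)).queue :=
    List.mem_append_right _ (List.mem_map.2 ⟨_, hm, rfl⟩)
  obtain ⟨i, hi⟩ := List.mem_iff_getElem?.1 hmem
  obtain ⟨h1, h2⟩ := act_of_getElem op hi
  refine ⟨s + 1 + i, by omega, h1, ?_⟩
  simp only [h2]
  push_cast
  exact le_rfl

end Fifo

/-- The number of messages in the causal chain of an operation up to the message. -/
def DMsg.level : DMsg n V → ℕ
  | .read _ _ => 1
  | .readAck _ _ => 2
  | .write _ _ _ => 3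
  | .writeAck _ _ _ => 4

/-- A client sends a write request only on receipt of an acknowledgement. -/
lemma two_le_level {c x : ℕ} {src d : Proc n} {m : DMsg n V} {s : DClient n V} {id inc : ℕ}
    {req : WriteReq n V} (h : (d, .write id req inc) ∈ (dClientRecv k v₀ c x src m s).sends) :
    2 ≤ m.level := by
  unfold dClientRecv at h
  split at h
  · exact le_rfl
  · exact Nat.le_of_ble_eq_true rfl
  · cases h

/-! ### Causal chains take time in the lower-bound run -/

namespace Fifo

variable (op : RegOp V)

lemma exists_sends_time {t : ℕ} {src dst : Proc n} {m : DMsg n V}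
    (h : (run (algorithmD n k v₀) op).Delivers t src dst m) :
    ∃ s < t, (run (algorithmD n k v₀) op).Sends s src dst m ∧
      (sim (algorithmD n k v₀) op t).time = (sim (algorithmD n k v₀) op s).time + 1 := by
  change (sim (algorithmD n k v₀) op t).act = _ at h
  rcases act_cases (A := algorithmD n k v₀) op t with ⟨-, h'⟩ | h' |
    ⟨src', dst', m', h', s, hs, hm, ht⟩ <;> rw [h'] at h <;> cases h
  exact ⟨s, hs, hm, ht⟩

/-- Every message is delivered exactly one unit after it was sent, and a message of level at least
two is sent on receipt of a message of at least the preceding level. -/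
lemma level_le_time {t : ℕ} {src dst : Proc n} {m : DMsg n V}
    (h : (run (algorithmD n k v₀) op).Delivers t src dst m) :
    m.level ≤ (sim (algorithmD n k v₀) op t).time := by
  induction t using Nat.strong_induction_on generalizing src dst m with
  | _ t ih =>
  obtain ⟨s, hs, hsend, ht⟩ := exists_sends_time op h
  rw [ht]
  rcases m with ⟨id, req⟩ | ⟨id, y⟩ | ⟨id, req, inc⟩ | ⟨id, inc, cv⟩
  · simp [DMsg.level]
  · obtain ⟨l, -, ⟨id', req, y', -, hy⟩ | ⟨id', req, a, hm, -⟩⟩ :=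
      Run.served_of_sends _ hsend (fun h => h)
    · have := ih s hs hy.delivers
      simp only [DMsg.level] at this ⊢
      omega
    · cases hm
  · suffices 2 ≤ (sim (algorithmD n k v₀) op s).time by simp only [DMsg.level]; omega
    rcases Run.sends_cases _ hsend with ⟨c, op', -, -, hs'⟩ | ⟨c, src', m', rfl, hd, hs'⟩ |
      ⟨l, src', m', rfl, hd, hs'⟩ | ⟨l, -, -, hs'⟩ | ⟨ha, -⟩
    · obtain ⟨z, -, hz⟩ := mem_readCall_sends.1 hs'
      cases hz
    · exact (two_le_level hs').trans (ih s hs hd)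
    · have hmem := Run.mem_sends_of_sends _ hsend trivial
      simp only [Run.ph, Run.recov_of_neverCrashes (run_neverCrashes op _)] at hmem
      cases hmem
    · obtain ⟨z, -, hz⟩ := mem_readCall_sends.1 hs'
      cases hz
    · change (sim (algorithmD n k v₀) op s).act = _ at ha
      rcases act_cases (A := algorithmD n k v₀) op s with ⟨-, h'⟩ | h' | ⟨_, _, _, h', -⟩ <;>
        rw [h'] at ha <;> cases ha
  · obtain ⟨l, -, ⟨id', req, y', hm, -⟩ | ⟨id', req, a, -, ha⟩⟩ :=
      Run.served_of_sends _ hsend (fun h => h)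
    · cases hm
    · obtain ⟨inc', hd⟩ := ha.delivers
      have := ih s hs hd
      simp only [DMsg.level] at this ⊢
      omega

/-- A client has no inner read in its second phase, so the message that completes an operation is a
write acknowledgement, of level four. -/
theorem four_le_time {s : ℕ} {r : RegResp V}
    (h : (run (algorithmD n k v₀) op).Returns 0 s r) :
    4 ≤ (sim (algorithmD n k v₀) op s).time := by
  obtain ⟨c, op', -, -, hr, -⟩ := h
  obtain ⟨-, w, j, m, hw, hd, w', S, hv, -⟩ := Run.resp_spec _ hr
  have hin := (Run.cl_storeOK _ c s r w hw).2
  have := level_le_time op hd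
  rcases hv with ⟨_, a, _, _, _⟩ | ⟨_, q, y, hq, _⟩
  · exact this
  · rw [hin] at hq; cases hq

end Fifo

theorem goodCaseLatency (hk : k < n) {K : Set (RegOp V)} (hK : K.Nonempty) :
    (algorithmD n k v₀).GoodCaseLatency K 4 := by
  refine ⟨fun ρ τ hc hτ t c op _ hi hp => Run.exists_returns_time hk hc hτ hi hp, fun x hx => ?_⟩
  obtain ⟨op, hop⟩ := hK
  obtain ⟨s, r, hr, hle⟩ := hx (Fifo.run _ op) _ (fun i => Fifo.run_neverCrashes op _)
    (Fifo.run_unitDelay op) 0 0 op hop (Fifo.run_invokes op) (Fifo.run_neverCrashes op _)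
  have h4 : (4 : ℝ) ≤ ((Fifo.sim (algorithmD n k v₀) op s).time : ℝ) := by
    exact_mod_cast Fifo.four_le_time op hr
  have h0 : (Fifo.sim (algorithmD n k v₀) op 0).time = 0 := rfl
  simp only [h0, Nat.cast_zero, zero_add] at hle
  exact h4.trans hle

end CRR

theorem mainTheorem2 {V : Type*} (v₀ : V) (n k b : ℕ) (hn : 2 * k + b + 1 ≤ n) :
    (CRR.algorithmD n k v₀).EventuallyTolerantAtomic k v₀ ∧
    (∀ ρ : CRR.Run (CRR.algorithmD n k v₀), ρ.Fair → ρ.ReliableChannels →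
      (ρ.ThresholdFrom k 0 ∧ ρ.BenignBound b) ∨ ((∃ t, ρ.ThresholdFrom k t) ∧ ρ.AlwaysActive k) →
      ρ.WaitFree) ∧
    (CRR.algorithmD n k v₀).GoodCaseLatency {op | op = .read} 4 ∧
    (CRR.algorithmD n k v₀).GoodCaseLatency {op | ∃ v, op = .write v} 4 := by
  refine ⟨fun ρ _ => ρ.linearizable, fun ρ hF hR h => ?_, ?_, ?_⟩
  · rcases h with ⟨h, hb⟩ | ⟨h, h'⟩
    · exact CRR.Run.waitFree_of_alwaysActive hF hR (by omega) ⟨0, h⟩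
        (CRR.Run.alwaysActive_of_benignBound hn h hb)
    · exact CRR.Run.waitFree_of_alwaysActive hF hR (by omega) h h'
  · exact CRR.goodCaseLatency (by omega) ⟨.read, rfl⟩
  · exact CRR.goodCaseLatency (by omega) ⟨.write v₀, v₀, rfl⟩
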